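/- Let $B\subset\mathbb{R}^2$ be the open unit disc, with polar coordinates $(R,\theta)$ and $e_R(\theta)=(\cos\theta,\sin\theta)$, $e_\theta(\theta)=(-\sin\theta,\cos\theta)$. Let $\nu>0$, $b\in\mathbb{R}^2$, $N\in\mathbb{N}$ with $N\ge 2$, and $a\in(N^2-N,N^2+N)$. Put $$f(x,\xi)=\nu\left[a(e_R^T\xi e_R)^2+(e_R^T\xi e_\theta)^2+a(e_\theta^T\xi e_R)^2+(e_\theta^T\xi e_\theta)^2\right],\qquad x\in B\setminus\{0\},\ \xi\in\mathbb{R}^{2\times2},$$ $E(u)=\int_B f(x,\nabla u)\,dx$ for $u\in W^{1,2}(B,\mathbb{R}^2)$, and let $\mathcal{A}^c$ be the set of all $u\in W^{1,2}(B,\mathbb{R}^2)$ with $\det\nabla u=1$ a.e. in $B$ and $u=\frac{1}{\sqrt N}e_R(N\theta)+b$ on $\partial B$ in the sense of traces. Then the following hold. (i) $f(x,\xi)=\nu M(x)\xi\cdot\xi$ for $x\in B\setminus\{0\}$ with $M\in L^\infty(B,\mathbb{R}^{16})$ given by $$M=a(e_R\otimes e_R)(e_R\otimes e_R)+(e_R\otimes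 e_\theta)(e_R\otimes e_\theta)+a(e_\theta\otimes e_R)(e_\theta\otimes e_R)+(e_\theta\otimes e_\theta)(e_\theta\otimes e_\theta),$$ where $((p\otimes q)(r\otimes s))\xi\cdot\xi=(p^T\xi q)(r^T\xi s)$; and $\nu|\xi|^2\le\nu M(x)\xi\cdot\xi$ for all $x\in B\setminus\{0\}$ and all $\xi$. (ii) $M$ has no limit at $0$, and neither has $x\mapsto f(x,\xi)$, for any $\xi\in\mathbb{R}^{2\times2}$ for which $\xi^T\xi$ is not a scalar multiple of the identity. (iii) $M$, and $x\mapsto f(x,\xi)$ for every $\xi$ as in (ii), belong to $W^{1,q}\setminus W^{1,2}$ on $B$ for all $1\le q<2$. (iv) The map $u=\frac{R}{\sqrt N}e_R(N\theta)+b$ is Lipschitz on $B$ but not in $C^1(B,\mathbb{R}^2)$. It is a stationary point of $E$ under the constraint $\det\nabla u=1$: $\frac{d}{dt}E(u+t\eta)|_{t=0}=0$ for all $\eta\in W_0^{1,2}(B,\mathbb{R}^2)$ with $\operatorname{cof}\nabla u\cdot\nabla\eta=0$ a.e. There is a corresponding pressure $\lambda$, with $\lambda\in W^{1,q}(B)$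 for all $1\le q<2$ and $$\int_B\nu M(x)\nabla u\cdot\nabla\eta\,dx=-\int_B\lambda\operatorname{cof}\nabla u\cdot\nabla\eta\,dx\quad\text{for all }\eta\in C_c^\infty(B,\mathbb{R}^2).$$ (v) $u$ is the unique global minimizer of $E$ in $\mathcal{A}^c$ (unique up to null sets). (vi) $\min_{v\in\mathcal{A}^c}E(v)=\nu\pi\left(\frac{a}{N}+N\right)$. -/

import Mathlib

open MeasureTheory Set Filter Topology
open scoped ContDiff ENNReal

noncomputable section

namespace IncompressibleDisc

/-- The Euclidean plane. -/
abbrev Plane : Type := EuclideanSpace ℝ (Fin 2)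

/-- Real two by two matrices. -/
abbrev Mat : Type := Matrix (Fin 2) (Fin 2) ℝ

/-- Fourth-order tensors, i.e. the sixteen-dimensional space of linear maps on matrices. -/
abbrev Tensor : Type := Fin 2 → Fin 2 → Fin 2 → Fin 2 → ℝ

/-- The open unit disc. -/
def disc : Set Plane := Metric.ball 0 1

/-- Lebesgue measure on the disc. -/
def discMeasure : Measure Plane := volume.restrict disc

/-! Polar coordinates -/

/-- The radial unit vector with angle `θ`. -/
def eR (θ : ℝ) : Plane := !₂[Real.cos θ, Real.sin θ]

/-- The angular unit vector with angle `θ`. -/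
def eTheta (θ : ℝ) : Plane := !₂[-Real.sin θ, Real.cos θ]

/-- The polar angle of a point; the polar radius is `‖x‖`. -/
def angle (x : Plane) : ℝ := Complex.arg ⟨x 0, x 1⟩

/-! Matrices and tensors -/

/-- The bilinear form `pᵀ ξ q`. -/
def sandwich (p : Plane) (ξ : Mat) (q : Plane) : ℝ := ∑ i, ∑ j, p i * ξ i j * q j

/-- The Frobenius inner product of two matrices. -/
def frob (ξ ζ : Mat) : ℝ := ∑ i, ∑ j, ξ i j * ζ i j

/-- The cofactor matrix, i.e. the transpose of the adjugate. -/
def cof (ξ : Mat) : Mat := ξ.adjugate.transpose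

/-- The tensor product `p ⊗ q` of two vectors. -/
def outer (p q : Plane) : Mat := Matrix.of fun i j => p i * q j

/-- The tensor `A B` acting by `(A B) ξ · ζ = (A · ξ) (B · ζ)`. -/
def tensorMul (A B : Mat) : Tensor := fun i j k l => A i j * B k l

/-- The action of a tensor on a matrix: `(T ξ)ₖₗ = ∑ᵢⱼ Tᵢⱼₖₗ ξᵢⱼ`. -/
def Tensor.act (T : Tensor) (ξ : Mat) : Mat := Matrix.of fun k l => ∑ i, ∑ j, T i j k l * ξ i j

/-- `ξ` is conformal or anticonformal (possibly zero): `ξᵀ ξ` is a multiple of the identity. -/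
def IsConformalMat (ξ : Mat) : Prop := ∃ c : ℝ, ξ.transpose * ξ = c • (1 : Mat)

/-! Sobolev spaces on the disc -/

/-- The `j`-th classical partial derivative of a scalar function. -/
def partialDeriv (j : Fin 2) (φ : Plane → ℝ) (x : Plane) : ℝ :=
  fderiv ℝ φ x (EuclideanSpace.single j 1)

/-- The classical gradient `(∇φ)ᵢⱼ = ∂ⱼ φᵢ` of a vector-valued map. -/
def jac (φ : Plane → Plane) (x : Plane) : Mat :=
  Matrix.of fun i j => fderiv ℝ φ x (EuclideanSpace.single j 1) i

/-- Smooth functions with compact support in the disc. -/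
def IsTest {F : Type*} [NormedAddCommGroup F] [NormedSpace ℝ F] (φ : Plane → F) : Prop :=
  ContDiff ℝ ∞ φ ∧ HasCompactSupport φ ∧ tsupport φ ⊆ disc

/-- `g` is the weak partial derivative of `f` in direction `j` on the disc. -/
def HasWeakPartial (j : Fin 2) (f g : Plane → ℝ) : Prop :=
  LocallyIntegrableOn f disc volume ∧ LocallyIntegrableOn g disc volume ∧
    ∀ φ : Plane → ℝ, IsTest φ →
      ∫ x, f x * partialDeriv j φ x ∂discMeasure = -∫ x, g x * φ x ∂discMeasure

/-- The space `W^{1,q}` of scalar functions on the disc. -/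
def MemW1 (q : ℝ≥0∞) (f : Plane → ℝ) : Prop :=
  MemLp f q discMeasure ∧
    ∀ j, ∃ g : Plane → ℝ, HasWeakPartial j f g ∧ MemLp g q discMeasure

/-- The space `W^{1,q}` of tensor fields on the disc. -/
def TensorMemW1 (q : ℝ≥0∞) (T : Plane → Tensor) : Prop :=
  ∀ i j k l, MemW1 q fun x => T x i j k l

/-- The space `W^{1,2}` of plane-valued maps on the disc. -/
def MapMemW12 (u : Plane → Plane) : Prop := ∀ i, MemW1 2 fun x => u x i

/-- `G` is a weak gradient of the map `u` on the disc, `Gᵢⱼ = ∂ⱼ uᵢ`. -/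
def HasWeakGrad (u : Plane → Plane) (G : Plane → Mat) : Prop :=
  ∀ i j, HasWeakPartial j (fun x => u x i) fun x => G x i j

open Classical in
/-- The weak gradient of a map (unique up to null sets of the disc when it exists). -/
def weakGrad (u : Plane → Plane) : Plane → Mat :=
  if h : ∃ G, HasWeakGrad u G then h.choose else 0

/-- Convergence in `W^{1,2}` on the disc of smooth maps `φ n` to `u ∈ W^{1,2}`. -/
def TendstoW12 (φ : ℕ → Plane → Plane) (u : Plane → Plane) : Prop :=
  Tendsto (fun n => eLpNorm (fun x => φ n x - u x) 2 discMeasure) atTop (𝓝 0) ∧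
    ∀ i j, Tendsto (fun n => eLpNorm (fun x => jac (φ n) x i j - weakGrad u x i j) 2 discMeasure)
      atTop (𝓝 0)

/-- The space `W₀^{1,2}` of plane-valued maps: the closure of the test maps in `W^{1,2}`. -/
def MapMemW012 (η : Plane → Plane) : Prop :=
  MapMemW12 η ∧ ∃ φ : ℕ → Plane → Plane, (∀ n, IsTest (φ n)) ∧ TendstoW12 φ η

/-- The map `u ∈ W^{1,2}` has trace `θ ↦ h θ` on the unit circle: for some maps, smooth up to the
boundary, that converge to `u` in `W^{1,2}`, the restrictions to the circle converge to `h` in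
`L²`. -/
def HasTrace (u : Plane → Plane) (h : ℝ → Plane) : Prop :=
  ∃ φ : ℕ → Plane → Plane, (∀ n, ContDiff ℝ ∞ (φ n)) ∧ TendstoW12 φ u ∧
    Tendsto (fun n => eLpNorm (fun θ => φ n (eR θ) - h θ) 2
      (volume.restrict (Ioc 0 (2 * Real.pi)))) atTop (𝓝 0)

/-- The incompressible maps in `W^{1,2}` of the disc with boundary values `h`. -/
def Admissible (h : ℝ → Plane) : Set (Plane → Plane) :=
  {u | MapMemW12 u ∧ (∀ᵐ x ∂discMeasure, (weakGrad u x).det = 1) ∧ HasTrace u h}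

/-- The energy `∫ f(x, ∇u) dx` over the disc. -/
def energy (f : Plane → Mat → ℝ) (u : Plane → Plane) : ℝ :=
  ∫ x, f x (weakGrad u x) ∂discMeasure

/-- `u` is a stationary point of the energy under the constraint `det ∇u = 1`: the first variation
vanishes in all directions `η ∈ W₀^{1,2}` that satisfy the linearized constraint. -/
def IsStationaryPoint (f : Plane → Mat → ℝ) (u : Plane → Plane) : Prop :=
  ∀ η : Plane → Plane, MapMemW012 η →
    (∀ᵐ x ∂discMeasure, frob (cof (weakGrad u x)) (weakGrad η x) = 0) →
      HasDerivAt (fun t : ℝ => energy f fun x => u x + t • η x) 0 0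

/-- `p` is a pressure of the map `u`, for the energy with integrand `T(x) ξ · ξ`: the
Euler-Lagrange equation `∫ T ∇u · ∇η = - ∫ p cof ∇u · ∇η` holds for all test maps `η`. -/
def IsPressure (T : Plane → Tensor) (u : Plane → Plane) (p : Plane → ℝ) : Prop :=
  ∀ η : Plane → Plane, IsTest η →
    ∫ x, frob ((T x).act (weakGrad u x)) (jac η x) ∂discMeasure =
      -∫ x, p x * frob (cof (weakGrad u x)) (jac η x) ∂discMeasure

/-! The concrete functional and the concrete map -/

/-- The quadratic integrand. -/
def integrand (ν a : ℝ) (x : Plane) (ξ : Mat) : ℝ :=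
  ν * (a * sandwich (eR (angle x)) ξ (eR (angle x)) ^ 2
    + sandwich (eR (angle x)) ξ (eTheta (angle x)) ^ 2
    + a * sandwich (eTheta (angle x)) ξ (eR (angle x)) ^ 2
    + sandwich (eTheta (angle x)) ξ (eTheta (angle x)) ^ 2)

/-- The coefficient tensor of the integrand. -/
def coeff (a : ℝ) (x : Plane) : Tensor :=
  let r := eR (angle x)
  let t := eTheta (angle x)
  a • tensorMul (outer r r) (outer r r) + tensorMul (outer r t) (outer r t)
    + a • tensorMul (outer t r) (outer t r) + tensorMul (outer t t) (outer t t)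

/-- The `N`-covering boundary values, shifted by `b`. -/
def boundaryData (N : ℕ) (b : Plane) (θ : ℝ) : Plane := (1 / √(N : ℝ)) • eR (N * θ) + b

/-- The one-homogeneous `N`-covering map, shifted by `b`. -/
def coveringMap (N : ℕ) (b : Plane) (x : Plane) : Plane :=
  (‖x‖ / √(N : ℝ)) • eR (N * angle x) + b

end IncompressibleDisc

end

open IncompressibleDisc

noncomputable section

namespace IncompressibleDisc

open Real (cos sin pi_pos)

/-! Frames and quadratic forms in polar coordinates -/

/-! Write `u` for the covering map, `R = ‖x‖`, `κ = (N² - a) / N`, and `D = ∇v - ∇u` for an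
admissible `v`. The energy is quadratic, so `E(v) - E(u) = 2ν ∫ M∇u·D + ν ∫ M D·D`, where `M D·D =
a|D e_R|² + |D e_θ|²`. Minimality rests on three facts.

Euler-Lagrange equation (`integral_bilin_coveringMap`): `∫ M∇u·D = -κ ∫ log R cof ∇u·D`. In the
polar frame, `∇u` has columns `eR(Nθ)/√N` and `√N eTheta(Nθ)`. Integrating by parts in `r` and in
`θ` (`integral_radDeriv_add_angDeriv`) leaves only a boundary term, which vanishes for equal traces.
Thus `νκ log R` is a pressure, and the first variation vanishes in the directions where `cof ∇u·∇η =
0`.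

Constraint (`frob_cof_eq_neg_det`): expanding `det (∇u + D) = 1` gives `cof ∇u·D = -det D`, so the
linear term of the energy becomes `2νκ ∫ log R det D`.

Jacobian estimate (`abs_integral_log_det_le`): `|2 ∫ log R det D| ≤ ∫ |D e_θ|²`. In polar
coordinates the Jacobian is a difference of an `r`-derivative and a `θ`-derivative. The weight
vanishes at `R = 1`, so integration by parts moves the derivative onto the logarithm, and the circle
integrals that remain are controlled by the Wirtinger inequality (`wirtinger`,
`abs_integral_mul_deriv_le`).

The range of `a` gives `|κ| ≤ 1`. The linear term is then absorbed by the tangential part of `∫ M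
D·D`, and the excess energy is at least `νa ∫ |D e_R|²` (`energy_excess`). If the excess is zero, `v
- u` has zero radial derivative and zero trace, and a Poincaré inequality (`integral_sq_le`) gives
`v = u` almost everywhere.

The entries of `M` and the integrand at fixed `ξ` are quadratic in `(cos θ, sin θ)`, hence
homogeneous of degree zero in `x`. Unless constant they have no limit at the origin. Their gradients
have size `1/R`, which is in `L^q` of the disc for `q < 2`, while `∫ R⁻² R dR` diverges. Weak
derivatives of functions that are smooth off the origin are obtained by cutting out small discs
(`hasWeakPartial_of_contDiffOn`). -/

@[simp] theorem eR_zero (θ : ℝ) : eR θ 0 = cos θ := rfl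
@[simp] theorem eR_one (θ : ℝ) : eR θ 1 = sin θ := rfl
@[simp] theorem eTheta_zero (θ : ℝ) : eTheta θ 0 = -sin θ := rfl
@[simp] theorem eTheta_one (θ : ℝ) : eTheta θ 1 = cos θ := rfl

/-- The components of `G eR`. -/
def radPart (G : Mat) (θ : ℝ) (i : Fin 2) : ℝ := G i 0 * cos θ + G i 1 * sin θ

/-- The components of `G eTheta`. -/
def tanPart (G : Mat) (θ : ℝ) (i : Fin 2) : ℝ := -(G i 0 * sin θ) + G i 1 * cos θ

theorem integrand_eq (ν a : ℝ) (x : Plane) (ξ : Mat) :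
    integrand ν a x ξ =
      ν * ∑ i, (a * radPart ξ (angle x) i ^ 2 + tanPart ξ (angle x) i ^ 2) := by
  have h := Real.sin_sq_add_cos_sq (angle x)
  simp only [integrand, sandwich, Fin.sum_univ_two, eR_zero, eR_one, eTheta_zero, eTheta_one,
    radPart, tanPart]
  generalize cos (angle x) = c at *
  generalize sin (angle x) = s at *
  linear_combination (ν * (a * (ξ 0 0 * c + ξ 0 1 * s) ^ 2 + a * (ξ 1 0 * c + ξ 1 1 * s) ^ 2
    + (-(ξ 0 0 * s) + ξ 0 1 * c) ^ 2 + (-(ξ 1 0 * s) + ξ 1 1 * c) ^ 2)) * h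

theorem sum_sq_parts (ξ : Mat) (θ : ℝ) :
    ∑ i, (radPart ξ θ i ^ 2 + tanPart ξ θ i ^ 2) = frob ξ ξ := by
  have h := Real.sin_sq_add_cos_sq θ
  simp only [Fin.sum_univ_two, radPart, tanPart, frob]
  linear_combination (ξ 0 0 ^ 2 + ξ 0 1 ^ 2 + ξ 1 0 ^ 2 + ξ 1 1 ^ 2) * h

/-- Both dyads of the frame add up to the identity. Hence the tensor acts trivially on the row
indices, and the angle enters only through `eR ⊗ eR` on the column indices. -/
theorem coeff_apply (a : ℝ) (x : Plane) (i j k l : Fin 2) :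
    coeff a x i j k l = (if i = k then 1 else 0) *
      ((a - 1) * (eR (angle x) j * eR (angle x) l) + if j = l then 1 else 0) := by
  have h := Real.sin_sq_add_cos_sq (angle x)
  have : coeff a x i j k l =
      (eR (angle x) i * eR (angle x) k + eTheta (angle x) i * eTheta (angle x) k) *
      (a * (eR (angle x) j * eR (angle x) l) + eTheta (angle x) j * eTheta (angle x) l) := by
    simp only [coeff, tensorMul, outer, Pi.add_apply, Pi.smul_apply, Matrix.of_apply, smul_eq_mul]
    ring
  rw [this]
  have h1 : eR (angle x) i * eR (angle x) k + eTheta (angle x) i * eTheta (angle x) k =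
      if i = k then 1 else 0 := by
    fin_cases i <;> fin_cases k <;> simp <;> linarith
  have h2 : eTheta (angle x) j * eTheta (angle x) l = (if j = l then 1 else 0)
      - eR (angle x) j * eR (angle x) l := by
    fin_cases j <;> fin_cases l <;> simp <;> linarith
  rw [h1, h2]
  ring

theorem frob_coeff_act (a : ℝ) (x : Plane) (ξ ζ : Mat) :
    frob ((coeff a x).act ξ) ζ =
      ∑ i, (a * radPart ξ (angle x) i * radPart ζ (angle x) i
        + tanPart ξ (angle x) i * tanPart ζ (angle x) i) := by
  have h := Real.sin_sq_add_cos_sq (angle x)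
  simp only [frob, Tensor.act, Matrix.of_apply, coeff_apply, Fin.sum_univ_two, radPart, tanPart,
    eR_zero, eR_one]
  simp
  generalize cos (angle x) = c at *
  generalize sin (angle x) = s at *
  obtain h' : s ^ 2 = 1 - c ^ 2 := by linarith
  ring_nf
  simp only [h']
  ring

/-- The frame is a rotation, so passing to the columns `G eR` and `G eTheta` leaves the determinant
unchanged. -/
theorem det_eq_parts (G : Mat) (θ : ℝ) :
    G.det = radPart G θ 0 * tanPart G θ 1 - tanPart G θ 0 * radPart G θ 1 := by
  have h := Real.sin_sq_add_cos_sq θ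
  simp only [Matrix.det_fin_two, radPart, tanPart]
  linear_combination (G 0 1 * G 1 0 - G 0 0 * G 1 1) * h

theorem frob_cof (ξ ζ : Mat) (θ : ℝ) :
    frob (cof ξ) ζ = radPart ξ θ 0 * tanPart ζ θ 1 + radPart ζ θ 0 * tanPart ξ θ 1
      - tanPart ξ θ 0 * radPart ζ θ 1 - tanPart ζ θ 0 * radPart ξ θ 1 := by
  have h := Real.sin_sq_add_cos_sq θ
  simp only [frob, cof, Matrix.adjugate_fin_two, Fin.sum_univ_two, Matrix.transpose_apply,
    radPart, tanPart]
  simp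
  linear_combination (-(ξ 0 0 * ζ 1 1) + ξ 0 1 * ζ 1 0 + ξ 1 0 * ζ 0 1 - ξ 1 1 * ζ 0 0) * h

/-- The planar determinant is a quadratic form, so its expansion stops at second order. This turns
the constraint into an exact relation between the cofactor term and the determinant of the
increment. -/
theorem det_add_eq (ξ ζ : Mat) : (ξ + ζ).det = ξ.det + frob (cof ξ) ζ + ζ.det := by
  simp only [frob, cof, Matrix.adjugate_fin_two, Fin.sum_univ_two, Matrix.transpose_apply,
    Matrix.det_fin_two]
  simp
  ring

/-! Polar coordinates -/

theorem norm_eR (θ : ℝ) : ‖eR θ‖ = 1 := by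
  simp [EuclideanSpace.norm_eq, Fin.sum_univ_two]

theorem norm_smul_eR {r : ℝ} (hr : 0 ≤ r) (θ : ℝ) : ‖r • eR θ‖ = r := by
  rw [norm_smul, norm_eR, mul_one, Real.norm_of_nonneg hr]

theorem norm_complex_eq (x : Plane) : ‖(⟨x 0, x 1⟩ : ℂ)‖ = ‖x‖ := by
  rw [EuclideanSpace.norm_eq, Complex.norm_def, Complex.normSq_apply, Fin.sum_univ_two]
  simp [sq]

theorem norm_smul_eR_angle (x : Plane) : ‖x‖ • eR (angle x) = x := by
  have h := Complex.norm_mul_cos_arg (⟨x 0, x 1⟩ : ℂ)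
  have h' := Complex.norm_mul_sin_arg (⟨x 0, x 1⟩ : ℂ)
  rw [norm_complex_eq] at h h'
  ext i
  fin_cases i
  · simpa [angle] using h
  · simpa [angle] using h'

theorem eR_angle_smul {r : ℝ} (hr : 0 < r) (θ : ℝ) : eR (angle (r • eR θ)) = eR θ := by
  have h := norm_smul_eR_angle (r • eR θ)
  rw [norm_smul_eR hr.le] at h
  exact smul_right_injective _ hr.ne' h

theorem eR_congr_iff {θ θ' : ℝ} : eR θ = eR θ' ↔ cos θ = cos θ' ∧ sin θ = sin θ' := by
  constructor
  · intro h
    exact ⟨congrArg (fun v : Plane => v 0) h, congrArg (fun v : Plane => v 1) h⟩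
  · rintro ⟨h, h'⟩
    simp [eR, h, h']

theorem cos_angle_smul {r : ℝ} (hr : 0 < r) (θ : ℝ) : cos (angle (r • eR θ)) = cos θ :=
  (eR_congr_iff.1 (eR_angle_smul hr θ)).1

theorem sin_angle_smul {r : ℝ} (hr : 0 < r) (θ : ℝ) : sin (angle (r • eR θ)) = sin θ :=
  (eR_congr_iff.1 (eR_angle_smul hr θ)).2

theorem cos_angle {x : Plane} (hx : x ≠ 0) : cos (angle x) = x 0 / ‖x‖ := by
  rw [eq_div_iff (norm_ne_zero_iff.2 hx), mul_comm]
  exact congrArg (fun v : Plane => v 0) (norm_smul_eR_angle x)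

theorem sin_angle {x : Plane} (hx : x ≠ 0) : sin (angle x) = x 1 / ‖x‖ := by
  rw [eq_div_iff (norm_ne_zero_iff.2 hx), mul_comm]
  exact congrArg (fun v : Plane => v 1) (norm_smul_eR_angle x)

/-- Multiplication by an integer is well defined on angles modulo `2π`. The jump of `angle` across
the slit is therefore invisible to the covering map. -/
theorem eR_nat_mul_congr (N : ℕ) {θ θ' : ℝ} (h : eR θ = eR θ') : eR (N * θ) = eR (N * θ') := by
  rw [eR_congr_iff] at h ⊢
  have h1 : (θ : Real.Angle) = θ' := Real.Angle.cos_sin_inj h.1 h.2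
  have h2 : ((N * θ : ℝ) : Real.Angle) = ((N * θ' : ℝ) : Real.Angle) := by
    rw [Real.Angle.natCast_mul_eq_nsmul, Real.Angle.natCast_mul_eq_nsmul, h1]
  constructor
  · rw [← Real.Angle.cos_coe, h2, Real.Angle.cos_coe]
  · rw [← Real.Angle.sin_coe, h2, Real.Angle.sin_coe]

theorem measurable_angle : Measurable angle := by
  unfold angle
  apply Complex.measurable_arg.comp
  exact Complex.measurableEquivRealProd.symm.measurable.comp
    (by fun_prop : Measurable fun x : Plane => (x 0, x 1))

/-- The measure `dr dθ` on the coordinate rectangle of the disc. -/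
def polarMeasure : Measure (ℝ × ℝ) :=
  (volume.restrict (Ioo 0 1)).prod (volume.restrict (Ioo (-Real.pi) Real.pi))

theorem polarMeasure_eq :
    polarMeasure = volume.restrict (Ioo (0 : ℝ) 1 ×ˢ Ioo (-Real.pi) Real.pi) := by
  rw [polarMeasure, Measure.prod_restrict]
  rfl

instance : IsFiniteMeasure polarMeasure := by unfold polarMeasure; infer_instance

@[fun_prop]
theorem continuous_eR : Continuous eR := by
  unfold eR
  apply (PiLp.continuous_toLp 2 _).comp
  refine continuous_pi fun i => ?_
  fin_cases i
  · exact Real.continuous_cos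
  · exact Real.continuous_sin

theorem continuous_polar : Continuous fun p : ℝ × ℝ => p.1 • eR p.2 :=
  continuous_fst.smul (continuous_eR.comp continuous_snd)

/-- The standard identification of the plane with `ℝ × ℝ`. -/
def planeEquiv : Plane ≃ᵐ ℝ × ℝ :=
  (MeasurableEquiv.toLp 2 (Fin 2 → ℝ)).symm.trans MeasurableEquiv.finTwoArrow

theorem measurePreserving_planeEquiv : MeasurePreserving planeEquiv :=
  (volume_preserving_finTwoArrow ℝ).comp (PiLp.volume_preserving_ofLp (Fin 2))

/-- The polar change of variables of `ℝ × ℝ`, transported by `planeEquiv`; the indicator of the disc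
cuts the radii down to `(0, 1)`. -/
theorem lintegral_disc (f : Plane → ℝ≥0∞) :
    ∫⁻ x, f x ∂discMeasure =
      ∫⁻ p, ENNReal.ofReal p.1 * f (p.1 • eR p.2) ∂polarMeasure := by
  have hd : MeasurableSet disc := measurableSet_ball
  have h1 : ∫⁻ x, f x ∂discMeasure = ∫⁻ p : ℝ × ℝ, (disc.indicator f) (planeEquiv.symm p) := by
    rw [discMeasure, ← lintegral_indicator hd,
      ← measurePreserving_planeEquiv.lintegral_comp_emb planeEquiv.measurableEmbedding]
    simp
  rw [h1, ← lintegral_comp_polarCoord_symm, polarMeasure_eq, polarCoord_target]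
  have hsub : Ioo (0 : ℝ) 1 ×ˢ Ioo (-Real.pi) Real.pi ⊆ Ioi (0 : ℝ) ×ˢ Ioo (-Real.pi) Real.pi :=
    prod_mono Ioo_subset_Ioi_self le_rfl
  rw [← lintegral_indicator (measurableSet_Ioi.prod measurableSet_Ioo),
    ← lintegral_indicator (measurableSet_Ioo.prod measurableSet_Ioo)]
  congr 1 with p
  have hp : planeEquiv.symm (polarCoord.symm p) = p.1 • eR p.2 := by
    ext i
    fin_cases i <;> rfl
  by_cases h : p ∈ Ioo (0 : ℝ) 1 ×ˢ Ioo (-Real.pi) Real.pi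
  · rw [indicator_of_mem h, indicator_of_mem (hsub h), hp, indicator_of_mem, smul_eq_mul]
    rw [disc, mem_ball_zero_iff, norm_smul_eR h.1.1.le]
    exact h.1.2
  · rw [indicator_of_notMem h]
    by_cases h' : p ∈ Ioi (0 : ℝ) ×ˢ Ioo (-Real.pi) Real.pi
    · rw [indicator_of_mem h', hp, indicator_of_notMem, smul_zero]
      rw [disc, mem_ball_zero_iff, norm_smul_eR (le_of_lt h'.1)]
      intro h1
      exact h ⟨⟨h'.1, h1⟩, h'.2⟩
    · rw [indicator_of_notMem h']

/-- As a pushforward of a measure with density, the change of variables applies at once to Bochner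
integrals and to integrability. -/
theorem discMeasure_eq_map : discMeasure =
    (polarMeasure.withDensity fun p => ENNReal.ofReal p.1).map fun p => p.1 • eR p.2 := by
  have hm : Measurable fun p : ℝ × ℝ => ENNReal.ofReal p.1 := by fun_prop
  ext s hs
  rw [Measure.map_apply continuous_polar.measurable hs, withDensity_apply _
    (continuous_polar.measurable hs), ← lintegral_indicator_one hs, lintegral_disc,
    ← lintegral_indicator (continuous_polar.measurable hs)]
  congr 1 with p
  by_cases h : p.1 • eR p.2 ∈ s
  · simp [h]
  · simp [h]

theorem integral_disc {f : Plane → ℝ} (hf : AEStronglyMeasurable f discMeasure) :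
    ∫ x, f x ∂discMeasure = ∫ p, p.1 * f (p.1 • eR p.2) ∂polarMeasure := by
  rw [discMeasure_eq_map] at hf ⊢
  rw [integral_map continuous_polar.aemeasurable hf,
    integral_withDensity_eq_integral_toReal_smul (by fun_prop) (by simp)]
  apply integral_congr_ae
  have : ∀ᵐ p ∂polarMeasure, p ∈ Ioo (0 : ℝ) 1 ×ˢ Ioo (-Real.pi) Real.pi := by
    rw [polarMeasure_eq]
    exact ae_restrict_mem (measurableSet_Ioo.prod measurableSet_Ioo)
  filter_upwards [this] with p hp
  rw [ENNReal.toReal_ofReal hp.1.1.le, smul_eq_mul]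

theorem ae_polar_mem : ∀ᵐ p ∂polarMeasure, p ∈ Ioo (0 : ℝ) 1 ×ˢ Ioo (-Real.pi) Real.pi := by
  rw [polarMeasure_eq]
  exact ae_restrict_mem (measurableSet_Ioo.prod measurableSet_Ioo)

theorem integrable_disc_iff {f : Plane → ℝ} (hf : AEStronglyMeasurable f discMeasure) :
    Integrable f discMeasure ↔
      Integrable (fun p : ℝ × ℝ => p.1 * f (p.1 • eR p.2)) polarMeasure := by
  rw [discMeasure_eq_map] at hf ⊢
  rw [integrable_map_measure hf continuous_polar.aemeasurable,
    integrable_withDensity_iff_integrable_smul' (by fun_prop) (by simp)]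
  apply integrable_congr
  filter_upwards [ae_polar_mem] with p hp
  rw [ENNReal.toReal_ofReal hp.1.1.le, smul_eq_mul]
  rfl

instance : IsFiniteMeasure discMeasure := by
  unfold discMeasure disc
  exact isFiniteMeasure_restrict.2 measure_ball_lt_top.ne

theorem ae_disc_mem : ∀ᵐ x ∂discMeasure, x ∈ disc ∧ x ≠ 0 := by
  have h : ∀ᵐ x ∂discMeasure, x ∈ disc := ae_restrict_mem measurableSet_ball
  have h' : ∀ᵐ x ∂discMeasure, x ≠ 0 := by
    apply ae_restrict_of_ae
    exact Measure.ae_ne volume 0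
  filter_upwards [h, h'] with x h1 h2 using ⟨h1, h2⟩

theorem discMeasure_univ : discMeasure.real univ = Real.pi := by
  rw [discMeasure, measureReal_def, Measure.restrict_apply_univ, disc,
    EuclideanSpace.volume_ball_fin_two]
  simp [Real.pi_pos.le]

theorem integral_polar {F : ℝ × ℝ → ℝ} (hF : Integrable F polarMeasure) :
    ∫ p, F p ∂polarMeasure = ∫ r in (0 : ℝ)..1, ∫ θ in -Real.pi..Real.pi, F (r, θ) := by
  rw [polarMeasure, integral_prod _ hF, intervalIntegral.integral_of_le zero_le_one,
    integral_Ioc_eq_integral_Ioo]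
  congr 1 with r
  rw [intervalIntegral.integral_of_le (by linarith [pi_pos]), integral_Ioc_eq_integral_Ioo]

theorem integral_polar_symm {F : ℝ × ℝ → ℝ} (hF : Integrable F polarMeasure) :
    ∫ p, F p ∂polarMeasure = ∫ θ in -Real.pi..Real.pi, ∫ r in (0 : ℝ)..1, F (r, θ) := by
  rw [polarMeasure, integral_prod_symm _ hF,
    intervalIntegral.integral_of_le (by linarith [pi_pos]), integral_Ioc_eq_integral_Ioo]
  congr 1 with θ
  rw [intervalIntegral.integral_of_le zero_le_one, integral_Ioc_eq_integral_Ioo]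

theorem integrable_polar_of_continuous {F : ℝ × ℝ → ℝ} (hF : Continuous F) :
    Integrable F polarMeasure := by
  rw [polarMeasure_eq]
  exact (hF.continuousOn.integrableOn_compact
    (isCompact_Icc.prod isCompact_Icc)).mono_set
      (prod_mono Ioo_subset_Icc_self Ioo_subset_Icc_self)

/-- The product of an integrable radial weight and a bounded continuous function is integrable. -/
theorem integrable_polar_mul {k : ℝ → ℝ} (hk : IntegrableOn k (Ioo 0 1)) {F : ℝ × ℝ → ℝ}
    (hF : Continuous F) : Integrable (fun p => k p.1 * F p) polarMeasure := by
  have h1 : Integrable (fun p : ℝ × ℝ => k p.1) polarMeasure :=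
    Integrable.comp_fst hk _
  obtain ⟨C, hC⟩ := (isCompact_Icc.prod isCompact_Icc :
    IsCompact (Icc (0 : ℝ) 1 ×ˢ Icc (-Real.pi) Real.pi)).exists_bound_of_continuousOn
      hF.continuousOn
  refine h1.mul_bdd (c := C) hF.aestronglyMeasurable ?_
  filter_upwards [ae_polar_mem] with p hp
  exact hC p ⟨Ioo_subset_Icc_self hp.1, Ioo_subset_Icc_self hp.2⟩

/-! Powers of the radius -/

/-- With the Jacobian `r`, the `q`-th power becomes `r ^ (1 - s q)`, which is integrable at zero
because `s q < 2`. With `s = 1` this is the source of the threshold `q < 2`. -/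
theorem memLp_norm_rpow_neg {s : ℝ} {q : ℝ≥0∞} (hq0 : q ≠ 0) (hq : q ≠ ⊤)
    (hsq : s * q.toReal < 2) : MemLp (fun x : Plane => ‖x‖ ^ (-s)) q discMeasure := by
  have hm : Measurable fun x : Plane => ‖x‖ ^ (-s) := by fun_prop
  rw [← integrable_norm_rpow_iff hm.aestronglyMeasurable hq0 hq,
    integrable_disc_iff (by measurability : Measurable _).aestronglyMeasurable]
  have h : IntegrableOn (fun r : ℝ => r ^ (1 - s * q.toReal)) (Ioo 0 1) := by
    rw [intervalIntegral.integrableOn_Ioo_rpow_iff zero_lt_one]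
    linarith
  refine (integrable_polar_mul h (continuous_const (y := (1 : ℝ)))).congr ?_
  filter_upwards [ae_polar_mem] with p hp
  have h0 : 0 < p.1 := hp.1.1
  rw [norm_smul_eR h0.le, Real.norm_of_nonneg (by positivity), ← Real.rpow_mul h0.le,
    sub_eq_add_neg, Real.rpow_add h0, Real.rpow_one, neg_mul, mul_one]

theorem abs_log_le_rpow {r s : ℝ} (h0 : 0 < r) (h1 : r ≤ 1) (hs : 0 < s) :
    |Real.log r| ≤ s⁻¹ * r ^ (-s) := by
  have h := Real.abs_log_mul_self_rpow_lt r s h0 h1 hs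
  have hp : 0 < r ^ s := by positivity
  rw [abs_mul, abs_of_pos hp] at h
  rw [Real.rpow_neg h0.le, ← div_eq_mul_inv, le_div_iff₀ hp]
  simpa using h.le

theorem norm_mem_of_disc {x : Plane} (hx : x ∈ disc ∧ x ≠ 0) : 0 < ‖x‖ ∧ ‖x‖ < 1 :=
  ⟨norm_pos_iff.2 hx.2, by simpa [disc] using hx.1⟩

theorem memLp_log_norm {q : ℝ≥0∞} (hq0 : q ≠ 0) (hq : q ≠ ⊤) :
    MemLp (fun x : Plane => Real.log ‖x‖) q discMeasure := by
  have hm : Measurable fun x : Plane => Real.log ‖x‖ := by fun_prop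
  have h : 0 < q.toReal := ENNReal.toReal_pos hq0 hq
  -- The logarithm is bounded by any negative power of the radius; with `s = 1/q` the critical
  -- product is `s q = 1 < 2`.
  refine ((memLp_norm_rpow_neg (s := 1 / q.toReal) hq0 hq ?_).const_mul (1 / q.toReal)⁻¹).mono
    hm.aestronglyMeasurable ?_
  · field_simp
    norm_num
  · filter_upwards [ae_disc_mem] with x hx
    obtain ⟨h0, h1⟩ := norm_mem_of_disc hx
    rw [Real.norm_eq_abs, Real.norm_of_nonneg (by positivity)]
    exact abs_log_le_rpow h0 h1.le (by positivity)

/-! Convergence in `Lᵖ` -/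

theorem tendsto_eLpNorm_of_dominated {α : Type*} [MeasurableSpace α] {μ : Measure α}
    {p : ℝ≥0∞} (hp0 : p ≠ 0) (hp : p ≠ ⊤) {f : ℕ → α → ℝ} {F : α → ℝ}
    (hm : ∀ n, AEStronglyMeasurable (f n) μ) (hF : MemLp F p μ)
    (hb : ∀ n, ∀ᵐ x ∂μ, ‖f n x‖ ≤ F x)
    (hlim : ∀ᵐ x ∂μ, Tendsto (fun n => f n x) atTop (𝓝 0)) :
    Tendsto (fun n => eLpNorm (f n) p μ) atTop (𝓝 0) := by
  have hpos : 0 < p.toReal := ENNReal.toReal_pos hp0 hp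
  simp only [eLpNorm_eq_lintegral_rpow_enorm_toReal hp0 hp]
  have key : Tendsto (fun n => ∫⁻ x, ‖f n x‖ₑ ^ p.toReal ∂μ) atTop (𝓝 (∫⁻ _, 0 ∂μ)) := by
    refine tendsto_lintegral_of_dominated_convergence' (fun x => ‖F x‖ₑ ^ p.toReal)
      (fun n => ((hm n).enorm.pow_const _)) (fun n => ?_) ?_ ?_
    · filter_upwards [hb n] with x hx
      gcongr
      rw [enorm_le_iff_norm_le]
      exact hx.trans (le_abs_self _)
    · exact (lintegral_rpow_enorm_lt_top_of_eLpNorm_lt_top hp0 hp hF.2).ne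
    · filter_upwards [hlim] with x hx
      have h1 : Tendsto (fun n => ‖f n x‖ₑ) atTop (𝓝 0) := by
        simpa [Function.comp_def] using (continuous_enorm.tendsto (0 : ℝ)).comp hx
      have := (ENNReal.continuous_rpow_const (y := p.toReal)).tendsto 0 |>.comp h1
      simpa [hpos, Function.comp_def] using this
  rw [lintegral_zero] at key
  have := (ENNReal.continuous_rpow_const (y := 1 / p.toReal)).tendsto 0 |>.comp key
  simpa [hpos, Function.comp_def] using this

/-- Continuity of the `L²` inner product. It carries the integral identities from smooth maps to
Sobolev maps. -/
theorem tendsto_integral_mul_of_L2 {α : Type*} [MeasurableSpace α] {μ : Measure α}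
    {f g : ℕ → α → ℝ} {F G : α → ℝ} (hf : ∀ n, MemLp (f n) 2 μ) (hg : ∀ n, MemLp (g n) 2 μ)
    (hF : MemLp F 2 μ) (hG : MemLp G 2 μ)
    (hfF : Tendsto (fun n => eLpNorm (fun x => f n x - F x) 2 μ) atTop (𝓝 0))
    (hgG : Tendsto (fun n => eLpNorm (fun x => g n x - G x) 2 μ) atTop (𝓝 0)) :
    Tendsto (fun n => ∫ x, f n x * g n x ∂μ) atTop (𝓝 (∫ x, F x * G x ∂μ)) := by
  have h1 := (Lp.tendsto_Lp_iff_tendsto_eLpNorm'' f hf F hF).2 hfF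
  have h2 := (Lp.tendsto_Lp_iff_tendsto_eLpNorm'' g hg G hG).2 hgG
  have h3 := h1.inner (𝕜 := ℝ) h2
  have key : ∀ {u v : α → ℝ} (hu : MemLp u 2 μ) (hv : MemLp v 2 μ),
      inner ℝ (hu.toLp u) (hv.toLp v) = ∫ x, u x * v x ∂μ := by
    intro u v hu hv
    rw [L2.inner_def]
    apply integral_congr_ae
    filter_upwards [hu.coeFn_toLp, hv.coeFn_toLp] with x h h'
    rw [h, h']
    simp [mul_comm]
  simpa only [key] using h3

theorem tendsto_eLpNorm_mul_bdd {α : Type*} [MeasurableSpace α] {μ : Measure α} {p : ℝ≥0∞}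
    {f : ℕ → α → ℝ} {F w : α → ℝ} {C : ℝ} (hw : ∀ᵐ x ∂μ, |w x| ≤ C)
    (hf : Tendsto (fun n => eLpNorm (fun x => f n x - F x) p μ) atTop (𝓝 0)) :
    Tendsto (fun n => eLpNorm (fun x => w x * f n x - w x * F x) p μ) atTop (𝓝 0) := by
  have h0 : Tendsto (fun n => ENNReal.ofReal C * eLpNorm (fun x => f n x - F x) p μ) atTop
      (𝓝 0) := by
    simpa using ENNReal.Tendsto.const_mul hf (Or.inr ENNReal.ofReal_ne_top)
  refine tendsto_of_tendsto_of_tendsto_of_le_of_le tendsto_const_nhds h0 (fun n => zero_le)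
    (fun n => eLpNorm_le_mul_eLpNorm_of_ae_le_mul ?_ p)
  filter_upwards [hw] with x hx
  rw [← mul_sub, norm_mul]
  gcongr
  exact hx

theorem tendsto_integral_mul_bdd {α : Type*} [MeasurableSpace α] {μ : Measure α}
    {f : ℕ → α → ℝ} {F w : α → ℝ} {C : ℝ} (hwm : AEStronglyMeasurable w μ)
    (hw : ∀ᵐ x ∂μ, |w x| ≤ C) (hfi : ∀ n, Integrable (f n) μ) (hFi : Integrable F μ)
    (hf : Tendsto (fun n => eLpNorm (fun x => f n x - F x) 1 μ) atTop (𝓝 0)) :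
    Tendsto (fun n => ∫ x, w x * f n x ∂μ) atTop (𝓝 (∫ x, w x * F x ∂μ)) :=
  tendsto_integral_of_L1' _ (hFi.bdd_mul hwm hw).1
    (Eventually.of_forall fun n => (hfi n).bdd_mul hwm hw) (tendsto_eLpNorm_mul_bdd hw hf)

/-! Weak derivatives -/

theorem isOpen_disc : IsOpen disc := Metric.isOpen_ball

theorem integrable_mul_of_tsupport {f φ : Plane → ℝ} (hf : LocallyIntegrableOn f disc volume)
    (hφ : Continuous φ) (hc : HasCompactSupport φ) (hs : tsupport φ ⊆ disc) :
    Integrable (fun x => f x * φ x) discMeasure := by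
  have h1 : IntegrableOn f (tsupport φ) volume :=
    hf.integrableOn_compact_subset hs hc.isCompact
  obtain ⟨C, hC⟩ := hc.exists_bound_of_continuous hφ
  have h2 : IntegrableOn (fun x => f x * φ x) (tsupport φ) volume :=
    Integrable.mul_bdd (c := C) h1 hφ.aestronglyMeasurable (ae_of_all _ hC)
  rw [integrableOn_iff_integrable_of_support_subset] at h2
  · exact h2.integrableOn
  · exact (Function.support_mul_subset_right _ _).trans (subset_tsupport φ)

theorem continuous_partialDeriv {f : Plane → ℝ} (hf : ContDiff ℝ ∞ f) (j : Fin 2) :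
    Continuous (partialDeriv j f) :=
  (hf.continuous_fderiv (by simp)).clm_apply continuous_const

theorem tsupport_partialDeriv_subset (f : Plane → ℝ) (j : Fin 2) :
    tsupport (partialDeriv j f) ⊆ tsupport f :=
  tsupport_fderiv_apply_subset ℝ _

theorem IsTest.partialDeriv_test {φ : Plane → ℝ} (hφ : IsTest φ) (j : Fin 2) :
    Continuous (partialDeriv j φ) ∧ HasCompactSupport (partialDeriv j φ) ∧
      tsupport (partialDeriv j φ) ⊆ disc :=
  ⟨continuous_partialDeriv hφ.1 j, hφ.2.1.fderiv_apply ℝ _,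
    (tsupport_partialDeriv_subset φ j).trans hφ.2.2⟩

theorem memLp_disc_of_continuous {f : Plane → ℝ} (hf : Continuous f) (q : ℝ≥0∞) :
    MemLp f q discMeasure := by
  obtain ⟨C, hC⟩ := (isCompact_closedBall (0 : Plane) 1).exists_bound_of_continuousOn
    hf.continuousOn
  refine MemLp.of_bound hf.aestronglyMeasurable C ?_
  filter_upwards [ae_disc_mem] with x hx
  exact hC x (Metric.ball_subset_closedBall hx.1)

theorem integral_disc_eq {f : Plane → ℝ} (hf : ∀ x ∉ disc, f x = 0) :
    ∫ x, f x ∂discMeasure = ∫ x, f x :=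
  setIntegral_eq_integral_of_forall_compl_eq_zero hf

theorem IsTest.eq_zero {φ : Plane → ℝ} (hφ : tsupport φ ⊆ disc) {x : Plane}
    (hx : x ∉ disc) : φ x = 0 :=
  image_eq_zero_of_notMem_tsupport fun h => hx (hφ h)

theorem hasWeakPartial_of_contDiff {f : Plane → ℝ} (hf : ContDiff ℝ ∞ f) (j : Fin 2) :
    HasWeakPartial j f (partialDeriv j f) := by
  have hl : LocallyIntegrableOn f disc volume :=
    (hf.continuous.locallyIntegrable).locallyIntegrableOn _
  have hl' : LocallyIntegrableOn (partialDeriv j f) disc volume :=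
    ((continuous_partialDeriv hf j).locallyIntegrable).locallyIntegrableOn _
  refine ⟨hl, hl', fun φ hφ => ?_⟩
  obtain ⟨h1, h2, h3⟩ := hφ.partialDeriv_test j
  rw [integral_disc_eq fun x hx => by rw [IsTest.eq_zero h3 hx, mul_zero],
    integral_disc_eq fun x hx => by rw [IsTest.eq_zero hφ.2.2 hx, mul_zero]]
  refine integral_mul_fderiv_eq_neg_fderiv_mul_of_integrable ?_ ?_ ?_
    (fun x _ => hf.differentiable (by simp) x) (fun x _ => hφ.1.differentiable (by simp) x)
  · exact ((continuous_partialDeriv hf j).mul hφ.1.continuous).integrable_of_hasCompactSupport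
      hφ.2.1.mul_left
  · exact (hf.continuous.mul h1).integrable_of_hasCompactSupport h2.mul_left
  · exact (hf.continuous.mul hφ.1.continuous).integrable_of_hasCompactSupport hφ.2.1.mul_left

/-- The fundamental lemma of the calculus of variations. It allows the chosen `weakGrad` to be
replaced by an explicit gradient almost everywhere. -/
theorem HasWeakPartial.ae_eq {j : Fin 2} {f g g' : Plane → ℝ} (h : HasWeakPartial j f g)
    (h' : HasWeakPartial j f g') : g =ᵐ[discMeasure] g' := by
  have key : ∀ᵐ x, x ∈ disc → (g x - g' x) = 0 := by
    refine isOpen_disc.ae_eq_zero_of_integral_contDiff_smul_eq_zero (h.2.1.sub h'.2.1) ?_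
    intro φ h1 h2 h3
    have e := (h.2.2 φ ⟨h1, h2, h3⟩).symm.trans (h'.2.2 φ ⟨h1, h2, h3⟩)
    rw [← integral_disc_eq fun x hx => by simp [IsTest.eq_zero h3 hx]]
    have : ∀ x, φ x • (g x - g' x) = g x * φ x - g' x * φ x := fun x => by
      rw [smul_eq_mul]; ring
    simp only [this]
    rw [integral_sub (integrable_mul_of_tsupport h.2.1 h1.continuous h2 h3)
      (integrable_mul_of_tsupport h'.2.1 h1.continuous h2 h3)]
    linarith
  filter_upwards [(ae_restrict_iff' measurableSet_ball).2 key] with x hx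
  linarith

theorem HasWeakPartial.add_const_mul {j : Fin 2} {f g f' g' : Plane → ℝ}
    (h : HasWeakPartial j f g) (h' : HasWeakPartial j f' g') (t : ℝ) :
    HasWeakPartial j (fun x => f x + t * f' x) (fun x => g x + t * g' x) := by
  refine ⟨h.1.add (h'.1.smul t), h.2.1.add (h'.2.1.smul t), fun φ hφ => ?_⟩
  obtain ⟨h1, h2, h3⟩ := hφ.partialDeriv_test j
  have e : ∀ u v w : Plane → ℝ, ∀ x, (u x + t * v x) * w x = u x * w x + t * (v x * w x) :=
    fun u v w x => by ring
  rw [integral_congr_ae (ae_of_all _ (e f f' _)), integral_congr_ae (ae_of_all _ (e g g' _)),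
    integral_add (integrable_mul_of_tsupport h.1 h1 h2 h3)
    ((integrable_mul_of_tsupport h'.1 h1 h2 h3).const_mul t),
    integral_add (integrable_mul_of_tsupport h.2.1 hφ.1.continuous hφ.2.1 hφ.2.2)
    ((integrable_mul_of_tsupport h'.2.1 hφ.1.continuous hφ.2.1 hφ.2.2).const_mul t),
    integral_const_mul, integral_const_mul, h.2.2 φ hφ, h'.2.2 φ hφ]
  ring

theorem locallyIntegrableOn_disc {f : Plane → ℝ} (hf : Integrable f discMeasure) :
    LocallyIntegrableOn f disc volume :=
  IntegrableOn.locallyIntegrableOn hf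

/-- Test functions and their derivatives are bounded, so `L¹` convergence is enough to pass to the
limit on both sides of the integration by parts. -/
theorem hasWeakPartial_of_tendsto {j : Fin 2} {f g : Plane → ℝ} {F : ℕ → Plane → ℝ}
    (hF : ∀ n, ContDiff ℝ ∞ (F n)) (hf : Integrable f discMeasure) (hg : Integrable g discMeasure)
    (h : Tendsto (fun n => eLpNorm (fun x => F n x - f x) 1 discMeasure) atTop (𝓝 0))
    (h' : Tendsto (fun n => eLpNorm (fun x => partialDeriv j (F n) x - g x) 1 discMeasure)
      atTop (𝓝 0)) : HasWeakPartial j f g := by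
  refine ⟨locallyIntegrableOn_disc hf, locallyIntegrableOn_disc hg,
    fun φ hφ => ?_⟩
  obtain ⟨h1, h2, h3⟩ := hφ.partialDeriv_test j
  obtain ⟨C, hC⟩ := h2.exists_bound_of_continuous h1
  obtain ⟨C', hC'⟩ := hφ.2.1.exists_bound_of_continuous hφ.1.continuous
  have l1 := tendsto_integral_mul_bdd h1.aestronglyMeasurable (ae_of_all _ hC)
    (fun n => memLp_one_iff_integrable.1 (memLp_disc_of_continuous (hF n).continuous 1)) hf h
  have l2 := tendsto_integral_mul_bdd hφ.1.continuous.aestronglyMeasurable (ae_of_all _ hC')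
    (fun n => memLp_one_iff_integrable.1
      (memLp_disc_of_continuous (continuous_partialDeriv (hF n) j) 1)) hg h'
  have e : ∀ n, ∫ x, partialDeriv j φ x * F n x ∂discMeasure =
      -∫ x, φ x * partialDeriv j (F n) x ∂discMeasure := by
    intro n
    have := (hasWeakPartial_of_contDiff (hF n) j).2.2 φ hφ
    simpa only [mul_comm] using this
  simp only [e] at l1
  have := tendsto_nhds_unique l1 l2.neg
  simpa only [mul_comm] using this

/-! Functions that are smooth away from the origin -/

/-- A smooth radial cutoff of a neighbourhood of the origin. -/
def cutoff (n : ℕ) (x : Plane) : ℝ := Real.smoothTransition (((n : ℝ) + 1) ^ 2 * ‖x‖ ^ 2 - 1)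

theorem contDiff_cutoff (n : ℕ) : ContDiff ℝ ∞ (cutoff n) :=
  Real.smoothTransition.contDiff.comp
    ((contDiff_const.mul (contDiff_norm_sq ℝ)).sub contDiff_const)

theorem abs_cutoff_le (n : ℕ) (x : Plane) : |cutoff n x| ≤ 1 := by
  rw [cutoff, abs_of_nonneg (Real.smoothTransition.nonneg _)]
  exact Real.smoothTransition.le_one _

theorem eventually_cutoff_eq_one {x : Plane} (hx : x ≠ 0) :
    ∀ᶠ n : ℕ in atTop, cutoff n =ᶠ[𝓝 x] 1 := by
  have hpos : 0 < ‖x‖ ^ 2 := by positivity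
  have h : Tendsto (fun n : ℕ => ((n : ℝ) + 1) ^ 2 * ‖x‖ ^ 2 - 1) atTop atTop := by
    apply tendsto_atTop_add_const_right
    apply Tendsto.atTop_mul_const hpos
    exact (tendsto_pow_atTop two_ne_zero).comp
      (tendsto_atTop_add_const_right _ _ tendsto_natCast_atTop_atTop)
  filter_upwards [h.eventually_gt_atTop 1] with n hn
  have hc : Continuous fun y : Plane => ((n : ℝ) + 1) ^ 2 * ‖y‖ ^ 2 - 1 := by fun_prop
  filter_upwards [(hc.tendsto x).eventually (lt_mem_nhds hn)] with y hy
  exact Real.smoothTransition.one_of_one_le hy.le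

theorem cutoff_eventuallyEq_zero (n : ℕ) : cutoff n =ᶠ[𝓝 0] 0 := by
  have hc : Continuous fun y : Plane => ((n : ℝ) + 1) ^ 2 * ‖y‖ ^ 2 - 1 := by fun_prop
  have h : ((n : ℝ) + 1) ^ 2 * ‖(0 : Plane)‖ ^ 2 - 1 < 0 := by simp
  filter_upwards [(hc.tendsto 0).eventually (gt_mem_nhds h)] with y hy
  exact Real.smoothTransition.zero_of_nonpos hy.le

/-- The derivative is supported in `[0, 1]`. The weight `t + 1` is chosen for the cutoffs, whose
argument `t` satisfies `t + 1 = (n + 1)²‖x‖²`. -/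
theorem exists_deriv_smoothTransition_bound :
    ∃ C, 0 ≤ C ∧ ∀ t : ℝ, |deriv Real.smoothTransition t| * |t + 1| ≤ C := by
  have hc : Continuous (deriv Real.smoothTransition) :=
    (Real.smoothTransition.contDiff (n := 1)).continuous_deriv le_rfl
  obtain ⟨C, hC⟩ := (isCompact_Icc (a := (0 : ℝ)) (b := 1)).exists_bound_of_continuousOn
    ((hc.abs.mul (continuous_id.add continuous_const).abs).continuousOn (s := Icc 0 1))
  refine ⟨C, (norm_nonneg _).trans (hC 0 (by simp)), fun t => ?_⟩
  by_cases ht : t ∈ Icc (0 : ℝ) 1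
  · exact (le_abs_self _).trans (hC t ht)
  · have h0 : deriv Real.smoothTransition t = 0 := by
      rw [mem_Icc, not_and_or, not_le, not_le] at ht
      rcases ht with ht | ht
      · have : Real.smoothTransition =ᶠ[𝓝 t] fun _ => 0 := by
          filter_upwards [gt_mem_nhds ht] with s hs
          exact Real.smoothTransition.zero_of_nonpos hs.le
        rw [this.deriv_eq, deriv_const]
      · have : Real.smoothTransition =ᶠ[𝓝 t] fun _ => 1 := by
          filter_upwards [lt_mem_nhds ht] with s hs
          exact Real.smoothTransition.one_of_one_le hs.le
        rw [this.deriv_eq, deriv_const]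
    rw [h0, abs_zero, zero_mul]
    exact (norm_nonneg _).trans (hC 0 (by simp))

/-- The cutoffs are dilates of one profile, so `‖x‖` times the gradient is scale invariant and
bounded independently of `n`. -/
theorem exists_partialDeriv_cutoff_bound :
    ∃ C, 0 ≤ C ∧ ∀ (n : ℕ) (j : Fin 2) (x : Plane), x ≠ 0 →
      |partialDeriv j (cutoff n) x| ≤ C / ‖x‖ := by
  obtain ⟨C, h0, hC⟩ := exists_deriv_smoothTransition_bound
  refine ⟨2 * C, by positivity, fun n j x hx => ?_⟩
  have hpos : 0 < ‖x‖ := norm_pos_iff.2 hx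
  have hd : HasFDerivAt (fun y : Plane => ((n : ℝ) + 1) ^ 2 * ‖y‖ ^ 2 - 1)
      (((n : ℝ) + 1) ^ 2 • (2 • innerSL ℝ x)) x :=
    ((hasStrictFDerivAt_norm_sq x).hasFDerivAt.const_mul _).sub_const _
  have hs : DifferentiableAt ℝ Real.smoothTransition (((n : ℝ) + 1) ^ 2 * ‖x‖ ^ 2 - 1) :=
    (Real.smoothTransition.contDiff (n := 1)).differentiable one_ne_zero _
  have e : partialDeriv j (cutoff n) x = deriv Real.smoothTransition
      (((n : ℝ) + 1) ^ 2 * ‖x‖ ^ 2 - 1) * (((n : ℝ) + 1) ^ 2 * (2 * x j)) := by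
    have := (hs.hasDerivAt.comp_hasFDerivAt x hd).fderiv
    rw [partialDeriv]
    change fderiv ℝ (Real.smoothTransition ∘ _) x _ = _
    rw [this]
    simp [EuclideanSpace.inner_single_right]
  have hb := hC (((n : ℝ) + 1) ^ 2 * ‖x‖ ^ 2 - 1)
  rw [sub_add_cancel, abs_of_nonneg (by positivity : 0 ≤ ((n : ℝ) + 1) ^ 2 * ‖x‖ ^ 2)] at hb
  have hj : |x j| ≤ ‖x‖ := PiLp.norm_apply_le x j
  rw [e, le_div_iff₀ hpos, abs_mul, abs_mul, abs_mul, abs_of_nonneg (by positivity :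
    0 ≤ ((n : ℝ) + 1) ^ 2), abs_two]
  calc _ ≤ |deriv Real.smoothTransition (((n : ℝ) + 1) ^ 2 * ‖x‖ ^ 2 - 1)| *
        (((n : ℝ) + 1) ^ 2 * (2 * ‖x‖)) * ‖x‖ := by gcongr
    _ = 2 * (|deriv Real.smoothTransition (((n : ℝ) + 1) ^ 2 * ‖x‖ ^ 2 - 1)| *
        (((n : ℝ) + 1) ^ 2 * ‖x‖ ^ 2)) := by ring
    _ ≤ _ := by gcongr

theorem contDiff_cutoff_mul {f : Plane → ℝ} (hf : ContDiffOn ℝ ∞ f {0}ᶜ) (n : ℕ) :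
    ContDiff ℝ ∞ fun x => cutoff n x * f x := by
  rw [contDiff_iff_contDiffAt]
  intro x
  by_cases hx : x = 0
  · subst hx
    have : (fun x => cutoff n x * f x) =ᶠ[𝓝 0] fun _ => 0 := by
      filter_upwards [cutoff_eventuallyEq_zero n] with y hy
      simp [hy]
    exact contDiffAt_const.congr_of_eventuallyEq this
  · exact (contDiff_cutoff n).contDiffAt.mul
      (hf.contDiffAt (isOpen_compl_singleton.mem_nhds hx))

theorem aestronglyMeasurable_of_contDiffOn {f : Plane → ℝ} (hf : ContinuousOn f {0}ᶜ) :
    AEStronglyMeasurable f discMeasure := by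
  have h := hf.aestronglyMeasurable (μ := discMeasure) (measurableSet_singleton 0).compl
  rwa [Measure.restrict_eq_self_of_ae_mem] at h
  filter_upwards [ae_disc_mem] with x hx using hx.2

theorem continuousOn_partialDeriv {f : Plane → ℝ} (hf : ContDiffOn ℝ ∞ f {0}ᶜ) (j : Fin 2) :
    ContinuousOn (partialDeriv j f) {0}ᶜ :=
  (hf.continuousOn_fderiv_of_isOpen isOpen_compl_singleton (by simp)).clm_apply continuousOn_const

theorem memLp_of_div_norm {f : Plane → ℝ} {q : ℝ≥0∞} (hf : ContinuousOn f {0}ᶜ)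
    (h : MemLp (fun x => f x / ‖x‖) q discMeasure) : MemLp f q discMeasure := by
  refine h.mono (aestronglyMeasurable_of_contDiffOn hf) ?_
  filter_upwards [ae_disc_mem] with x hx
  obtain ⟨h0, h1⟩ := norm_mem_of_disc hx
  rw [norm_div, norm_norm, le_div_iff₀ h0]
  exact mul_le_of_le_one_right (norm_nonneg _) h1.le

theorem tendsto_cutoff_mul {f : Plane → ℝ} {q : ℝ≥0∞} (hq0 : q ≠ 0) (hq : q ≠ ⊤)
    (hf : ContDiffOn ℝ ∞ f {0}ᶜ) (h : MemLp (fun x => f x / ‖x‖) q discMeasure) :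
    Tendsto (fun n => eLpNorm (fun x => cutoff n x * f x - f x) q discMeasure) atTop (𝓝 0) := by
  refine tendsto_eLpNorm_of_dominated hq0 hq (fun n => ?_)
    ((memLp_of_div_norm hf.continuousOn h).norm.const_mul 2) (fun n => ?_) ?_
  · exact ((contDiff_cutoff_mul hf n).continuous.aestronglyMeasurable).sub
      (aestronglyMeasurable_of_contDiffOn hf.continuousOn)
  · refine ae_of_all _ fun x => ?_
    have := abs_cutoff_le n x
    calc ‖cutoff n x * f x - f x‖ ≤ |cutoff n x| * ‖f x‖ + ‖f x‖ := by
          rw [← Real.norm_eq_abs, ← norm_mul]; exact norm_sub_le _ _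
      _ ≤ 1 * ‖f x‖ + ‖f x‖ := by gcongr
      _ = _ := by ring
  · filter_upwards [ae_disc_mem] with x hx
    refine tendsto_const_nhds.congr' ?_
    filter_upwards [eventually_cutoff_eq_one hx.2] with n hn
    simp [hn.self_of_nhds]

/-- By the product rule the only dangerous term is `f` times the derivative of the cutoff. It is
dominated by a multiple of `|f| / ‖x‖` and is eventually zero at each point off the origin. -/
theorem tendsto_partialDeriv_cutoff_mul {f : Plane → ℝ} {q : ℝ≥0∞} (hq0 : q ≠ 0) (hq : q ≠ ⊤)
    (hf : ContDiffOn ℝ ∞ f {0}ᶜ) (h : MemLp (fun x => f x / ‖x‖) q discMeasure) {j : Fin 2}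
    (hj : MemLp (partialDeriv j f) q discMeasure) :
    Tendsto (fun n => eLpNorm (fun x => partialDeriv j (fun y => cutoff n y * f y) x -
      partialDeriv j f x) q discMeasure) atTop (𝓝 0) := by
  obtain ⟨C, hC0, hC⟩ := exists_partialDeriv_cutoff_bound
  refine tendsto_eLpNorm_of_dominated hq0 hq (fun n => ?_)
    ((hj.norm.const_mul 2).add (h.norm.const_mul C)) (fun n => ?_) ?_
  · exact (continuous_partialDeriv (contDiff_cutoff_mul hf n) j).aestronglyMeasurable.sub
      (aestronglyMeasurable_of_contDiffOn (continuousOn_partialDeriv hf j))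
  · filter_upwards [ae_disc_mem] with x hx
    have hfx : DifferentiableAt ℝ f x :=
      (hf.contDiffAt (isOpen_compl_singleton.mem_nhds hx.2)).differentiableAt (by simp)
    have e : partialDeriv j (fun y => cutoff n y * f y) x =
        cutoff n x * partialDeriv j f x + f x * partialDeriv j (cutoff n) x := by
      simp only [partialDeriv]
      rw [fderiv_fun_mul ((contDiff_cutoff n).differentiable (by simp) x) hfx]
      simp
    rw [e]
    have h1 := abs_cutoff_le n x
    have h2 := hC n j x hx.2
    calc _ ≤ |cutoff n x| * ‖partialDeriv j f x‖ + ‖f x‖ * |partialDeriv j (cutoff n) x|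
          + ‖partialDeriv j f x‖ := by
          rw [← Real.norm_eq_abs, ← Real.norm_eq_abs, ← norm_mul, ← norm_mul]
          exact (norm_sub_le _ _).trans (by gcongr; exact norm_add_le _ _)
      _ ≤ 1 * ‖partialDeriv j f x‖ + ‖f x‖ * (C / ‖x‖) + ‖partialDeriv j f x‖ := by gcongr
      _ = _ := by
        simp only [Pi.add_apply, norm_div, norm_norm]; ring
  · filter_upwards [ae_disc_mem] with x hx
    refine tendsto_const_nhds.congr' ?_
    filter_upwards [eventually_cutoff_eq_one hx.2] with n hn
    have : (fun y => cutoff n y * f y) =ᶠ[𝓝 x] f := by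
      filter_upwards [hn] with y hy
      simp [hy]
    rw [partialDeriv, this.fderiv_eq, partialDeriv, sub_self]

/-- The origin is removable: integrability of `f / ‖x‖` prevents the cutoffs from leaving a singular
contribution there. -/
theorem hasWeakPartial_of_contDiffOn {f : Plane → ℝ} (hf : ContDiffOn ℝ ∞ f {0}ᶜ)
    (h : MemLp (fun x => f x / ‖x‖) 1 discMeasure) {j : Fin 2}
    (hj : MemLp (partialDeriv j f) 1 discMeasure) :
    HasWeakPartial j f (partialDeriv j f) :=
  hasWeakPartial_of_tendsto (contDiff_cutoff_mul hf)
    (memLp_one_iff_integrable.1 (memLp_of_div_norm hf.continuousOn h))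
    (memLp_one_iff_integrable.1 hj) (tendsto_cutoff_mul one_ne_zero ENNReal.one_ne_top hf h)
    (tendsto_partialDeriv_cutoff_mul one_ne_zero ENNReal.one_ne_top hf h hj)

/-! Polar derivatives -/

theorem eR_eq_add (θ : ℝ) : eR θ = cos θ • EuclideanSpace.single (0 : Fin 2) (1 : ℝ) +
    sin θ • EuclideanSpace.single (1 : Fin 2) (1 : ℝ) := by
  ext i; fin_cases i <;> simp

theorem eTheta_eq_add (θ : ℝ) : eTheta θ = -sin θ • EuclideanSpace.single (0 : Fin 2) (1 : ℝ) +
    cos θ • EuclideanSpace.single (1 : Fin 2) (1 : ℝ) := by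
  ext i; fin_cases i <;> simp

theorem hasDerivAt_eR (θ : ℝ) : HasDerivAt eR (eTheta θ) θ := by
  rw [eTheta_eq_add, funext eR_eq_add]
  exact ((Real.hasDerivAt_cos θ).smul_const _).add ((Real.hasDerivAt_sin θ).smul_const _)

theorem hasDerivAt_eTheta (θ : ℝ) : HasDerivAt eTheta (-eR θ) θ := by
  rw [eR_eq_add, funext eTheta_eq_add, neg_add, ← neg_smul, ← neg_smul]
  exact ((Real.hasDerivAt_sin θ).neg.smul_const _).add ((Real.hasDerivAt_cos θ).smul_const _)

theorem fderiv_eR (f : Plane → ℝ) (x : Plane) (θ : ℝ) :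
    fderiv ℝ f x (eR θ) = partialDeriv 0 f x * cos θ + partialDeriv 1 f x * sin θ := by
  rw [eR_eq_add, map_add, map_smul, map_smul, partialDeriv, partialDeriv, smul_eq_mul, smul_eq_mul]
  ring

theorem fderiv_eTheta (f : Plane → ℝ) (x : Plane) (θ : ℝ) :
    fderiv ℝ f x (eTheta θ) = -(partialDeriv 0 f x * sin θ) + partialDeriv 1 f x * cos θ := by
  rw [eTheta_eq_add, map_add, map_smul, map_smul, partialDeriv, partialDeriv, smul_eq_mul,
    smul_eq_mul]
  ring

theorem partialDeriv_zero_eq (f : Plane → ℝ) (x : Plane) (θ : ℝ) : partialDeriv 0 f x =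
    cos θ * fderiv ℝ f x (eR θ) - sin θ * fderiv ℝ f x (eTheta θ) := by
  rw [fderiv_eR, fderiv_eTheta]
  linear_combination (-partialDeriv 0 f x) * Real.sin_sq_add_cos_sq θ

theorem partialDeriv_one_eq (f : Plane → ℝ) (x : Plane) (θ : ℝ) : partialDeriv 1 f x =
    sin θ * fderiv ℝ f x (eR θ) + cos θ * fderiv ℝ f x (eTheta θ) := by
  rw [fderiv_eR, fderiv_eTheta]
  linear_combination (-partialDeriv 1 f x) * Real.sin_sq_add_cos_sq θ

theorem abs_partialDeriv_le (f : Plane → ℝ) (x : Plane) (θ : ℝ) (j : Fin 2) :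
    |partialDeriv j f x| ≤ |fderiv ℝ f x (eR θ)| + |fderiv ℝ f x (eTheta θ)| := by
  have hc := Real.abs_cos_le_one θ
  have hs := Real.abs_sin_le_one θ
  fin_cases j
  · change |partialDeriv 0 f x| ≤ _
    rw [partialDeriv_zero_eq f x θ]
    refine (abs_sub _ _).trans ?_
    rw [abs_mul, abs_mul]
    exact add_le_add (mul_le_of_le_one_left (abs_nonneg _) hc)
      (mul_le_of_le_one_left (abs_nonneg _) hs)
  · change |partialDeriv 1 f x| ≤ _
    rw [partialDeriv_one_eq f x θ]
    refine (abs_add_le _ _).trans ?_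
    rw [abs_mul, abs_mul]
    exact add_le_add (mul_le_of_le_one_left (abs_nonneg _) hs)
      (mul_le_of_le_one_left (abs_nonneg _) hc)

theorem hasDerivAt_radial {F : Type*} [NormedAddCommGroup F] [NormedSpace ℝ F] {f : Plane → F}
    {r θ : ℝ} (hf : DifferentiableAt ℝ f (r • eR θ)) :
    HasDerivAt (fun s : ℝ => f (s • eR θ)) (fderiv ℝ f (r • eR θ) (eR θ)) r := by
  have h : HasDerivAt (fun s : ℝ => s • eR θ) (eR θ) r := by
    simpa using (hasDerivAt_id r).smul_const (eR θ)
  exact hf.hasFDerivAt.comp_hasDerivAt r h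

theorem hasDerivAt_angular {F : Type*} [NormedAddCommGroup F] [NormedSpace ℝ F] {f : Plane → F}
    {r θ : ℝ} (hf : DifferentiableAt ℝ f (r • eR θ)) :
    HasDerivAt (fun t : ℝ => f (r • eR t)) (r • fderiv ℝ f (r • eR θ) (eTheta θ)) θ := by
  have h : HasDerivAt (fun t : ℝ => r • eR t) (r • eTheta θ) θ := (hasDerivAt_eR θ).const_smul r
  rw [← map_smul]
  exact hf.hasFDerivAt.comp_hasDerivAt θ h

/-! Quadratic functions of the angle -/

/-- The function `α cos² θ + β cos θ sin θ + γ` of the polar angle. -/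
def angular (α β γ : ℝ) (x : Plane) : ℝ :=
  α * cos (angle x) ^ 2 + β * (cos (angle x) * sin (angle x)) + γ

theorem coeff_eq_angular (a : ℝ) (i j k l : Fin 2) :
    ∃ α β γ, (fun x => coeff a x i j k l) = angular α β γ := by
  have key : ∃ α β γ, ∀ x, (a - 1) * (eR (angle x) j * eR (angle x) l) +
      (if j = l then 1 else 0) = angular α β γ x := by
    fin_cases j <;> fin_cases l
    · exact ⟨a - 1, 0, 1, fun x => by simp [angular, sq]⟩
    · exact ⟨0, a - 1, 0, fun x => by simp [angular]⟩
    · exact ⟨0, a - 1, 0, fun x => by simp [angular, mul_comm (sin _)]⟩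
    · refine ⟨-(a - 1), 0, a, fun x => ?_⟩
      have := Real.sin_sq_add_cos_sq (angle x)
      simp only [angular, eR_one, Fin.mk_one, if_true]
      linear_combination (a - 1) * this
  obtain ⟨α, β, γ, h⟩ := key
  refine ⟨(if i = k then 1 else 0) * α, (if i = k then 1 else 0) * β,
    (if i = k then 1 else 0) * γ, funext fun x => ?_⟩
  rw [coeff_apply, h, angular, angular]
  ring

/-- One entry that is not constant for `a ≠ 1` suffices for both negative statements about the
tensor. -/
theorem coeff_mixed_eq (a : ℝ) : (fun x => coeff a x 0 0 0 1) = angular 0 (a - 1) 0 := by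
  funext x
  simp [coeff_apply, angular]

/-- The first two coefficients are multiples of the difference of the squared column norms of `ξ`
and of the inner product of its columns. When `ν (a - 1) ≠ 0`, both vanish exactly when `ξᵀ ξ` is
scalar. -/
theorem integrand_eq_angular (ν a : ℝ) (ξ : Mat) : (fun x => integrand ν a x ξ) =
    angular (ν * (a - 1) * (ξ 0 0 ^ 2 + ξ 1 0 ^ 2 - (ξ 0 1 ^ 2 + ξ 1 1 ^ 2)))
      (2 * ν * (a - 1) * (ξ 0 0 * ξ 0 1 + ξ 1 0 * ξ 1 1))
      (ν * (a - 1) * (ξ 0 1 ^ 2 + ξ 1 1 ^ 2) +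
        ν * (ξ 0 0 ^ 2 + ξ 1 0 ^ 2 + ξ 0 1 ^ 2 + ξ 1 1 ^ 2)) := by
  funext x
  have h := Real.sin_sq_add_cos_sq (angle x)
  simp only [integrand_eq, angular, Fin.sum_univ_two, radPart, tanPart]
  generalize cos (angle x) = c at *
  generalize sin (angle x) = s at *
  linear_combination (ν * (a * (ξ 0 1 ^ 2 + ξ 1 1 ^ 2) + (ξ 0 0 ^ 2 + ξ 1 0 ^ 2))) * h

theorem isConformalMat_of {ξ : Mat}
    (h1 : ξ 0 0 ^ 2 + ξ 1 0 ^ 2 - (ξ 0 1 ^ 2 + ξ 1 1 ^ 2) = 0)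
    (h2 : ξ 0 0 * ξ 0 1 + ξ 1 0 * ξ 1 1 = 0) : IsConformalMat ξ := by
  refine ⟨ξ 0 0 ^ 2 + ξ 1 0 ^ 2, ?_⟩
  ext i j
  fin_cases i <;> fin_cases j <;> simp [Matrix.mul_apply, Fin.sum_univ_two] <;> linarith

theorem angular_smul_eR {r : ℝ} (hr : 0 < r) (α β γ θ : ℝ) :
    angular α β γ (r • eR θ) = α * cos θ ^ 2 + β * (cos θ * sin θ) + γ := by
  rw [angular, cos_angle_smul hr, sin_angle_smul hr]

/-- The function is constant on each open ray from the origin, so a limit at the origin is its value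
on every ray. -/
theorem angular_eq_zero_of_tendsto {α β γ l : ℝ}
    (h : Tendsto (angular α β γ) (𝓝[≠] 0) (𝓝 l)) : α = 0 ∧ β = 0 := by
  have key : ∀ θ, α * cos θ ^ 2 + β * (cos θ * sin θ) + γ = l := by
    intro θ
    have h1 : Tendsto (fun r : ℝ => r • eR θ) (𝓝[>] 0) (𝓝[≠] 0) := by
      refine tendsto_nhdsWithin_iff.2 ⟨?_, ?_⟩
      · have : Tendsto (fun r : ℝ => r • eR θ) (𝓝 0) (𝓝 ((0 : ℝ) • eR θ)) :=
          (continuous_id.smul continuous_const).tendsto 0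
        rw [zero_smul] at this
        exact this.mono_left nhdsWithin_le_nhds
      · filter_upwards [self_mem_nhdsWithin] with r hr
        have hr' : (0 : ℝ) < r := hr
        intro h0
        have := norm_smul_eR hr'.le θ
        rw [h0, norm_zero] at this
        exact hr'.ne this
    refine tendsto_nhds_unique ?_ (h.comp h1)
    refine tendsto_const_nhds.congr' ?_
    filter_upwards [self_mem_nhdsWithin] with r hr
    exact (angular_smul_eR hr α β γ θ).symm
  -- These three directions give the values `α + γ`, `γ` and `(α + β)/2 + γ`.
  have k0 := key 0
  have k1 := key (Real.pi / 2)
  have k2 := key (Real.pi / 4)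
  have hs : √2 * √2 = 2 := Real.mul_self_sqrt zero_le_two
  simp only [Real.cos_zero, Real.sin_zero, Real.cos_pi_div_two, Real.sin_pi_div_two,
    Real.cos_pi_div_four, Real.sin_pi_div_four] at k0 k1 k2
  have hα : α = 0 := by linarith
  subst hα
  refine ⟨rfl, ?_⟩
  nlinarith

theorem contDiffOn_angular (α β γ : ℝ) : ContDiffOn ℝ ∞ (angular α β γ) {0}ᶜ := by
  have h : ContDiffOn ℝ ∞ (fun x : Plane => α * (x 0 / ‖x‖) ^ 2 +
      β * ((x 0 / ‖x‖) * (x 1 / ‖x‖)) + γ) {0}ᶜ := by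
    intro x hx
    have hn : ContDiffAt ℝ ∞ (fun x : Plane => ‖x‖) x := contDiffAt_norm ℝ hx
    have hn0 : ‖x‖ ≠ 0 := norm_ne_zero_iff.2 hx
    have h0 : ContDiffAt ℝ ∞ (fun x : Plane => x 0) x := by fun_prop
    have h1 : ContDiffAt ℝ ∞ (fun x : Plane => x 1) x := by fun_prop
    exact (((contDiffAt_const.mul ((h0.div hn hn0).pow 2)).add (contDiffAt_const.mul
      ((h0.div hn hn0).mul (h1.div hn hn0)))).add contDiffAt_const).contDiffWithinAt
  refine h.congr fun x hx => ?_
  rw [angular, cos_angle hx, sin_angle hx]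

theorem abs_angular_le (α β γ : ℝ) (x : Plane) : |angular α β γ x| ≤ |α| + |β| + |γ| := by
  have hc := Real.abs_cos_le_one (angle x)
  have hs := Real.abs_sin_le_one (angle x)
  rw [angular]
  refine (abs_add_three _ _ _).trans ?_
  rw [abs_mul, abs_mul, abs_mul, abs_pow]
  have h1 : |cos (angle x)| ^ 2 ≤ 1 := pow_le_one₀ (abs_nonneg _) hc
  have h2 : |cos (angle x)| * |sin (angle x)| ≤ 1 := mul_le_one₀ hc (abs_nonneg _) hs
  gcongr
  · exact mul_le_of_le_one_right (abs_nonneg _) h1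
  · exact mul_le_of_le_one_right (abs_nonneg _) h2

theorem smul_eR_ne_zero {r : ℝ} (hr : 0 < r) (θ : ℝ) : r • eR θ ≠ 0 := by
  rw [← norm_ne_zero_iff, norm_smul_eR hr.le]
  exact hr.ne'

theorem differentiableAt_of_contDiffOn {f : Plane → ℝ} (hf : ContDiffOn ℝ ∞ f {0}ᶜ) {x : Plane}
    (hx : x ≠ 0) : DifferentiableAt ℝ f x :=
  (hf.contDiffAt (isOpen_compl_singleton.mem_nhds hx)).differentiableAt (by simp)

theorem fderiv_angular_eR (α β γ θ : ℝ) {r : ℝ} (hr : 0 < r) :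
    fderiv ℝ (angular α β γ) (r • eR θ) (eR θ) = 0 := by
  have h := hasDerivAt_radial (differentiableAt_of_contDiffOn (contDiffOn_angular α β γ)
    (smul_eR_ne_zero hr θ))
  refine h.unique ((hasDerivAt_const r
    (α * cos θ ^ 2 + β * (cos θ * sin θ) + γ)).congr_of_eventuallyEq ?_)
  filter_upwards [lt_mem_nhds hr] with s hs
  exact angular_smul_eR hs α β γ θ

theorem fderiv_angular_eTheta (α β γ θ : ℝ) {r : ℝ} (hr : 0 < r) :
    r * fderiv ℝ (angular α β γ) (r • eR θ) (eTheta θ) =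
      -(α * (2 * cos θ * sin θ)) + β * (cos θ ^ 2 - sin θ ^ 2) := by
  have h := hasDerivAt_angular (differentiableAt_of_contDiffOn (contDiffOn_angular α β γ)
    (smul_eR_ne_zero hr θ))
  have hc := Real.hasDerivAt_cos θ
  have hs := Real.hasDerivAt_sin θ
  have h' : HasDerivAt (fun t => α * cos t ^ 2 + β * (cos t * sin t) + γ)
      (α * (2 * cos θ ^ (2 - 1) * (-sin θ)) + β * (-sin θ * sin θ + cos θ * cos θ)) θ :=
    (((hc.pow 2).const_mul α).add ((hc.mul hs).const_mul β)).add_const γ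
  simp only [angular_smul_eR hr] at h
  rw [← smul_eq_mul, h.unique h', show 2 - 1 = 1 from rfl]
  ring

/-- By homogeneity of degree zero the radial derivative vanishes, and `r` times the tangential
derivative depends on the angle alone. -/
theorem abs_partialDeriv_angular_le (α β γ : ℝ) {x : Plane} (hx : x ≠ 0) (j : Fin 2) :
    |partialDeriv j (angular α β γ) x| ≤ (2 * |α| + 2 * |β|) * ‖x‖ ^ (-1 : ℝ) := by
  have hpos : 0 < ‖x‖ := norm_pos_iff.2 hx
  have h := abs_partialDeriv_le (angular α β γ) x (angle x) j
  have h1 := fderiv_angular_eR α β γ (angle x) hpos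
  have h2 := fderiv_angular_eTheta α β γ (angle x) hpos
  rw [norm_smul_eR_angle] at h1 h2
  rw [h1, abs_zero, zero_add] at h
  refine h.trans ?_
  rw [Real.rpow_neg_one, ← div_eq_mul_inv, le_div_iff₀ hpos, mul_comm,
    show ∀ t, ‖x‖ * |t| = |‖x‖ * t| from fun t => by rw [abs_mul, abs_norm], h2]
  have hc := Real.abs_cos_le_one (angle x)
  have hs := Real.abs_sin_le_one (angle x)
  refine (abs_add_le _ _).trans ?_
  rw [abs_neg, abs_mul, abs_mul, abs_mul, abs_mul, abs_two]
  have h4 : |cos (angle x)| * |sin (angle x)| ≤ 1 := mul_le_one₀ hc (abs_nonneg _) hs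
  have h5 : |cos (angle x) ^ 2 - sin (angle x) ^ 2| ≤ 2 := by
    refine (abs_sub _ _).trans ?_
    rw [abs_pow, abs_pow]
    linarith [pow_le_one₀ (n := 2) (abs_nonneg _) hc, pow_le_one₀ (n := 2) (abs_nonneg _) hs]
  have h6 := mul_le_mul_of_nonneg_left h4 (abs_nonneg α)
  have h7 := mul_le_mul_of_nonneg_left h5 (abs_nonneg β)
  linarith

theorem aestronglyMeasurable_angular (α β γ : ℝ) :
    AEStronglyMeasurable (angular α β γ) discMeasure :=
  aestronglyMeasurable_of_contDiffOn (contDiffOn_angular α β γ).continuousOn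

theorem memLp_angular (α β γ : ℝ) (q : ℝ≥0∞) : MemLp (angular α β γ) q discMeasure :=
  MemLp.of_bound (aestronglyMeasurable_angular α β γ) _ (ae_of_all _ (abs_angular_le α β γ))

theorem toReal_mul_lt_two {q : ℝ≥0∞} (hq : q < 2) : 1 * q.toReal < 2 := by
  rw [one_mul]
  exact (ENNReal.toReal_lt_toReal hq.ne_top (by simp)).2 hq

theorem memLp_of_le_inv_norm {f : Plane → ℝ} (hf : AEStronglyMeasurable f discMeasure) {C : ℝ}
    (hC : ∀ x, x ≠ 0 → |f x| ≤ C * ‖x‖ ^ (-1 : ℝ)) {q : ℝ≥0∞} (hq1 : 1 ≤ q) (hq : q < 2) :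
    MemLp f q discMeasure := by
  refine ((memLp_norm_rpow_neg (zero_lt_one.trans_le hq1).ne' hq.ne_top
    (toReal_mul_lt_two hq)).const_mul C).mono' hf ?_
  filter_upwards [ae_disc_mem] with x hx using hC x hx.2

theorem hasWeakPartial_angular (α β γ : ℝ) (j : Fin 2) :
    HasWeakPartial j (angular α β γ) (partialDeriv j (angular α β γ)) := by
  refine hasWeakPartial_of_contDiffOn (contDiffOn_angular α β γ) ?_ ?_
  · refine memLp_of_le_inv_norm (C := |α| + |β| + |γ|) ?_ (fun x hx => ?_) le_rfl (by norm_num)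
    · exact (aestronglyMeasurable_angular α β γ).div₀ (by fun_prop)
    · rw [abs_div, abs_norm, Real.rpow_neg_one, ← div_eq_mul_inv]
      gcongr
      exact abs_angular_le α β γ x
  · exact memLp_of_le_inv_norm (aestronglyMeasurable_of_contDiffOn
      (continuousOn_partialDeriv (contDiffOn_angular α β γ) j))
      (fun x hx => abs_partialDeriv_angular_le α β γ hx j) le_rfl (by norm_num)

theorem memW1_angular (α β γ : ℝ) {q : ℝ≥0∞} (hq1 : 1 ≤ q) (hq : q < 2) :
    MemW1 q (angular α β γ) :=
  ⟨memLp_angular α β γ q, fun j => ⟨_, hasWeakPartial_angular α β γ j,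
    memLp_of_le_inv_norm (aestronglyMeasurable_of_contDiffOn
      (continuousOn_partialDeriv (contDiffOn_angular α β γ) j))
      (fun _ hx => abs_partialDeriv_angular_le α β γ hx j) hq1 hq⟩⟩

theorem measurable_cos_angle : Measurable fun x => cos (angle x) :=
  Real.measurable_cos.comp measurable_angle

theorem measurable_sin_angle : Measurable fun x => sin (angle x) :=
  Real.measurable_sin.comp measurable_angle

theorem memLp_cos_angle_mul {f : Plane → ℝ} {q : ℝ≥0∞} (hf : MemLp f q discMeasure) :
    MemLp (fun x => f x * cos (angle x)) q discMeasure := by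
  refine hf.mono (hf.1.mul measurable_cos_angle.aestronglyMeasurable) (ae_of_all _ fun x => ?_)
  rw [norm_mul]
  exact mul_le_of_le_one_right (norm_nonneg _) (Real.abs_cos_le_one _)

theorem memLp_sin_angle_mul {f : Plane → ℝ} {q : ℝ≥0∞} (hf : MemLp f q discMeasure) :
    MemLp (fun x => f x * sin (angle x)) q discMeasure := by
  refine hf.mono (hf.1.mul measurable_sin_angle.aestronglyMeasurable) (ae_of_all _ fun x => ?_)
  rw [norm_mul]
  exact mul_le_of_le_one_right (norm_nonneg _) (Real.abs_sin_le_one _)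

/-- The tangential derivative is `h(θ)/r`, so its square with the Jacobian is `h(θ)²/r`. This is
integrable only if the trigonometric polynomial `h` vanishes. -/
theorem angular_eq_zero_of_memW1 {α β γ : ℝ} (h : MemW1 2 (angular α β γ)) : α = 0 ∧ β = 0 := by
  have hp : ∀ j, MemLp (partialDeriv j (angular α β γ)) 2 discMeasure := by
    intro j
    obtain ⟨g, hg, hg2⟩ := h.2 j
    exact hg2.ae_eq (hg.ae_eq (hasWeakPartial_angular α β γ j))
  have hT := ((memLp_sin_angle_mul (hp 0)).neg.add (memLp_cos_angle_mul (hp 1)))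
  have hi := (integrable_disc_iff hT.integrable_sq.1).1 hT.integrable_sq
  have hi2 : Integrable (fun p : ℝ × ℝ => (-(α * (2 * cos p.2 * sin p.2)) +
      β * (cos p.2 ^ 2 - sin p.2 ^ 2)) ^ 2 * p.1⁻¹) polarMeasure := by
    refine hi.congr ?_
    filter_upwards [ae_polar_mem] with p hp
    have hr : 0 < p.1 := hp.1.1
    have e := fderiv_angular_eTheta α β γ p.2 hr
    rw [fderiv_eTheta] at e
    rw [← e]
    simp only [Pi.add_apply, Pi.neg_apply, cos_angle_smul hr, sin_angle_smul hr]
    field_simp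
  -- By Fubini, almost every radial slice is integrable, and at an angle with `h(θ) ≠ 0` the slice
  -- is a nonzero multiple of `1/r`.
  have hae := hi2.prod_left_ae
  have hz : ∀ᵐ θ ∂(volume.restrict (Ioo (-Real.pi) Real.pi)),
      -(α * (2 * cos θ * sin θ)) + β * (cos θ ^ 2 - sin θ ^ 2) = 0 := by
    filter_upwards [hae] with θ hθ
    by_contra hne
    have h1 : IntegrableOn (fun r : ℝ => r⁻¹) (Ioo 0 1) := by
      have := hθ.const_mul ((-(α * (2 * cos θ * sin θ)) + β * (cos θ ^ 2 - sin θ ^ 2)) ^ 2)⁻¹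
      refine this.congr (ae_of_all _ fun r => ?_)
      exact inv_mul_cancel_left₀ (pow_ne_zero 2 hne) _
    have h2 : IntervalIntegrable (fun r : ℝ => r⁻¹) volume 0 1 := by
      rwa [intervalIntegrable_iff_integrableOn_Ioo_of_le zero_le_one]
    rw [intervalIntegrable_inv_iff] at h2
    simp at h2
  have hall := Measure.eqOn_open_of_ae_eq (f := fun θ : ℝ => -(α * (2 * cos θ * sin θ)) +
      β * (cos θ ^ 2 - sin θ ^ 2)) (g := fun _ => 0) hz isOpen_Ioo (by fun_prop) (by fun_prop)
  have hπ := pi_pos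
  have k0 := hall (show (0 : ℝ) ∈ _ from ⟨by linarith, by linarith⟩)
  have k1 := hall (show Real.pi / 4 ∈ _ from ⟨by linarith, by linarith⟩)
  have hs : √2 * √2 = 2 := Real.mul_self_sqrt zero_le_two
  simp only [Real.cos_zero, Real.sin_zero, Real.cos_pi_div_four, Real.sin_pi_div_four] at k0 k1
  have hβ : β = 0 := by linarith
  subst hβ
  refine ⟨?_, rfl⟩
  nlinarith

/-! The coefficients -/

theorem coeff_memLp_top (a : ℝ) (i j k l : Fin 2) :
    MemLp (fun x => coeff a x i j k l) ⊤ discMeasure := by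
  obtain ⟨α, β, γ, h⟩ := coeff_eq_angular a i j k l
  rw [h]
  exact memLp_angular α β γ ⊤

theorem integrand_eq_coeff (ν a : ℝ) (x : Plane) (ξ : Mat) :
    integrand ν a x ξ = ν * frob ((coeff a x).act ξ) ξ := by
  rw [integrand_eq, frob_coeff_act]
  congr 1
  exact Finset.sum_congr rfl fun i _ => by ring

theorem coeff_coercive {a : ℝ} (ha : 1 ≤ a) (x : Plane) (ξ : Mat) :
    frob ξ ξ ≤ frob ((coeff a x).act ξ) ξ := by
  rw [frob_coeff_act, ← sum_sq_parts ξ (angle x)]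
  refine Finset.sum_le_sum fun i _ => ?_
  have := mul_le_mul_of_nonneg_right ha (sq_nonneg (radPart ξ (angle x) i))
  linarith

theorem coeff_not_tendsto {a : ℝ} (ha : a ≠ 1) :
    ¬ ∃ L : Tensor, Tendsto (coeff a) (𝓝[≠] 0) (𝓝 L) := by
  rintro ⟨L, hL⟩
  have h1 := tendsto_pi_nhds.1 (tendsto_pi_nhds.1 (tendsto_pi_nhds.1
    (tendsto_pi_nhds.1 hL 0) 0) 0) 1
  rw [coeff_mixed_eq] at h1
  exact ha (sub_eq_zero.1 (angular_eq_zero_of_tendsto h1).2)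

theorem coeff_memW1 (a : ℝ) {q : ℝ≥0∞} (hq1 : 1 ≤ q) (hq : q < 2) : TensorMemW1 q (coeff a) := by
  intro i j k l
  obtain ⟨α, β, γ, h⟩ := coeff_eq_angular a i j k l
  rw [h]
  exact memW1_angular α β γ hq1 hq

theorem coeff_not_memW1 {a : ℝ} (ha : a ≠ 1) : ¬ TensorMemW1 2 (coeff a) := by
  intro h
  have h1 := h 0 0 0 1
  rw [coeff_mixed_eq] at h1
  exact ha (sub_eq_zero.1 (angular_eq_zero_of_memW1 h1).2)

theorem isConformalMat_of_integrand {ν a : ℝ} (hν : ν ≠ 0) (ha : a ≠ 1) {ξ : Mat}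
    (h : ν * (a - 1) * (ξ 0 0 ^ 2 + ξ 1 0 ^ 2 - (ξ 0 1 ^ 2 + ξ 1 1 ^ 2)) = 0 ∧
      2 * ν * (a - 1) * (ξ 0 0 * ξ 0 1 + ξ 1 0 * ξ 1 1) = 0) : IsConformalMat ξ := by
  have ha' : a - 1 ≠ 0 := sub_ne_zero.2 ha
  refine isConformalMat_of ?_ ?_
  · simpa [hν, ha'] using h.1
  · simpa [hν, ha'] using h.2

theorem integrand_not_tendsto {ν a : ℝ} (hν : ν ≠ 0) (ha : a ≠ 1) {ξ : Mat}
    (hξ : ¬ IsConformalMat ξ) :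
    ¬ ∃ l : ℝ, Tendsto (fun x => integrand ν a x ξ) (𝓝[≠] 0) (𝓝 l) := by
  rintro ⟨l, hl⟩
  rw [integrand_eq_angular] at hl
  exact hξ (isConformalMat_of_integrand hν ha (angular_eq_zero_of_tendsto hl))

theorem integrand_memW1 (ν a : ℝ) (ξ : Mat) {q : ℝ≥0∞} (hq1 : 1 ≤ q) (hq : q < 2) :
    MemW1 q fun x => integrand ν a x ξ := by
  rw [integrand_eq_angular]
  exact memW1_angular _ _ _ hq1 hq

theorem integrand_not_memW1 {ν a : ℝ} (hν : ν ≠ 0) (ha : a ≠ 1) {ξ : Mat}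
    (hξ : ¬ IsConformalMat ξ) : ¬ MemW1 2 fun x => integrand ν a x ξ := by
  intro h
  rw [integrand_eq_angular] at h
  exact hξ (isConformalMat_of_integrand hν ha (angular_eq_zero_of_memW1 h))

/-! The Wirtinger inequality -/

theorem neg_pi_lt_pi : -Real.pi < Real.pi := by linarith [pi_pos]

/-- Parseval: for period `2π` the coefficients satisfy `|f̂'(n)| = |n| |f̂(n)|`, and the only
frequency with `|n| < 1` is removed by the zero mean. -/
theorem wirtinger {f f' : ℝ → ℝ} (hf : ∀ θ, HasDerivAt f (f' θ) θ) (hf' : Continuous f')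
    (hper : f (-Real.pi) = f Real.pi) (hmean : ∫ θ in -Real.pi..Real.pi, f θ = 0) :
    ∫ θ in -Real.pi..Real.pi, f θ ^ 2 ≤ ∫ θ in -Real.pi..Real.pi, f' θ ^ 2 := by
  have hab := neg_pi_lt_pi
  have hfc : Continuous f := continuous_iff_continuousAt.2 fun θ => (hf θ).continuousAt
  have hL : ∀ g : ℝ → ℝ, Continuous g →
      MemLp (fun θ => (g θ : ℂ)) 2 (volume.restrict (Ioc (-Real.pi) Real.pi)) := by
    intro g hg
    have hg' : Continuous fun θ => (g θ : ℂ) := Complex.continuous_ofReal.comp hg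
    obtain ⟨C, hC⟩ := (isCompact_Icc (a := -Real.pi) (b := Real.pi)).exists_bound_of_continuousOn
      hg'.continuousOn
    refine MemLp.of_bound hg'.aestronglyMeasurable C ?_
    filter_upwards [ae_restrict_mem measurableSet_Ioc] with x hx
    exact hC x (Ioc_subset_Icc_self hx)
  have h1 := hasSum_sq_fourierCoeffOn hab (hL f hfc)
  have h2 := hasSum_sq_fourierCoeffOn hab (hL f' hf')
  have hle : ∀ n : ℤ, ‖fourierCoeffOn hab (fun θ => (f θ : ℂ)) n‖ ^ 2 ≤
      ‖fourierCoeffOn hab (fun θ => (f' θ : ℂ)) n‖ ^ 2 := by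
    intro n
    by_cases hn : n = 0
    · subst hn
      have : fourierCoeffOn hab (fun θ => (f θ : ℂ)) 0 = 0 := by
        rw [fourierCoeffOn_eq_integral]
        simp [intervalIntegral.integral_ofReal, hmean]
      rw [this]
      simp
    -- The endpoint term vanishes by periodicity, and what is left is the coefficient of `f'`
    -- divided by `n`, up to a unit factor.
    · have := fourierCoeffOn_of_hasDerivAt hab hn (f := fun θ => (f θ : ℂ))
        (f' := fun θ => (f' θ : ℂ)) (fun x _ => (hf x).ofReal_comp)
        ((Complex.continuous_ofReal.comp hf').intervalIntegrable _ _)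
      rw [this, hper, sub_self, mul_zero, zero_sub, norm_mul, norm_neg, norm_mul]
      gcongr
      have hn1 : (1 : ℝ) ≤ |(n : ℝ)| := by
        rw [← Int.cast_abs]
        exact_mod_cast Int.one_le_abs hn
      have e1 : ‖((Real.pi : ℝ) : ℂ) - ((-Real.pi : ℝ) : ℂ)‖ = 2 * Real.pi := by
        rw [← Complex.ofReal_sub, Complex.norm_real, Real.norm_of_nonneg (by linarith)]
        ring
      have e2 : ‖(1 : ℂ) / (-2 * Real.pi * Complex.I * n)‖ = 1 / (2 * Real.pi * |(n : ℝ)|) := by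
        simp [abs_of_pos pi_pos]
      rw [e1, e2, ← mul_assoc]
      refine mul_le_of_le_one_left (norm_nonneg _) ?_
      rw [one_div_mul_eq_div, div_le_one (by positivity)]
      nlinarith [pi_pos]
  have h3 := hasSum_le hle h1 h2
  have e : ∀ g : ℝ → ℝ, ∫ x in -Real.pi..Real.pi, ‖(g x : ℂ)‖ ^ 2 =
      ∫ x in -Real.pi..Real.pi, g x ^ 2 := by
    intro g
    congr 1 with x
    simp
  rw [e, e, smul_eq_mul, smul_eq_mul] at h3
  exact le_of_mul_le_mul_left h3 (by rw [inv_pos]; linarith)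

theorem abs_integral_mul_deriv_le {f f' g g' : ℝ → ℝ} (hf : ∀ θ, HasDerivAt f (f' θ) θ)
    (hf' : Continuous f') (hg : ∀ θ, HasDerivAt g (g' θ) θ) (hg' : Continuous g')
    (hfp : f (-Real.pi) = f Real.pi) (hgp : g (-Real.pi) = g Real.pi) :
    |2 * ∫ θ in -Real.pi..Real.pi, f θ * g' θ| ≤
      ∫ θ in -Real.pi..Real.pi, (f' θ ^ 2 + g' θ ^ 2) := by
  have hfc : Continuous f := continuous_iff_continuousAt.2 fun θ => (hf θ).continuousAt
  -- Since `g'` has zero integral, `f` may be replaced by `f - m`. Then `2|xy| ≤ x² + y²` and the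
  -- Wirtinger inequality for `f - m` finish the bound.
  set m := (2 * Real.pi)⁻¹ * ∫ θ in -Real.pi..Real.pi, f θ with hm
  have hw := wirtinger (f := fun θ => f θ - m) (fun θ => (hf θ).sub_const m) hf' (by simp [hfp])
    (by
      rw [intervalIntegral.integral_sub (hfc.intervalIntegrable _ _) (by simp),
        intervalIntegral.integral_const, smul_eq_mul, hm]
      have := pi_pos
      field_simp
      ring)
  have h0 : ∫ θ in -Real.pi..Real.pi, g' θ = 0 := by
    rw [intervalIntegral.integral_eq_sub_of_hasDerivAt (fun x _ => hg x)
      (hg'.intervalIntegrable _ _), hgp, sub_self]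
  have e : ∫ θ in -Real.pi..Real.pi, f θ * g' θ =
      ∫ θ in -Real.pi..Real.pi, (f θ - m) * g' θ := by
    have : ∀ θ, (f θ - m) * g' θ = f θ * g' θ - m * g' θ := fun θ => by ring
    simp only [this]
    rw [intervalIntegral.integral_sub (by apply Continuous.intervalIntegrable; fun_prop)
      (by apply Continuous.intervalIntegrable; fun_prop), intervalIntegral.integral_const_mul, h0]
    ring
  rw [intervalIntegral.integral_add (by apply Continuous.intervalIntegrable; fun_prop)
    (by apply Continuous.intervalIntegrable; fun_prop), e, ← intervalIntegral.integral_const_mul]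
  refine (intervalIntegral.abs_integral_le_integral_abs neg_pi_lt_pi.le).trans
    (le_trans ?_ (add_le_add_left hw _))
  rw [← intervalIntegral.integral_add (by apply Continuous.intervalIntegrable; fun_prop)
    (by apply Continuous.intervalIntegrable; fun_prop)]
  refine intervalIntegral.integral_mono_on neg_pi_lt_pi.le
    (by apply Continuous.intervalIntegrable; fun_prop)
    (by apply Continuous.intervalIntegrable; fun_prop) fun θ _ => ?_
  rw [abs_le]
  constructor
  · nlinarith [sq_nonneg (f θ - m + g' θ)]
  · nlinarith [sq_nonneg (f θ - m - g' θ)]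

/-! Integral identities for smooth functions in polar coordinates -/

/-- The radial derivative. -/
def radDeriv (f : Plane → ℝ) (x : Plane) : ℝ := fderiv ℝ f x (eR (angle x))

/-- The normalized angular derivative. -/
def angDeriv (f : Plane → ℝ) (x : Plane) : ℝ := fderiv ℝ f x (eTheta (angle x))

theorem eTheta_angle_smul {r : ℝ} (hr : 0 < r) (θ : ℝ) :
    eTheta (angle (r • eR θ)) = eTheta θ := by
  rw [eTheta, cos_angle_smul hr, sin_angle_smul hr, eTheta]

theorem radDeriv_smul_eR (f : Plane → ℝ) {r : ℝ} (hr : 0 < r) (θ : ℝ) :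
    radDeriv f (r • eR θ) = fderiv ℝ f (r • eR θ) (eR θ) := by
  rw [radDeriv, eR_angle_smul hr]

theorem angDeriv_smul_eR (f : Plane → ℝ) {r : ℝ} (hr : 0 < r) (θ : ℝ) :
    angDeriv f (r • eR θ) = fderiv ℝ f (r • eR θ) (eTheta θ) := by
  rw [angDeriv, eTheta_angle_smul hr]

@[fun_prop]
theorem continuous_eTheta : Continuous eTheta :=
  continuous_iff_continuousAt.2 fun θ => (hasDerivAt_eTheta θ).continuousAt

theorem aestronglyMeasurable_radDeriv {f : Plane → ℝ} (hf : ContDiff ℝ ∞ f) :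
    AEStronglyMeasurable (radDeriv f) discMeasure := by
  have : radDeriv f = fun x => partialDeriv 0 f x * cos (angle x) +
      partialDeriv 1 f x * sin (angle x) := funext fun x => fderiv_eR f x _
  rw [this]
  exact (((continuous_partialDeriv hf 0).measurable.mul measurable_cos_angle).add
    ((continuous_partialDeriv hf 1).measurable.mul measurable_sin_angle)).aestronglyMeasurable

theorem aestronglyMeasurable_angDeriv {f : Plane → ℝ} (hf : ContDiff ℝ ∞ f) :
    AEStronglyMeasurable (angDeriv f) discMeasure := by
  have : angDeriv f = fun x => -(partialDeriv 0 f x * sin (angle x)) +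
      partialDeriv 1 f x * cos (angle x) := funext fun x => fderiv_eTheta f x _
  rw [this]
  exact (((continuous_partialDeriv hf 0).measurable.mul measurable_sin_angle).neg.add
    ((continuous_partialDeriv hf 1).measurable.mul measurable_cos_angle)).aestronglyMeasurable

theorem continuous_fderiv_polar_eR {f : Plane → ℝ} (hf : ContDiff ℝ ∞ f) :
    Continuous fun p : ℝ × ℝ => fderiv ℝ f (p.1 • eR p.2) (eR p.2) :=
  ((hf.continuous_fderiv (by simp)).comp continuous_polar).clm_apply
    (continuous_eR.comp continuous_snd)

theorem continuous_fderiv_polar_eTheta {f : Plane → ℝ} (hf : ContDiff ℝ ∞ f) :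
    Continuous fun p : ℝ × ℝ => fderiv ℝ f (p.1 • eR p.2) (eTheta p.2) :=
  ((hf.continuous_fderiv (by simp)).comp continuous_polar).clm_apply
    (continuous_eTheta.comp continuous_snd)

theorem eR_neg_pi : eR (-Real.pi) = eR Real.pi := by
  rw [eR_congr_iff]
  simp

theorem continuous_radial {f : Plane → ℝ} (hf : ContDiff ℝ ∞ f) :
    Continuous fun p : ℝ × ℝ => f (p.1 • eR p.2) :=
  hf.continuous.comp continuous_polar

theorem integrableOn_log : IntegrableOn Real.log (Ioo 0 1) :=
  (intervalIntegrable_iff_integrableOn_Ioo_of_le zero_le_one).1 intervalIntegral.intervalIntegrable_log'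

theorem integrableOn_add_log (A B : ℝ) :
    IntegrableOn (fun r => A + B * Real.log r) (Ioo 0 1) :=
  (integrableOn_const (by simp)).add (integrableOn_log.const_mul B)

/-- The Euler-Lagrange identity of the covering map, tested with a smooth function. -/
theorem integral_radDeriv_add_angDeriv {a N : ℝ} (hN : N ≠ 0) {c c' : ℝ → ℝ}
    (hc : Continuous c) (hc' : ∀ θ, HasDerivAt c' (-(N * c θ)) θ)
    (hp : ∀ θ θ', eR θ = eR θ' → c θ = c θ' ∧ c' θ = c' θ')
    (hm : Measurable fun x => c (angle x)) (hm' : Measurable fun x => c' (angle x))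
    {f : Plane → ℝ} (hf : ContDiff ℝ ∞ f) :
    ∫ x, ((a + (N ^ 2 - a) * Real.log ‖x‖) * (c (angle x) * radDeriv f x) +
      (N + (N ^ 2 - a) / N * Real.log ‖x‖) * (c' (angle x) * angDeriv f x)) ∂discMeasure =
      a * ∫ θ in -Real.pi..Real.pi, c θ * f (eR θ) := by
  have hc'c : Continuous c' := continuous_iff_continuousAt.2 fun θ => (hc' θ).continuousAt
  have hfd : Differentiable ℝ f := hf.differentiable (by simp)
  have hfr := continuous_fderiv_polar_eR hf
  have hft := continuous_fderiv_polar_eTheta hf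
  have hf0 := continuous_radial hf
  have hlog : Measurable fun x : Plane => Real.log ‖x‖ := by fun_prop
  have hmeas : AEStronglyMeasurable (fun x : Plane => (a + (N ^ 2 - a) * Real.log ‖x‖) *
      (c (angle x) * radDeriv f x) + (N + (N ^ 2 - a) / N * Real.log ‖x‖) *
      (c' (angle x) * angDeriv f x)) discMeasure :=
    ((((hlog.const_mul _).const_add _).aestronglyMeasurable).mul
      (hm.aestronglyMeasurable.mul (aestronglyMeasurable_radDeriv hf))).add
    ((((hlog.const_mul _).const_add _).aestronglyMeasurable).mul
      (hm'.aestronglyMeasurable.mul (aestronglyMeasurable_angDeriv hf)))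
  have i1 : Integrable (fun p : ℝ × ℝ => (a + (N ^ 2 - a) * Real.log p.1) *
      (p.1 * (c p.2 * fderiv ℝ f (p.1 • eR p.2) (eR p.2)))) polarMeasure :=
    integrable_polar_mul (integrableOn_add_log _ _) (by fun_prop)
  have i2 : Integrable (fun p : ℝ × ℝ => (N + (N ^ 2 - a) / N * Real.log p.1) *
      (c' p.2 * (p.1 * fderiv ℝ f (p.1 • eR p.2) (eTheta p.2)))) polarMeasure :=
    integrable_polar_mul (integrableOn_add_log _ _) (by fun_prop)
  have i3 : Integrable (fun p : ℝ × ℝ => (N ^ 2 + (N ^ 2 - a) * Real.log p.1) *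
      (c p.2 * f (p.1 • eR p.2))) polarMeasure :=
    integrable_polar_mul (integrableOn_add_log _ _) (by fun_prop)
  have e1 : ∫ p, (a + (N ^ 2 - a) * Real.log p.1) *
      (p.1 * (c p.2 * fderiv ℝ f (p.1 • eR p.2) (eR p.2))) ∂polarMeasure =
      a * (∫ θ in -Real.pi..Real.pi, c θ * f (eR θ)) -
      ∫ p, (N ^ 2 + (N ^ 2 - a) * Real.log p.1) * (c p.2 * f (p.1 • eR p.2)) ∂polarMeasure := by
    rw [eq_sub_iff_add_eq, ← integral_add i1 i3, integral_polar_symm (i1.fun_add i3),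
      ← intervalIntegral.integral_const_mul]
    congr 1 with θ
    dsimp only
    have hcont : Continuous fun r : ℝ => c θ * f (r • eR θ) := by fun_prop
    have hcr : Continuous fun r : ℝ => fderiv ℝ f (r • eR θ) (eR θ) :=
      hfr.comp (by fun_prop : Continuous fun r : ℝ => (r, θ))
    have hlogi : ∀ A B : ℝ, IntervalIntegrable (fun r => A + B * Real.log r) volume 0 1 :=
      fun A B => (intervalIntegrable_iff_integrableOn_Ioo_of_le zero_le_one).2
        (integrableOn_add_log A B)
    -- The weight `a r + (N² - a) r log r` has derivative `N² + (N² - a) log r`. It is continuous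
    -- with value `0` at `r = 0`, and its value `a` at `r = 1` produces the boundary term.
    rw [intervalIntegral.integral_eq_sub_of_hasDerivAt_of_le zero_le_one
      (f := fun r => (a * r + (N ^ 2 - a) * (r * Real.log r)) * (c θ * f (r • eR θ)))]
    · simp
    · exact (((continuous_const.mul continuous_id).add (continuous_const.mul
        Real.continuous_mul_log)).mul hcont).continuousOn
    · intro r hr
      have h1 := ((hasDerivAt_id' r).const_mul a).add
        ((Real.hasDerivAt_mul_log hr.1.ne').const_mul (N ^ 2 - a))
      have h2 := (hasDerivAt_radial (hfd (r • eR θ))).const_mul (c θ)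
      refine (h1.mul h2).congr_deriv ?_
      simp only [Pi.add_apply]
      ring
    · exact ((hlogi _ _).mul_continuousOn
        (continuous_id.mul (continuous_const.mul hcr)).continuousOn).add
        ((hlogi _ _).mul_continuousOn hcont.continuousOn)
  have e2 : ∫ p, (N + (N ^ 2 - a) / N * Real.log p.1) *
      (c' p.2 * (p.1 * fderiv ℝ f (p.1 • eR p.2) (eTheta p.2))) ∂polarMeasure =
      ∫ p, (N ^ 2 + (N ^ 2 - a) * Real.log p.1) * (c p.2 * f (p.1 • eR p.2)) ∂polarMeasure := by
    -- Integration by parts in the angle replaces `c'` by `N c`, and `N` times the tangential weight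
    -- is the weight left over from the radial integration. The two interior terms therefore cancel
    -- in the sum.
    rw [integral_polar i2, integral_polar i3]
    congr 1 with r
    dsimp only
    rw [intervalIntegral.integral_const_mul, intervalIntegral.integral_const_mul]
    have hft' : Continuous fun θ : ℝ => fderiv ℝ f (r • eR θ) (eTheta θ) :=
      hft.comp (by fun_prop : Continuous fun θ : ℝ => (r, θ))
    have h := intervalIntegral.integral_mul_deriv_eq_deriv_mul (a := -Real.pi) (b := Real.pi)
      (fun θ _ => hc' θ) (fun θ _ => hasDerivAt_angular (r := r) (hfd (r • eR θ)))
      ((hc.const_mul N).neg.intervalIntegrable _ _)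
      ((by fun_prop : Continuous fun θ => r • fderiv ℝ f (r • eR θ) (eTheta θ)).intervalIntegrable
        _ _)
    simp only [smul_eq_mul] at h
    rw [h, eR_neg_pi, (hp _ _ eR_neg_pi).2, sub_self, zero_sub, ← intervalIntegral.integral_neg,
      ← intervalIntegral.integral_const_mul, ← intervalIntegral.integral_const_mul]
    congr 1 with θ
    field_simp
    try ring
  rw [integral_disc hmeas]
  have e3 : ∫ p, p.1 * ((a + (N ^ 2 - a) * Real.log ‖p.1 • eR p.2‖) *
      (c (angle (p.1 • eR p.2)) * radDeriv f (p.1 • eR p.2)) +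
      (N + (N ^ 2 - a) / N * Real.log ‖p.1 • eR p.2‖) *
      (c' (angle (p.1 • eR p.2)) * angDeriv f (p.1 • eR p.2))) ∂polarMeasure =
      ∫ p, ((a + (N ^ 2 - a) * Real.log p.1) *
      (p.1 * (c p.2 * fderiv ℝ f (p.1 • eR p.2) (eR p.2))) +
      (N + (N ^ 2 - a) / N * Real.log p.1) *
      (c' p.2 * (p.1 * fderiv ℝ f (p.1 • eR p.2) (eTheta p.2)))) ∂polarMeasure := by
    apply integral_congr_ae
    filter_upwards [ae_polar_mem] with p hpm
    have hr : 0 < p.1 := hpm.1.1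
    rw [norm_smul_eR hr.le, radDeriv_smul_eR f hr, angDeriv_smul_eR f hr,
      (hp _ _ (eR_angle_smul hr p.2)).1, (hp _ _ (eR_angle_smul hr p.2)).2]
    ring
  rw [e3, integral_add i1 i2, e1, e2]
  ring

/-- A weighted integral of a Jacobian determinant is controlled by the angular derivatives. -/
theorem abs_integral_jacobian_le {L L' : ℝ → ℝ} (hL : ∀ r, HasDerivAt L (L' r) r)
    (hL' : Continuous L') (hL1 : L 1 = 0) (hL0 : ∀ r ∈ Ioo (0 : ℝ) 1, 0 ≤ L' r ∧ r * L' r ≤ 1)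
    {f g : Plane → ℝ} (hf : ContDiff ℝ ∞ f) (hg : ContDiff ℝ ∞ g) :
    |2 * ∫ x, L ‖x‖ * (radDeriv f x * angDeriv g x - angDeriv f x * radDeriv g x) ∂discMeasure| ≤
      ∫ x, (angDeriv f x ^ 2 + angDeriv g x ^ 2) ∂discMeasure := by
  have hLc : Continuous L := continuous_iff_continuousAt.2 fun r => (hL r).continuousAt
  have hfd : Differentiable ℝ f := hf.differentiable (by simp)
  have hgd : Differentiable ℝ g := hg.differentiable (by simp)
  have hg2 : ContDiff ℝ ∞ (fderiv ℝ g) := hg.fderiv_right (by simp)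
  have hgd2 : Differentiable ℝ (fderiv ℝ g) := hg2.differentiable (by simp)
  have hf0 := hf.continuous
  have hfr := continuous_fderiv_polar_eR hf
  have hft := continuous_fderiv_polar_eTheta hf
  have hgr := continuous_fderiv_polar_eR hg
  have hgt := continuous_fderiv_polar_eTheta hg
  have hgrt : Continuous fun p : ℝ × ℝ =>
      fderiv ℝ (fderiv ℝ g) (p.1 • eR p.2) (eR p.2) (eTheta p.2) :=
    (((hg2.continuous_fderiv (by simp)).comp continuous_polar).clm_apply
      (continuous_eR.comp continuous_snd)).clm_apply (continuous_eTheta.comp continuous_snd)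
  have hsymm : ∀ x v w, fderiv ℝ (fderiv ℝ g) x v w = fderiv ℝ (fderiv ℝ g) x w v := fun x v w =>
    ((contDiff_infty.1 hg 2).contDiffAt.isSymmSndFDerivAt (by simp)).eq v w
  have sliceθ : ∀ {F : ℝ × ℝ → ℝ}, Continuous F → ∀ r, Continuous fun θ => F (r, θ) :=
    fun h r => h.comp (by fun_prop : Continuous fun θ : ℝ => (r, θ))
  have slicer : ∀ {F : ℝ × ℝ → ℝ}, Continuous F → ∀ θ, Continuous fun r => F (r, θ) :=
    fun h θ => h.comp (by fun_prop : Continuous fun r : ℝ => (r, θ))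
  -- the derivative of `f ∂_θ g` along the radius and of `f ∂_r g` along the circle
  set D₁ : ℝ × ℝ → ℝ := fun p => fderiv ℝ f (p.1 • eR p.2) (eR p.2) *
      (p.1 * fderiv ℝ g (p.1 • eR p.2) (eTheta p.2)) + f (p.1 • eR p.2) *
      (fderiv ℝ g (p.1 • eR p.2) (eTheta p.2) +
        p.1 * fderiv ℝ (fderiv ℝ g) (p.1 • eR p.2) (eR p.2) (eTheta p.2)) with hD₁
  set D₂ : ℝ × ℝ → ℝ := fun p => (p.1 * fderiv ℝ f (p.1 • eR p.2) (eTheta p.2)) *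
      fderiv ℝ g (p.1 • eR p.2) (eR p.2) + f (p.1 • eR p.2) *
      (p.1 * fderiv ℝ (fderiv ℝ g) (p.1 • eR p.2) (eR p.2) (eTheta p.2) +
        fderiv ℝ g (p.1 • eR p.2) (eTheta p.2)) with hD₂
  have cD₁ : Continuous D₁ := by fun_prop
  have cD₂ : Continuous D₂ := by fun_prop
  have d₁ : ∀ r θ, HasDerivAt (fun r : ℝ => f (r • eR θ) *
      (r * fderiv ℝ g (r • eR θ) (eTheta θ))) (D₁ (r, θ)) r := by
    intro r θ
    have h2 := (hasDerivAt_radial (hgd2 (r • eR θ))).clm_apply (hasDerivAt_const r (eTheta θ))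
    refine ((hasDerivAt_radial (hfd (r • eR θ))).mul ((hasDerivAt_id' r).mul h2)).congr_deriv ?_
    simp [hD₁]
  have d₂ : ∀ r θ, HasDerivAt (fun θ : ℝ => f (r • eR θ) * fderiv ℝ g (r • eR θ) (eR θ))
      (D₂ (r, θ)) θ := by
    intro r θ
    have h2 := (hasDerivAt_angular (r := r) (hgd2 (r • eR θ))).clm_apply (hasDerivAt_eR θ)
    refine ((hasDerivAt_angular (r := r) (hfd (r • eR θ))).mul h2).congr_deriv ?_
    simp [hD₂, hsymm _ (eR θ)]
  have i1 : Integrable (fun p : ℝ × ℝ => L p.1 * D₁ p) polarMeasure :=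
    integrable_polar_of_continuous (by fun_prop)
  have i2 : Integrable (fun p : ℝ × ℝ => L p.1 * D₂ p) polarMeasure :=
    integrable_polar_of_continuous (by fun_prop)
  have i3 : Integrable (fun p : ℝ × ℝ => L' p.1 * (f (p.1 • eR p.2) *
      (p.1 * fderiv ℝ g (p.1 • eR p.2) (eTheta p.2)))) polarMeasure :=
    integrable_polar_of_continuous (by fun_prop)
  have i4 : Integrable (fun p : ℝ × ℝ => L' p.1 * ((p.1 * fderiv ℝ f (p.1 • eR p.2)
      (eTheta p.2)) ^ 2 + (p.1 * fderiv ℝ g (p.1 • eR p.2) (eTheta p.2)) ^ 2)) polarMeasure :=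
    integrable_polar_of_continuous (by fun_prop)
  have i5 : Integrable (fun p : ℝ × ℝ => p.1 * (fderiv ℝ f (p.1 • eR p.2)
      (eTheta p.2) ^ 2 + fderiv ℝ g (p.1 • eR p.2) (eTheta p.2) ^ 2)) polarMeasure :=
    integrable_polar_of_continuous (by fun_prop)
  -- The outer boundary term vanishes because `L 1 = 0`, the inner one because of the factor `r`; no
  -- boundary condition on `f` or `g` enters.
  have e1 : ∫ p, L p.1 * D₁ p ∂polarMeasure = -∫ p, L' p.1 * (f (p.1 • eR p.2) *
      (p.1 * fderiv ℝ g (p.1 • eR p.2) (eTheta p.2))) ∂polarMeasure := by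
    rw [eq_neg_iff_add_eq_zero, ← integral_add i1 i3, integral_polar_symm (i1.fun_add i3)]
    rw [intervalIntegral.integral_congr (g := fun _ => 0), intervalIntegral.integral_zero]
    intro θ _
    dsimp only
    rw [intervalIntegral.integral_eq_sub_of_hasDerivAt (f := fun r => L r * (f (r • eR θ) *
      (r * fderiv ℝ g (r • eR θ) (eTheta θ))))]
    · simp [hL1]
    · intro r _
      refine ((hL r).mul (d₁ r θ)).congr_deriv ?_
      ring
    · apply Continuous.intervalIntegrable
      have := slicer cD₁ θ
      have := slicer hgt θ
      fun_prop
  have e2 : ∫ p, L p.1 * D₂ p ∂polarMeasure = 0 := by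
    rw [integral_polar i2]
    rw [intervalIntegral.integral_congr (g := fun _ => 0), intervalIntegral.integral_zero]
    intro r _
    dsimp only
    -- On each circle this is the integral of the derivative of a periodic function, and the weight
    -- is constant there.
    rw [intervalIntegral.integral_const_mul, intervalIntegral.integral_eq_sub_of_hasDerivAt
      (fun θ _ => d₂ r θ) ((sliceθ cD₂ r).intervalIntegrable _ _), eR_neg_pi, sub_self, mul_zero]
  have e3 : |2 * ∫ p, L' p.1 * (f (p.1 • eR p.2) *
      (p.1 * fderiv ℝ g (p.1 • eR p.2) (eTheta p.2))) ∂polarMeasure| ≤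
      ∫ p, L' p.1 * ((p.1 * fderiv ℝ f (p.1 • eR p.2) (eTheta p.2)) ^ 2 +
        (p.1 * fderiv ℝ g (p.1 • eR p.2) (eTheta p.2)) ^ 2) ∂polarMeasure := by
    rw [integral_polar i3, integral_polar i4, ← intervalIntegral.integral_const_mul]
    have cont : ∀ {F : ℝ × ℝ → ℝ}, Continuous F →
        IntervalIntegrable (fun r => ∫ θ in -Real.pi..Real.pi, F (r, θ)) volume 0 1 :=
      fun {F} hF => (intervalIntegral.continuous_parametric_intervalIntegral_of_continuous'
        (f := fun r θ => F (r, θ)) hF _ _).intervalIntegrable _ _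
    refine (intervalIntegral.abs_integral_le_integral_abs zero_le_one).trans
      (intervalIntegral.integral_mono_on_of_le_Ioo zero_le_one ?_ ?_ fun r hr => ?_)
    · exact ((cont (F := fun p => L' p.1 * (f (p.1 • eR p.2) *
        (p.1 * fderiv ℝ g (p.1 • eR p.2) (eTheta p.2)))) (by fun_prop)).const_mul 2).abs
    · exact cont (F := fun p => L' p.1 * ((p.1 * fderiv ℝ f (p.1 • eR p.2) (eTheta p.2)) ^ 2 +
        (p.1 * fderiv ℝ g (p.1 • eR p.2) (eTheta p.2)) ^ 2)) (by fun_prop)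
    · dsimp only
      rw [intervalIntegral.integral_const_mul, intervalIntegral.integral_const_mul,
        mul_left_comm, abs_mul, abs_of_nonneg (hL0 r hr).1]
      refine mul_le_mul_of_nonneg_left ?_ (hL0 r hr).1
      -- The Wirtinger estimate on the circle of radius `r`, where the angular derivatives are `r`
      -- times the normalized ones.
      exact abs_integral_mul_deriv_le (fun θ => hasDerivAt_angular (hfd (r • eR θ)))
        ((sliceθ hft r).const_smul r) (fun θ => hasDerivAt_angular (hgd (r • eR θ)))
        ((sliceθ hgt r).const_smul r) (by rw [eR_neg_pi]) (by rw [eR_neg_pi])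
  have hmeasL : AEStronglyMeasurable (fun x : Plane => L ‖x‖) discMeasure :=
    (hLc.comp continuous_norm).aestronglyMeasurable
  change |2 * ∫ x, ((fun x : Plane => L ‖x‖) * (radDeriv f * angDeriv g - angDeriv f * radDeriv g)) x
    ∂discMeasure| ≤ ∫ x, (angDeriv f ^ 2 + angDeriv g ^ 2) x ∂discMeasure
  rw [integral_disc (hmeasL.mul (((aestronglyMeasurable_radDeriv hf).mul
    (aestronglyMeasurable_angDeriv hg)).sub ((aestronglyMeasurable_angDeriv hf).mul
    (aestronglyMeasurable_radDeriv hg)))), integral_disc (((aestronglyMeasurable_angDeriv hf).pow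
    2).add ((aestronglyMeasurable_angDeriv hg).pow 2))]
  -- The mixed second derivatives of `g` in `D₁` and `D₂` cancel, which exhibits `r` times the
  -- Jacobian as a divergence in `(r, θ)`.
  have e4 : ∫ p, p.1 * ((fun x : Plane => L ‖x‖) * (radDeriv f * angDeriv g - angDeriv f * radDeriv g))
      (p.1 • eR p.2) ∂polarMeasure = ∫ p, (L p.1 * D₁ p - L p.1 * D₂ p) ∂polarMeasure := by
    apply integral_congr_ae
    filter_upwards [ae_polar_mem] with p hpm
    have hr : 0 < p.1 := hpm.1.1
    simp only [Pi.mul_apply, Pi.sub_apply, norm_smul_eR hr.le, radDeriv_smul_eR _ hr,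
      angDeriv_smul_eR _ hr, hD₁, hD₂]
    ring
  have e5 : ∫ p, p.1 * (angDeriv f ^ 2 + angDeriv g ^ 2) (p.1 • eR p.2) ∂polarMeasure =
      ∫ p, p.1 * (fderiv ℝ f (p.1 • eR p.2) (eTheta p.2) ^ 2 +
        fderiv ℝ g (p.1 • eR p.2) (eTheta p.2) ^ 2) ∂polarMeasure := by
    apply integral_congr_ae
    filter_upwards [ae_polar_mem] with p hpm
    have hr : 0 < p.1 := hpm.1.1
    simp only [Pi.add_apply, Pi.pow_apply, angDeriv_smul_eR _ hr]
  rw [e4, e5, integral_sub i1 i2, e1, e2, sub_zero, mul_neg, abs_neg]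
  refine e3.trans (integral_mono_ae i4 i5 ?_)
  filter_upwards [ae_polar_mem] with p hpm
  have hr : 0 < p.1 := hpm.1.1
  have h := (hL0 p.1 hpm.1).2
  have e : ∀ s t : ℝ, L' p.1 * ((p.1 * s) ^ 2 + (p.1 * t) ^ 2) =
      (p.1 * L' p.1) * (p.1 * (s ^ 2 + t ^ 2)) := fun s t => by ring
  rw [e]
  exact mul_le_of_le_one_left (by positivity) h

/-- A Poincaré inequality with boundary term. -/
theorem integral_sq_le {f : Plane → ℝ} (hf : ContDiff ℝ ∞ f) :
    ∫ x, f x ^ 2 ∂discMeasure ≤ (∫ θ in -Real.pi..Real.pi, f (eR θ) ^ 2) +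
      ∫ x, radDeriv f x ^ 2 ∂discMeasure := by
  have hfd : Differentiable ℝ f := hf.differentiable (by simp)
  have hf0 := hf.continuous
  have hfr := continuous_fderiv_polar_eR hf
  have i1 : Integrable (fun p : ℝ × ℝ => p.1 * f (p.1 • eR p.2) ^ 2) polarMeasure :=
    integrable_polar_of_continuous (by fun_prop)
  have i2 : Integrable (fun p : ℝ × ℝ => p.1 * fderiv ℝ f (p.1 • eR p.2) (eR p.2) ^ 2)
    polarMeasure := integrable_polar_of_continuous (by fun_prop)
  have i3 : Integrable (fun p : ℝ × ℝ => 2 * p.1 * f (p.1 • eR p.2) ^ 2 +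
      2 * p.1 ^ 2 * f (p.1 • eR p.2) * fderiv ℝ f (p.1 • eR p.2) (eR p.2)) polarMeasure :=
    integrable_polar_of_continuous (by fun_prop)
  have e1 : ∫ θ in -Real.pi..Real.pi, f (eR θ) ^ 2 = ∫ p, (2 * p.1 * f (p.1 • eR p.2) ^ 2 +
      2 * p.1 ^ 2 * f (p.1 • eR p.2) * fderiv ℝ f (p.1 • eR p.2) (eR p.2)) ∂polarMeasure := by
    rw [integral_polar_symm i3]
    congr 1 with θ
    dsimp only
    have hcr : Continuous fun r : ℝ => fderiv ℝ f (r • eR θ) (eR θ) :=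
      hfr.comp (by fun_prop : Continuous fun r : ℝ => (r, θ))
    -- The factor `r²` removes the contribution of the origin, so the boundary integral is the
    -- integral of the radial derivative of `r² f²`.
    rw [intervalIntegral.integral_eq_sub_of_hasDerivAt (f := fun r => r ^ 2 * f (r • eR θ) ^ 2)]
    · simp
    · intro r _
      refine ((hasDerivAt_pow 2 r).mul ((hasDerivAt_radial (hfd (r • eR θ))).pow 2)).congr_deriv ?_
      simp
      ring
    · apply Continuous.intervalIntegrable
      fun_prop
  change _ ≤ _ + ∫ x, (radDeriv f ^ 2) x ∂discMeasure
  rw [integral_disc (by fun_prop : Continuous fun x => f x ^ 2).aestronglyMeasurable,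
    integral_disc ((aestronglyMeasurable_radDeriv hf).pow 2)]
  have e2 : ∫ p, p.1 * (radDeriv f ^ 2) (p.1 • eR p.2) ∂polarMeasure =
      ∫ p, p.1 * fderiv ℝ f (p.1 • eR p.2) (eR p.2) ^ 2 ∂polarMeasure := by
    apply integral_congr_ae
    filter_upwards [ae_polar_mem] with p hpm
    simp only [Pi.pow_apply, radDeriv_smul_eR _ hpm.1.1]
  rw [e1, e2, ← integral_add i3 i2]
  refine integral_mono_ae i1 (i3.add i2) ?_
  filter_upwards [ae_polar_mem] with p hpm
  have hr : 0 < p.1 := hpm.1.1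
  have hr1 : p.1 < 1 := hpm.1.2
  generalize f (p.1 • eR p.2) = s
  generalize fderiv ℝ f (p.1 • eR p.2) (eR p.2) = t
  have h : p.1 * p.1 ^ 2 * t ^ 2 ≤ p.1 * t ^ 2 := by
    have : p.1 ^ 2 ≤ 1 := pow_le_one₀ hr.le hr1.le
    nlinarith [mul_nonneg hr.le (sq_nonneg t)]
  -- The difference of the two sides is `r (s + r t)² + (r - r³) t²`.
  nlinarith [mul_nonneg hr.le (sq_nonneg (s + p.1 * t))]

/-! Weak gradients of maps -/

theorem MapMemW12.hasWeakGrad {u : Plane → Plane} (hu : MapMemW12 u) :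
    HasWeakGrad u (weakGrad u) := by
  have h : ∃ G, HasWeakGrad u G := by
    choose g hg _ using fun i => (hu i).2
    exact ⟨fun x => Matrix.of fun i j => g i j x, fun i j => hg i j⟩
  rw [weakGrad, dif_pos h]
  exact h.choose_spec

theorem HasWeakGrad.weakGrad_ae_eq {u : Plane → Plane} {G : Plane → Mat} (h : HasWeakGrad u G) :
    weakGrad u =ᵐ[discMeasure] G := by
  have h' : HasWeakGrad u (weakGrad u) := by
    have h0 : ∃ G, HasWeakGrad u G := ⟨G, h⟩
    rw [weakGrad, dif_pos h0]
    exact h0.choose_spec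
  filter_upwards [(h' 0 0).ae_eq (h 0 0), (h' 0 1).ae_eq (h 0 1), (h' 1 0).ae_eq (h 1 0),
    (h' 1 1).ae_eq (h 1 1)] with x h1 h2 h3 h4
  ext i j
  fin_cases i <;> fin_cases j
  exacts [h1, h2, h3, h4]

theorem MapMemW12.memLp_weakGrad {u : Plane → Plane} (hu : MapMemW12 u) (i j : Fin 2) :
    MemLp (fun x => weakGrad u x i j) 2 discMeasure := by
  obtain ⟨g, hg, hg2⟩ := (hu i).2 j
  exact hg2.ae_eq (hg.ae_eq (hu.hasWeakGrad i j))

theorem HasWeakGrad.add_smul {u η : Plane → Plane} {G H : Plane → Mat} (hu : HasWeakGrad u G)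
    (hη : HasWeakGrad η H) (t : ℝ) :
    HasWeakGrad (fun x => u x + t • η x) (fun x => G x + t • H x) := fun i j =>
  (hu i j).add_const_mul (hη i j) t

theorem jac_eq_partialDeriv {φ : Plane → Plane} (hφ : ContDiff ℝ ∞ φ) (x : Plane) (i j : Fin 2) :
    jac φ x i j = partialDeriv j (fun y => φ y i) x := by
  have h := (EuclideanSpace.proj (𝕜 := ℝ) i).hasFDerivAt.comp x
    (hφ.differentiable (by simp) x).hasFDerivAt
  rw [partialDeriv]
  change _ = fderiv ℝ ((EuclideanSpace.proj (𝕜 := ℝ) i) ∘ φ) x _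
  rw [h.fderiv]
  rfl

theorem contDiff_component {φ : Plane → Plane} (hφ : ContDiff ℝ ∞ φ) (i : Fin 2) :
    ContDiff ℝ ∞ fun y => φ y i :=
  contDiff_euclidean.1 hφ i

theorem radPart_jac {φ : Plane → Plane} (hφ : ContDiff ℝ ∞ φ) (x : Plane) (i : Fin 2) :
    radPart (jac φ x) (angle x) i = radDeriv (fun y => φ y i) x := by
  rw [radPart, jac_eq_partialDeriv hφ, jac_eq_partialDeriv hφ, radDeriv, fderiv_eR]

theorem tanPart_jac {φ : Plane → Plane} (hφ : ContDiff ℝ ∞ φ) (x : Plane) (i : Fin 2) :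
    tanPart (jac φ x) (angle x) i = angDeriv (fun y => φ y i) x := by
  rw [tanPart, jac_eq_partialDeriv hφ, jac_eq_partialDeriv hφ, angDeriv, fderiv_eTheta]

theorem tendsto_eLpNorm_component {α : Type*} [MeasurableSpace α] {μ : Measure α} {p : ℝ≥0∞}
    {f : ℕ → α → Plane} (h : Tendsto (fun n => eLpNorm (f n) p μ) atTop (𝓝 0)) (i : Fin 2) :
    Tendsto (fun n => eLpNorm (fun x => f n x i) p μ) atTop (𝓝 0) :=
  tendsto_of_tendsto_of_tendsto_of_le_of_le tendsto_const_nhds h (fun _ => zero_le)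
    fun n => eLpNorm_mono fun x => PiLp.norm_apply_le (f n x) i

theorem tendsto_eLpNorm_add {α : Type*} [MeasurableSpace α] {μ : Measure α} {p : ℝ≥0∞}
    (hp : 1 ≤ p) {f g : ℕ → α → ℝ} (hfm : ∀ n, AEStronglyMeasurable (f n) μ)
    (hgm : ∀ n, AEStronglyMeasurable (g n) μ)
    (hf : Tendsto (fun n => eLpNorm (f n) p μ) atTop (𝓝 0))
    (hg : Tendsto (fun n => eLpNorm (g n) p μ) atTop (𝓝 0)) :
    Tendsto (fun n => eLpNorm (fun x => f n x + g n x) p μ) atTop (𝓝 0) := by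
  have h := hf.add hg
  rw [add_zero] at h
  exact tendsto_of_tendsto_of_tendsto_of_le_of_le tendsto_const_nhds h (fun _ => zero_le)
    fun n => eLpNorm_add_le (hfm n) (hgm n) hp

theorem tendsto_eLpNorm_sub {α : Type*} [MeasurableSpace α] {μ : Measure α} {p : ℝ≥0∞}
    (hp : 1 ≤ p) {f g : ℕ → α → ℝ} (hfm : ∀ n, AEStronglyMeasurable (f n) μ)
    (hgm : ∀ n, AEStronglyMeasurable (g n) μ)
    (hf : Tendsto (fun n => eLpNorm (f n) p μ) atTop (𝓝 0))
    (hg : Tendsto (fun n => eLpNorm (g n) p μ) atTop (𝓝 0)) :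
    Tendsto (fun n => eLpNorm (fun x => f n x - g n x) p μ) atTop (𝓝 0) := by
  have h := hf.add hg
  rw [add_zero] at h
  exact tendsto_of_tendsto_of_tendsto_of_le_of_le tendsto_const_nhds h (fun _ => zero_le)
    fun n => eLpNorm_sub_le (hfm n) (hgm n) hp

theorem tendsto_eLpNorm_plane {α : Type*} [MeasurableSpace α] {μ : Measure α} {p : ℝ≥0∞}
    (hp : 1 ≤ p) {f : ℕ → α → Plane}
    (hm : ∀ n i, AEStronglyMeasurable (fun x => f n x i) μ)
    (h : ∀ i, Tendsto (fun n => eLpNorm (fun x => f n x i) p μ) atTop (𝓝 0)) :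
    Tendsto (fun n => eLpNorm (f n) p μ) atTop (𝓝 0) := by
  have hn : ∀ i, Tendsto (fun n => eLpNorm (fun x => ‖f n x i‖) p μ) atTop (𝓝 0) := fun i => by
    simpa only [eLpNorm_norm] using h i
  have key := tendsto_eLpNorm_add hp (fun n => (hm n 0).norm) (fun n => (hm n 1).norm) (hn 0) (hn 1)
  refine tendsto_of_tendsto_of_tendsto_of_le_of_le tendsto_const_nhds key (fun _ => zero_le)
    fun n => eLpNorm_mono_real fun x => ?_
  rw [EuclideanSpace.norm_eq, Fin.sum_univ_two]
  refine Real.sqrt_le_iff.2 ⟨by positivity, ?_⟩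
  nlinarith [mul_nonneg (norm_nonneg (f n x 0)) (norm_nonneg (f n x 1))]

/-! The covering map -/

/-- The components of the covering map, up to an additive constant. -/
def coveringPart (N : ℕ) (i : Fin 2) (x : Plane) : ℝ := ‖x‖ / √(N : ℝ) * eR (N * angle x) i

theorem coveringMap_apply (N : ℕ) (b x : Plane) (i : Fin 2) :
    coveringMap N b x i = coveringPart N i x + b i := by
  simp [coveringMap, coveringPart]

theorem coveringPart_smul_eR (N : ℕ) (i : Fin 2) {r : ℝ} (hr : 0 < r) (θ : ℝ) :
    coveringPart N i (r • eR θ) = r / √(N : ℝ) * eR (N * θ) i := by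
  rw [coveringPart, norm_smul_eR hr.le, eR_nat_mul_congr N (eR_angle_smul hr θ)]

theorem contDiffOn_cos_angle : ContDiffOn ℝ ∞ (fun x => cos (angle x)) {0}ᶜ := by
  have h : ContDiffOn ℝ ∞ (fun x : Plane => x 0 / ‖x‖) {0}ᶜ := fun x hx =>
    ((by fun_prop : ContDiffAt ℝ ∞ (fun x : Plane => x 0) x).div (contDiffAt_norm ℝ hx)
      (norm_ne_zero_iff.2 hx)).contDiffWithinAt
  exact h.congr fun x hx => cos_angle hx

theorem contDiffOn_sin_angle : ContDiffOn ℝ ∞ (fun x => sin (angle x)) {0}ᶜ := by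
  have h : ContDiffOn ℝ ∞ (fun x : Plane => x 1 / ‖x‖) {0}ᶜ := fun x hx =>
    ((by fun_prop : ContDiffAt ℝ ∞ (fun x : Plane => x 1) x).div (contDiffAt_norm ℝ hx)
      (norm_ne_zero_iff.2 hx)).contDiffWithinAt
  exact h.congr fun x hx => sin_angle hx

/-- The angle itself jumps across the slit, so smoothness is built up from `cos (angle x)` and `sin
(angle x)` by the addition formulas. -/
theorem contDiffOn_cos_sin_mul_angle (N : ℕ) :
    ContDiffOn ℝ ∞ (fun x => cos (N * angle x)) {0}ᶜ ∧
      ContDiffOn ℝ ∞ (fun x => sin (N * angle x)) {0}ᶜ := by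
  induction N with
  | zero => simp [contDiffOn_const]
  | succ n ih =>
    simp only [Nat.cast_succ, add_mul, one_mul, Real.cos_add, Real.sin_add]
    exact ⟨(ih.1.mul contDiffOn_cos_angle).sub (ih.2.mul contDiffOn_sin_angle),
      (ih.2.mul contDiffOn_cos_angle).add (ih.1.mul contDiffOn_sin_angle)⟩

theorem contDiffOn_coveringPart (N : ℕ) (i : Fin 2) :
    ContDiffOn ℝ ∞ (coveringPart N i) {0}ᶜ := by
  have hn : ContDiffOn ℝ ∞ (fun x : Plane => ‖x‖ / √(N : ℝ)) {0}ᶜ := fun x hx =>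
    ((contDiffAt_norm ℝ hx).div_const _).contDiffWithinAt
  fin_cases i
  · exact hn.mul (contDiffOn_cos_sin_mul_angle N).1
  · exact hn.mul (contDiffOn_cos_sin_mul_angle N).2

theorem hasDerivAt_eR_mul (N : ℕ) (i : Fin 2) (θ : ℝ) :
    HasDerivAt (fun θ : ℝ => eR (N * θ) i) (N * eTheta (N * θ) i) θ := by
  have h1 : HasDerivAt (fun θ : ℝ => (N : ℝ) * θ) N θ := by
    simpa using (hasDerivAt_id θ).const_mul (N : ℝ)
  have h := (EuclideanSpace.proj (𝕜 := ℝ) i).hasFDerivAt.comp_hasDerivAt θ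
    ((hasDerivAt_eR (N * θ)).scomp θ h1)
  exact h.congr_deriv (by simp)

theorem hasDerivAt_eTheta_mul (N : ℕ) (i : Fin 2) (θ : ℝ) :
    HasDerivAt (fun θ : ℝ => eTheta (N * θ) i) (-(N * eR (N * θ) i)) θ := by
  have h1 : HasDerivAt (fun θ : ℝ => (N : ℝ) * θ) N θ := by
    simpa using (hasDerivAt_id θ).const_mul (N : ℝ)
  have h := (EuclideanSpace.proj (𝕜 := ℝ) i).hasFDerivAt.comp_hasDerivAt θ
    ((hasDerivAt_eTheta (N * θ)).scomp θ h1)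
  exact h.congr_deriv (by simp)

theorem fderiv_coveringPart_eR (N : ℕ) (i : Fin 2) {r : ℝ} (hr : 0 < r) (θ : ℝ) :
    fderiv ℝ (coveringPart N i) (r • eR θ) (eR θ) = eR (N * θ) i / √(N : ℝ) := by
  have h := hasDerivAt_radial (differentiableAt_of_contDiffOn (contDiffOn_coveringPart N i)
    (smul_eR_ne_zero hr θ))
  have h' := ((hasDerivAt_id' r).div_const √(N : ℝ)).mul_const (eR (N * θ) i)
  rw [h.unique (h'.congr_of_eventuallyEq ?_)]
  · ring
  · filter_upwards [lt_mem_nhds hr] with s hs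
    exact coveringPart_smul_eR N i hs θ

theorem fderiv_coveringPart_eTheta (N : ℕ) (i : Fin 2) {r : ℝ} (hr : 0 < r) (θ : ℝ) :
    fderiv ℝ (coveringPart N i) (r • eR θ) (eTheta θ) = √(N : ℝ) * eTheta (N * θ) i := by
  have h := hasDerivAt_angular (differentiableAt_of_contDiffOn (contDiffOn_coveringPart N i)
    (smul_eR_ne_zero hr θ))
  simp only [coveringPart_smul_eR N i hr] at h
  have e := h.unique ((hasDerivAt_eR_mul N i θ).const_mul (r / √(N : ℝ)))
  rw [smul_eq_mul] at e
  have hs : r / √(N : ℝ) * (N * eTheta (N * θ) i) = r * (√(N : ℝ) * eTheta (N * θ) i) := by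
    rw [show r / √(N : ℝ) * (N * eTheta (N * θ) i) = r * (N / √(N : ℝ) * eTheta (N * θ) i) by ring,
      Real.div_sqrt]
  rw [hs] at e
  exact mul_left_cancel₀ hr.ne' e

/-- The classical gradient of the covering map. -/
def coveringGrad (N : ℕ) (x : Plane) : Mat :=
  Matrix.of fun i j => partialDeriv j (coveringPart N i) x

/-- With `tanPart_coveringGrad`, this says that the gradient maps the frame at `θ` to the frame at
`Nθ` with stretches `1/√N` and `√N`. The unit determinant and the constant energy density `ν(a/N +
N)` follow. -/
theorem radPart_coveringGrad (N : ℕ) {x : Plane} (hx : x ≠ 0) (i : Fin 2) :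
    radPart (coveringGrad N x) (angle x) i = eR (N * angle x) i / √(N : ℝ) := by
  have h := fderiv_coveringPart_eR N i (norm_pos_iff.2 hx) (angle x)
  rw [norm_smul_eR_angle, fderiv_eR] at h
  exact h

theorem tanPart_coveringGrad (N : ℕ) {x : Plane} (hx : x ≠ 0) (i : Fin 2) :
    tanPart (coveringGrad N x) (angle x) i = √(N : ℝ) * eTheta (N * angle x) i := by
  have h := fderiv_coveringPart_eTheta N i (norm_pos_iff.2 hx) (angle x)
  rw [norm_smul_eR_angle, fderiv_eTheta] at h
  exact h

theorem abs_eR_le (θ : ℝ) (i : Fin 2) : |eR θ i| ≤ 1 := by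
  rw [← norm_eR θ]
  exact PiLp.norm_apply_le (eR θ) i

theorem abs_eTheta_le (θ : ℝ) (i : Fin 2) : |eTheta θ i| ≤ 1 := by
  fin_cases i
  · simpa using Real.abs_sin_le_one θ
  · simpa using Real.abs_cos_le_one θ

theorem abs_partialDeriv_coveringPart_le (N : ℕ) (i j : Fin 2) {x : Plane} (hx : x ≠ 0) :
    |partialDeriv j (coveringPart N i) x| ≤ 1 / √(N : ℝ) + √(N : ℝ) := by
  have hpos := norm_pos_iff.2 hx
  have h := abs_partialDeriv_le (coveringPart N i) x (angle x) j
  have h1 := fderiv_coveringPart_eR N i hpos (angle x)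
  have h2 := fderiv_coveringPart_eTheta N i hpos (angle x)
  rw [norm_smul_eR_angle] at h1 h2
  rw [h1, h2, abs_div, abs_mul, abs_of_nonneg (Real.sqrt_nonneg _)] at h
  refine h.trans (add_le_add ?_ ?_)
  · gcongr
    exact abs_eR_le _ _
  · exact mul_le_of_le_one_right (Real.sqrt_nonneg _) (abs_eTheta_le _ _)

theorem memLp_coveringGrad (N : ℕ) (i j : Fin 2) (q : ℝ≥0∞) :
    MemLp (fun x => coveringGrad N x i j) q discMeasure := by
  refine MemLp.of_bound (aestronglyMeasurable_of_contDiffOn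
    (continuousOn_partialDeriv (contDiffOn_coveringPart N i) j)) (1 / √(N : ℝ) + √(N : ℝ)) ?_
  filter_upwards [ae_disc_mem] with x hx using abs_partialDeriv_coveringPart_le N i j hx.2

theorem memLp_coveringPart_div (N : ℕ) (i : Fin 2) (q : ℝ≥0∞) :
    MemLp (fun x => coveringPart N i x / ‖x‖) q discMeasure := by
  refine MemLp.of_bound ((aestronglyMeasurable_of_contDiffOn
    (contDiffOn_coveringPart N i).continuousOn).div₀ (by fun_prop)) (1 / √(N : ℝ)) ?_
  filter_upwards [ae_disc_mem] with x hx
  obtain ⟨h0, -⟩ := norm_mem_of_disc hx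
  have e : coveringPart N i x / ‖x‖ = 1 / √(N : ℝ) * eR (N * angle x) i := by
    rw [coveringPart]
    field_simp
  rw [e, norm_mul, Real.norm_of_nonneg (by positivity)]
  exact mul_le_of_le_one_right (by positivity) (abs_eR_le _ _)

theorem memLp_coveringPart (N : ℕ) (i : Fin 2) (q : ℝ≥0∞) :
    MemLp (coveringPart N i) q discMeasure :=
  memLp_of_div_norm (contDiffOn_coveringPart N i).continuousOn (memLp_coveringPart_div N i q)

theorem hasWeakGrad_coveringMap (N : ℕ) (b : Plane) :
    HasWeakGrad (coveringMap N b) (coveringGrad N) := by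
  intro i j
  have h1 := hasWeakPartial_of_contDiffOn (contDiffOn_coveringPart N i)
    (memLp_coveringPart_div N i 1) (memLp_coveringGrad N i j 1)
  have h2 := hasWeakPartial_of_contDiff (contDiff_const (c := b i) (𝕜 := ℝ) (E := Plane) (n := ∞)) j
  have h := h1.add_const_mul h2 1
  have e : (fun x => coveringMap N b x i) = fun x => coveringPart N i x + 1 * b i :=
    funext fun x => by rw [coveringMap_apply, one_mul]
  have e' : (fun x => coveringGrad N x i j) = fun x => partialDeriv j (coveringPart N i) x +
      1 * partialDeriv j (fun _ : Plane => b i) x := by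
    funext x
    simp [partialDeriv, coveringGrad]
  rw [e, e']
  exact h

theorem mapMemW12_coveringMap (N : ℕ) (b : Plane) : MapMemW12 (coveringMap N b) := by
  intro i
  refine ⟨?_, fun j => ⟨_, hasWeakGrad_coveringMap N b i j, memLp_coveringGrad N i j 2⟩⟩
  simp only [coveringMap_apply]
  exact (memLp_coveringPart N i 2).add (memLp_const _)

theorem weakGrad_coveringMap (N : ℕ) (b : Plane) :
    weakGrad (coveringMap N b) =ᵐ[discMeasure] coveringGrad N :=
  (hasWeakGrad_coveringMap N b).weakGrad_ae_eq

/-- Smooth approximations of the covering map. -/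
def coveringApprox (N : ℕ) (b : Plane) (n : ℕ) (x : Plane) : Plane :=
  WithLp.toLp 2 fun i => cutoff n x * coveringPart N i x + b i

theorem contDiff_coveringApprox (N : ℕ) (b : Plane) (n : ℕ) :
    ContDiff ℝ ∞ (coveringApprox N b n) :=
  contDiff_euclidean.2 fun i =>
    (contDiff_cutoff_mul (contDiffOn_coveringPart N i) n).add contDiff_const

theorem tendstoW12_coveringApprox (N : ℕ) (b : Plane) :
    TendstoW12 (coveringApprox N b) (coveringMap N b) := by
  have hmeas : ∀ i, AEStronglyMeasurable (fun x => coveringMap N b x i) discMeasure := fun i =>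
    (mapMemW12_coveringMap N b i).1.1
  constructor
  · refine tendsto_eLpNorm_plane one_le_two (fun n i => ?_) fun i => ?_
    · exact (contDiff_component (contDiff_coveringApprox N b n)
        i).continuous.aestronglyMeasurable.sub (hmeas i)
    · refine (tendsto_cutoff_mul two_ne_zero ENNReal.ofNat_ne_top (contDiffOn_coveringPart N i)
        (memLp_coveringPart_div N i 2)).congr fun n => ?_
      congr 1 with x
      rw [PiLp.sub_apply, coveringMap_apply]
      simp [coveringApprox]
  · intro i j
    refine (tendsto_partialDeriv_cutoff_mul two_ne_zero ENNReal.ofNat_ne_top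
      (contDiffOn_coveringPart N i) (memLp_coveringPart_div N i 2)
      (memLp_coveringGrad N i j 2)).congr fun n => eLpNorm_congr_ae ?_
    filter_upwards [weakGrad_coveringMap N b] with x hx
    rw [hx, jac_eq_partialDeriv (contDiff_coveringApprox N b n)]
    simp [coveringGrad, coveringApprox, partialDeriv]

/-- For `n ≥ 1` the cutoff argument on the unit circle is at least `3`, so the cutoff is `1` and the
boundary values are exact. At `n = 0` the argument is `0` and the cutoff vanishes there. -/
theorem coveringApprox_eR (N : ℕ) (b : Plane) {n : ℕ} (hn : 1 ≤ n) (θ : ℝ) :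
    coveringApprox N b n (eR θ) = boundaryData N b θ := by
  have h1 : cutoff n (eR θ) = 1 := by
    rw [cutoff, norm_eR]
    apply Real.smoothTransition.one_of_one_le
    have : (1 : ℝ) ≤ n := by exact_mod_cast hn
    nlinarith
  have h2 : ∀ i, coveringPart N i (eR θ) = 1 / √(N : ℝ) * eR (N * θ) i := fun i => by
    simpa using coveringPart_smul_eR N i one_pos θ
  ext i
  simp [coveringApprox, boundaryData, h1, h2]

theorem hasTrace_coveringMap (N : ℕ) (b : Plane) :
    HasTrace (coveringMap N b) (boundaryData N b) := by
  refine ⟨coveringApprox N b, contDiff_coveringApprox N b, tendstoW12_coveringApprox N b, ?_⟩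
  refine tendsto_const_nhds.congr' ?_
  filter_upwards [eventually_ge_atTop 1] with n hn
  simp [coveringApprox_eR N b hn]

/-- Taking the cofactor exchanges the stretches `1/√N` and `√N`; the factor `√N` clears the
denominators. -/
theorem frob_cof_coveringGrad {N : ℕ} (hN : N ≠ 0) {x : Plane} (hx : x ≠ 0) (H : Mat) :
    √(N : ℝ) * frob (cof (coveringGrad N x)) H =
      ∑ i, (N * (eR (N * angle x) i * radPart H (angle x) i) +
        eTheta (N * angle x) i * tanPart H (angle x) i) := by
  have hpos : (0 : ℝ) < √(N : ℝ) := Real.sqrt_pos.2 (by positivity)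
  have hs : √(N : ℝ) * √(N : ℝ) = N := Real.mul_self_sqrt (by positivity)
  rw [frob_cof _ _ (angle x)]
  simp only [radPart_coveringGrad N hx, tanPart_coveringGrad N hx, Fin.sum_univ_two, eR_zero,
    eR_one, eTheta_zero, eTheta_one]
  generalize (N : ℝ) * angle x = φ
  generalize √(N : ℝ) = s at *
  rw [← hs]
  field_simp
  ring

theorem det_coveringGrad {N : ℕ} (hN : N ≠ 0) {x : Plane} (hx : x ≠ 0) :
    (coveringGrad N x).det = 1 := by
  have hpos : (0 : ℝ) < √(N : ℝ) := Real.sqrt_pos.2 (by positivity)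
  rw [det_eq_parts _ (angle x)]
  simp only [radPart_coveringGrad N hx, tanPart_coveringGrad N hx, eR_zero, eR_one, eTheta_zero,
    eTheta_one]
  field_simp
  linarith [Real.sin_sq_add_cos_sq (N * angle x)]

theorem coveringMap_mem_admissible {N : ℕ} (hN : N ≠ 0) (b : Plane) :
    coveringMap N b ∈ Admissible (boundaryData N b) := by
  refine ⟨mapMemW12_coveringMap N b, ?_, hasTrace_coveringMap N b⟩
  filter_upwards [weakGrad_coveringMap N b, ae_disc_mem] with x hx hx0
  rw [hx, det_coveringGrad hN hx0.2]

theorem energy_coveringMap (ν a : ℝ) {N : ℕ} (hN : N ≠ 0) (b : Plane) :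
    energy (integrand ν a) (coveringMap N b) = ν * Real.pi * (a / N + N) := by
  have hs : √(N : ℝ) ^ 2 = N := Real.sq_sqrt (by positivity)
  have : energy (integrand ν a) (coveringMap N b) = ∫ _, ν * (a / N + N) ∂discMeasure := by
    apply integral_congr_ae
    filter_upwards [weakGrad_coveringMap N b, ae_disc_mem] with x hx hx0
    rw [hx, integrand_eq]
    simp only [radPart_coveringGrad N hx0.2, tanPart_coveringGrad N hx0.2, Fin.sum_univ_two,
      eR_zero, eR_one, eTheta_zero, eTheta_one, div_pow, mul_pow, hs]
    have h := Real.sin_sq_add_cos_sq (N * angle x)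
    linear_combination (ν * (a / N + N)) * h
  rw [this, integral_const, discMeasure_univ, smul_eq_mul]
  ring

/-! ### Lipschitz continuity of the covering map and its failure to be differentiable at the origin
-/

theorem abs_sin_nat_mul_le (N : ℕ) (t : ℝ) : |sin (N * t)| ≤ N * |sin t| := by
  induction N with
  | zero => simp
  | succ n ih =>
    rw [Nat.cast_succ, add_mul, one_mul, Real.sin_add, add_mul, one_mul]
    refine (abs_add_le _ _).trans (add_le_add ?_ ?_)
    · rw [abs_mul]
      exact (mul_le_of_le_one_right (abs_nonneg _) (Real.abs_cos_le_one _)).trans ih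
    · rw [abs_mul]
      exact mul_le_of_le_one_left (abs_nonneg _) (Real.abs_cos_le_one _)

theorem norm_eR_sub (α β : ℝ) : ‖eR α - eR β‖ = 2 * |sin ((α - β) / 2)| := by
  have h : ‖eR α - eR β‖ ^ 2 = (2 * |sin ((α - β) / 2)|) ^ 2 := by
    rw [EuclideanSpace.norm_sq_eq, Fin.sum_univ_two, mul_pow, sq_abs, Real.sin_sq_eq_half_sub,
      mul_div_cancel₀ _ two_ne_zero, Real.cos_sub]
    simp only [PiLp.sub_apply, eR_zero, eR_one, Real.norm_eq_abs, sq_abs]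
    linear_combination Real.sin_sq_add_cos_sq α + Real.sin_sq_add_cos_sq β
  exact (pow_left_inj₀ (norm_nonneg _) (by positivity) two_ne_zero).1 h

/-- A chord has length `2|sin|` of half the angle difference, so this is `|sin (N t)| ≤ N |sin t|`.
Working with chords avoids the jump of the angle. -/
theorem norm_eR_mul_sub_le (N : ℕ) (α β : ℝ) :
    ‖eR (N * α) - eR (N * β)‖ ≤ N * ‖eR α - eR β‖ := by
  rw [norm_eR_sub, norm_eR_sub, show (N * α - N * β) / 2 = N * ((α - β) / 2) by ring]
  have := abs_sin_nat_mul_le N ((α - β) / 2)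
  linarith

/-- The covering map is Lipschitz continuous. -/
theorem lipschitzWith_coveringMap (N : ℕ) (b : Plane) :
    LipschitzWith (Real.toNNReal (1 / √(N : ℝ) * (1 + N * 2))) (coveringMap N b) := by
  refine LipschitzWith.of_dist_le_mul fun x y => ?_
  rw [Real.coe_toNNReal _ (by positivity), dist_eq_norm, dist_eq_norm]
  -- The increment splits into a change of radius, of Lipschitz constant `1`, and a change of
  -- direction, of constant `2N`.
  have e : coveringMap N b x - coveringMap N b y = (1 / √(N : ℝ)) •
      ((‖x‖ - ‖y‖) • eR (N * angle x) + ‖y‖ • (eR (N * angle x) - eR (N * angle y))) := by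
    simp only [coveringMap]
    module
  have h1 : |‖x‖ - ‖y‖| ≤ ‖x - y‖ := abs_norm_sub_norm_le x y
  have h2 : ‖y‖ * ‖eR (angle x) - eR (angle y)‖ ≤ 2 * ‖x - y‖ := by
    have e2 : ‖y‖ • (eR (angle x) - eR (angle y)) =
        (x - y) - (‖x‖ - ‖y‖) • eR (angle x) := by
      rw [smul_sub, norm_smul_eR_angle, sub_smul, norm_smul_eR_angle]
      abel
    rw [← norm_norm y, ← norm_smul, e2]
    refine (norm_sub_le _ _).trans ?_
    rw [norm_smul, norm_eR, mul_one, Real.norm_eq_abs]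
    linarith
  rw [e, norm_smul, Real.norm_of_nonneg (by positivity), mul_assoc]
  refine mul_le_mul_of_nonneg_left ((norm_add_le _ _).trans ?_) (by positivity)
  rw [norm_smul, norm_eR, mul_one, Real.norm_eq_abs, norm_smul, norm_norm]
  have h3 := mul_le_mul_of_nonneg_left (norm_eR_mul_sub_le N (angle x) (angle y)) (norm_nonneg y)
  have h4 := mul_le_mul_of_nonneg_left h2 (Nat.cast_nonneg (α := ℝ) N)
  linarith

/-- The covering map is not differentiable at the origin. -/
theorem not_contDiffOn_coveringMap {N : ℕ} (hN : 2 ≤ N) (b : Plane) :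
    ¬ ContDiffOn ℝ 1 (coveringMap N b) disc := by
  intro h
  have hd : DifferentiableAt ℝ (coveringMap N b) 0 :=
    (h.contDiffAt (isOpen_disc.mem_nhds (by simp [disc]))).differentiableAt one_ne_zero
  have hN2 : (2 : ℝ) ≤ N := by exact_mod_cast hN
  set A := fderiv ℝ (coveringMap N b) 0 with hA
  have key : ∀ θ, A (eR θ) = (1 / √(N : ℝ)) • eR (N * θ) := by
    intro θ
    have h0 : HasDerivAt (fun s : ℝ => coveringMap N b (s • eR θ)) (A (eR θ)) 0 := by
      have := hasDerivAt_radial (f := coveringMap N b) (r := 0) (θ := θ) (by rwa [zero_smul])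
      rwa [zero_smul] at this
    have h1 : HasDerivAt (fun s : ℝ => (s / √(N : ℝ)) • eR (N * θ) + b)
        ((1 / √(N : ℝ)) • eR (N * θ)) 0 :=
      (((hasDerivAt_id' 0).div_const _).smul_const _).add_const b
    -- The linear formula along the ray is available for `s ≥ 0` only, and the right derivative
    -- already determines `A (eR θ)`.
    refine (uniqueDiffOn_Ici (0 : ℝ) 0 self_mem_Ici).eq_deriv _ h0.hasDerivWithinAt
      (h1.hasDerivWithinAt.congr_of_mem (fun s hs => ?_) self_mem_Ici)
    rcases (show (0 : ℝ) ≤ s from hs).eq_or_lt with rfl | hs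
    · simp [coveringMap]
    · rw [coveringMap, norm_smul_eR hs.le, eR_nat_mul_congr N (eR_angle_smul hs θ)]
  -- Both angles `±π/N` are sent to the direction `-eR 0`, while their sum is a nonnegative multiple
  -- of `eR 0`, whose direction is preserved. A linear `A` cannot do both.
  have hsum : eR (Real.pi / N) + eR (-(Real.pi / N)) = (2 * cos (Real.pi / N)) • eR 0 := by
    ext i
    fin_cases i <;> simp
    ring
  have h2 := congrArg A hsum
  rw [map_add, map_smul, key, key, key] at h2
  have h3 := congrArg (fun v : Plane => v 0) h2
  have e1 : (N : ℝ) * (Real.pi / N) = Real.pi := by field_simp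
  have e2 : (N : ℝ) * -(Real.pi / N) = -Real.pi := by rw [mul_neg, e1]
  rw [e1, e2] at h3
  simp only [PiLp.add_apply, PiLp.smul_apply, eR_zero, Real.cos_neg, Real.cos_pi, mul_zero,
    Real.cos_zero, smul_eq_mul] at h3
  have hc : 0 ≤ cos (Real.pi / N) := by
    apply Real.cos_nonneg_of_neg_pi_div_two_le_of_le
    · have : 0 ≤ Real.pi / N := by positivity
      linarith [pi_pos]
    · gcongr
  have hp : 0 < 1 / √(N : ℝ) := by positivity
  nlinarith [mul_nonneg hc hp.le]

/-! Limits of the integral identities -/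

theorem integrable_mul_of_L2 {α : Type*} [MeasurableSpace α] {μ : Measure α} {f g : α → ℝ}
    (hf : MemLp f 2 μ) (hg : MemLp g 2 μ) : Integrable (fun x => f x * g x) μ :=
  hf.integrable_mul hg

/-- The gradients of the smooth maps `ψ n` converge to `D` in `L²`. -/
structure GradTendsto (ψ : ℕ → Plane → Plane) (D : Plane → Mat) : Prop where
  contDiff : ∀ n, ContDiff ℝ ∞ (ψ n)
  memLp : ∀ i j, MemLp (fun x => D x i j) 2 discMeasure
  tendsto : ∀ i j, Tendsto (fun n => eLpNorm (fun x => jac (ψ n) x i j - D x i j) 2 discMeasure)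
    atTop (𝓝 0)

theorem memLp_radPart {D : Plane → Mat} (hD : ∀ i j, MemLp (fun x => D x i j) 2 discMeasure)
    (i : Fin 2) : MemLp (fun x => radPart (D x) (angle x) i) 2 discMeasure :=
  (memLp_cos_angle_mul (hD i 0)).add (memLp_sin_angle_mul (hD i 1))

theorem memLp_tanPart {D : Plane → Mat} (hD : ∀ i j, MemLp (fun x => D x i j) 2 discMeasure)
    (i : Fin 2) : MemLp (fun x => tanPart (D x) (angle x) i) 2 discMeasure :=
  (memLp_sin_angle_mul (hD i 0)).neg.add (memLp_cos_angle_mul (hD i 1))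

theorem memLp_jac {φ : Plane → Plane} (hφ : ContDiff ℝ ∞ φ) (i j : Fin 2) (q : ℝ≥0∞) :
    MemLp (fun x => jac φ x i j) q discMeasure := by
  simp only [jac_eq_partialDeriv hφ]
  exact memLp_disc_of_continuous (continuous_partialDeriv (contDiff_component hφ i) j) q

theorem memLp_radDeriv {f : Plane → ℝ} (hf : ContDiff ℝ ∞ f) (q : ℝ≥0∞) :
    MemLp (radDeriv f) q discMeasure := by
  have e : radDeriv f = fun x => partialDeriv 0 f x * cos (angle x) +
      partialDeriv 1 f x * sin (angle x) := funext fun x => fderiv_eR f x _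
  rw [e]
  exact (memLp_cos_angle_mul (memLp_disc_of_continuous (continuous_partialDeriv hf 0) q)).add
    (memLp_sin_angle_mul (memLp_disc_of_continuous (continuous_partialDeriv hf 1) q))

theorem memLp_angDeriv {f : Plane → ℝ} (hf : ContDiff ℝ ∞ f) (q : ℝ≥0∞) :
    MemLp (angDeriv f) q discMeasure := by
  have e : angDeriv f = fun x => -(partialDeriv 0 f x * sin (angle x)) +
      partialDeriv 1 f x * cos (angle x) := funext fun x => fderiv_eTheta f x _
  rw [e]
  exact (memLp_sin_angle_mul (memLp_disc_of_continuous (continuous_partialDeriv hf 0) q)).neg.add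
    (memLp_cos_angle_mul (memLp_disc_of_continuous (continuous_partialDeriv hf 1) q))

theorem GradTendsto.aestronglyMeasurable {ψ : ℕ → Plane → Plane} {D : Plane → Mat}
    (h : GradTendsto ψ D) (n : ℕ) (i j : Fin 2) {w : Plane → ℝ} (hw : Measurable w) :
    AEStronglyMeasurable (fun x => w x * jac (ψ n) x i j - w x * D x i j) discMeasure :=
  (hw.aestronglyMeasurable.mul (memLp_jac (h.contDiff n) i j 2).1).sub
    (hw.aestronglyMeasurable.mul (h.memLp i j).1)

theorem GradTendsto.radPart {ψ : ℕ → Plane → Plane} {D : Plane → Mat} (h : GradTendsto ψ D)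
    (i : Fin 2) : Tendsto (fun n => eLpNorm (fun x => radDeriv (fun y => ψ n y i) x -
      radPart (D x) (angle x) i) 2 discMeasure) atTop (𝓝 0) := by
  have h0 := tendsto_eLpNorm_mul_bdd (w := fun x => cos (angle x)) (C := 1)
    (ae_of_all _ fun x => Real.abs_cos_le_one _) (h.tendsto i 0)
  have h1 := tendsto_eLpNorm_mul_bdd (w := fun x => sin (angle x)) (C := 1)
    (ae_of_all _ fun x => Real.abs_sin_le_one _) (h.tendsto i 1)
  refine (tendsto_eLpNorm_add one_le_two
    (fun n => h.aestronglyMeasurable n i 0 measurable_cos_angle)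
    (fun n => h.aestronglyMeasurable n i 1 measurable_sin_angle) h0 h1).congr fun n => ?_
  congr 1 with x
  rw [← radPart_jac (h.contDiff n), IncompressibleDisc.radPart, IncompressibleDisc.radPart]
  ring

theorem GradTendsto.tanPart {ψ : ℕ → Plane → Plane} {D : Plane → Mat} (h : GradTendsto ψ D)
    (i : Fin 2) : Tendsto (fun n => eLpNorm (fun x => angDeriv (fun y => ψ n y i) x -
      tanPart (D x) (angle x) i) 2 discMeasure) atTop (𝓝 0) := by
  have h0 := tendsto_eLpNorm_mul_bdd (w := fun x => -sin (angle x)) (C := 1)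
    (ae_of_all _ fun x => by rw [abs_neg]; exact Real.abs_sin_le_one _) (h.tendsto i 0)
  have h1 := tendsto_eLpNorm_mul_bdd (w := fun x => cos (angle x)) (C := 1)
    (ae_of_all _ fun x => Real.abs_cos_le_one _) (h.tendsto i 1)
  refine (tendsto_eLpNorm_add one_le_two
    (fun n => h.aestronglyMeasurable n i 0 (w := fun x => -sin (angle x)) measurable_sin_angle.neg)
    (fun n => h.aestronglyMeasurable n i 1 measurable_cos_angle) h0 h1).congr fun n => ?_
  congr 1 with x
  rw [← tanPart_jac (h.contDiff n), IncompressibleDisc.tanPart, IncompressibleDisc.tanPart]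
  ring

theorem measurable_eR_mul (N : ℕ) (i : Fin 2) : Measurable fun x => eR (N * angle x) i := by
  have h : Continuous fun θ : ℝ => eR (N * θ) i := by fun_prop
  exact h.measurable.comp measurable_angle

theorem measurable_eTheta_mul (N : ℕ) (i : Fin 2) :
    Measurable fun x => eTheta (N * angle x) i := by
  have h : Continuous fun θ : ℝ => eTheta (N * θ) i := by fun_prop
  exact h.measurable.comp measurable_angle

theorem memLp_const_add_log_mul (A B : ℝ) {w : Plane → ℝ} (hm : Measurable w)
    (hw : ∀ x, |w x| ≤ 1) :
    MemLp (fun x => (A + B * Real.log ‖x‖) * w x) 2 discMeasure := by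
  have h : MemLp (fun x : Plane => A + B * Real.log ‖x‖) 2 discMeasure :=
    (memLp_const A).add ((memLp_log_norm two_ne_zero ENNReal.ofNat_ne_top).const_mul B)
  refine h.mono (h.1.mul hm.aestronglyMeasurable) (ae_of_all _ fun x => ?_)
  rw [norm_mul]
  exact mul_le_of_le_one_right (norm_nonneg _) (hw x)

theorem eTheta_nat_mul_congr (N : ℕ) {θ θ' : ℝ} (h : eR θ = eR θ') :
    eTheta (N * θ) = eTheta (N * θ') := by
  obtain ⟨h1, h2⟩ := eR_congr_iff.1 (eR_nat_mul_congr N h)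
  rw [eTheta, eTheta, h1, h2]

/-- The logarithmic weights lie in `L²` of the disc, so the identity for smooth functions survives
`L²` convergence of gradients, and its boundary term tends to zero by `hb`. -/
theorem integral_weighted_parts_eq_zero (a : ℝ) {N : ℕ} (hN : N ≠ 0) {ψ : ℕ → Plane → Plane}
    {D : Plane → Mat} (h : GradTendsto ψ D) (i : Fin 2)
    (hb : Tendsto (fun n => ∫ θ in -Real.pi..Real.pi, eR (N * θ) i * ψ n (eR θ) i) atTop (𝓝 0)) :
    ∫ x, ((a + ((N : ℝ) ^ 2 - a) * Real.log ‖x‖) * eR (N * angle x) i *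
        radPart (D x) (angle x) i +
      (N + ((N : ℝ) ^ 2 - a) / N * Real.log ‖x‖) * eTheta (N * angle x) i *
        tanPart (D x) (angle x) i) ∂discMeasure = 0 := by
  have hN' : (N : ℝ) ≠ 0 := by exact_mod_cast hN
  have w1 := memLp_const_add_log_mul a ((N : ℝ) ^ 2 - a) (measurable_eR_mul N i)
    fun x => abs_eR_le _ i
  have w2 := memLp_const_add_log_mul N (((N : ℝ) ^ 2 - a) / N) (measurable_eTheta_mul N i)
    fun x => abs_eTheta_le _ i
  have hs := fun n => contDiff_component (h.contDiff n) i
  have l1 := tendsto_integral_mul_of_L2 (fun _ => w1) (fun n => memLp_radDeriv (hs n) 2) w1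
    (memLp_radPart h.memLp i) (by simp) (h.radPart i)
  have l2 := tendsto_integral_mul_of_L2 (fun _ => w2) (fun n => memLp_angDeriv (hs n) 2) w2
    (memLp_tanPart h.memLp i) (by simp) (h.tanPart i)
  rw [integral_add (integrable_mul_of_L2 w1 (memLp_radPart h.memLp i))
    (integrable_mul_of_L2 w2 (memLp_tanPart h.memLp i))]
  have key := fun n => integral_radDeriv_add_angDeriv (a := a) hN'
    (c := fun θ => eR (N * θ) i) (c' := fun θ => eTheta (N * θ) i)
    (by fun_prop) (hasDerivAt_eTheta_mul N i)
    (fun θ θ' e => ⟨by rw [eR_nat_mul_congr N e], by rw [eTheta_nat_mul_congr N e]⟩)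
    (measurable_eR_mul N i) (measurable_eTheta_mul N i) (hs n)
  have l3 := l1.add l2
  refine tendsto_nhds_unique l3 ?_
  have hb' := hb.const_mul a
  rw [mul_zero] at hb'
  refine hb'.congr fun n => ?_
  rw [← key n, ← integral_add (integrable_mul_of_L2 w1 (memLp_radDeriv (hs n) 2))
    (integrable_mul_of_L2 w2 (memLp_angDeriv (hs n) 2))]
  congr 1 with x
  ring

/-- The bilinear form `T ξ · ζ` of the coefficients `T`. -/
def bilin (a : ℝ) (x : Plane) (ξ ζ : Mat) : ℝ :=
  ∑ i, (a * radPart ξ (angle x) i * radPart ζ (angle x) i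
    + tanPart ξ (angle x) i * tanPart ζ (angle x) i)

/-- The gradient of the covering map is bounded. Through the constraint this later places `det D` in
`L²` rather than merely in `L¹`. -/
theorem memLp_frob_cof (N : ℕ) (b : Plane) {D : Plane → Mat}
    (hD : ∀ i j, MemLp (fun x => D x i j) 2 discMeasure) :
    MemLp (fun x => frob (cof (weakGrad (coveringMap N b) x)) (D x)) 2 discMeasure := by
  have hbd : ∀ i j k l, MemLp (fun x => coveringGrad N x i j * D x k l) 2 discMeasure := by
    intro i j k l
    refine ((hD k l).norm.const_mul (1 / √(N : ℝ) + √(N : ℝ))).mono'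
      ((memLp_coveringGrad N i j 2).1.mul (hD k l).1) ?_
    filter_upwards [ae_disc_mem] with x hx
    rw [norm_mul]
    exact mul_le_mul_of_nonneg_right (abs_partialDeriv_coveringPart_le N i j hx.2)
      (norm_nonneg _)
  have h := (((hbd 1 1 0 0).sub (hbd 1 0 0 1)).sub (hbd 0 1 1 0)).add (hbd 0 0 1 1)
  refine h.ae_eq ?_
  filter_upwards [weakGrad_coveringMap N b] with x hx
  rw [hx]
  simp only [frob, cof, Matrix.adjugate_fin_two, Fin.sum_univ_two, Matrix.transpose_apply,
    Pi.add_apply, Pi.sub_apply]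
  simp
  ring

theorem integrable_bilin (a : ℝ) {D E : Plane → Mat}
    (hD : ∀ i j, MemLp (fun x => D x i j) 2 discMeasure)
    (hE : ∀ i j, MemLp (fun x => E x i j) 2 discMeasure) :
    Integrable (fun x => bilin a x (D x) (E x)) discMeasure := by
  refine integrable_finsetSum _ fun i _ => ?_
  exact ((memLp_radPart hD i).const_mul a |>.integrable_mul (memLp_radPart hE i)).add
    ((memLp_tanPart hD i).integrable_mul (memLp_tanPart hE i))

theorem integrable_log_mul {f : Plane → ℝ} (hf : MemLp f 2 discMeasure) :
    Integrable (fun x => Real.log ‖x‖ * f x) discMeasure :=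
  (memLp_log_norm two_ne_zero ENNReal.ofNat_ne_top).integrable_mul hf

/-- The Euler-Lagrange equation of the covering map. -/
theorem integral_bilin_coveringMap (a : ℝ) {N : ℕ} (hN : N ≠ 0) (b : Plane)
    {ψ : ℕ → Plane → Plane} {D : Plane → Mat} (h : GradTendsto ψ D)
    (hb : ∀ i, Tendsto (fun n => ∫ θ in -Real.pi..Real.pi, eR (N * θ) i * ψ n (eR θ) i)
      atTop (𝓝 0)) :
    ∫ x, bilin a x (weakGrad (coveringMap N b) x) (D x) ∂discMeasure =
      -(((N : ℝ) ^ 2 - a) / N * ∫ x, Real.log ‖x‖ *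
        frob (cof (weakGrad (coveringMap N b) x)) (D x) ∂discMeasure) := by
  have hN' : (N : ℝ) ≠ 0 := by exact_mod_cast hN
  have hpos : (0 : ℝ) < √(N : ℝ) := Real.sqrt_pos.2 (by positivity)
  have hs : √(N : ℝ) * √(N : ℝ) = N := Real.mul_self_sqrt (by positivity)
  have hU := (mapMemW12_coveringMap N b).memLp_weakGrad
  have hi : ∀ i, Integrable (fun x => (a + ((N : ℝ) ^ 2 - a) * Real.log ‖x‖) *
      eR (N * angle x) i * radPart (D x) (angle x) i +
      (N + ((N : ℝ) ^ 2 - a) / N * Real.log ‖x‖) * eTheta (N * angle x) i *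
        tanPart (D x) (angle x) i) discMeasure := fun i =>
    ((memLp_const_add_log_mul a ((N : ℝ) ^ 2 - a) (measurable_eR_mul N i)
      fun x => abs_eR_le _ i).integrable_mul (memLp_radPart h.memLp i)).add
    ((memLp_const_add_log_mul N (((N : ℝ) ^ 2 - a) / N) (measurable_eTheta_mul N i)
      fun x => abs_eTheta_le _ i).integrable_mul (memLp_tanPart h.memLp i))
  have h0 := integral_weighted_parts_eq_zero a hN h 0 (hb 0)
  have h1 := integral_weighted_parts_eq_zero a hN h 1 (hb 1)
  have hsum := integral_add (hi 0) (hi 1)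
  rw [h0, h1, add_zero] at hsum
  rw [eq_neg_iff_add_eq_zero, ← integral_const_mul, ← integral_add (integrable_bilin a hU h.memLp)
    ((integrable_log_mul (memLp_frob_cof N b h.memLp)).const_mul _)]
  -- After multiplication by `√N` the integrand is the sum over the two components of the weighted
  -- parts, whose integrals are zero.
  refine (mul_eq_zero_iff_left hpos.ne').1 ?_
  rw [← hsum, ← integral_const_mul]
  apply integral_congr_ae
  filter_upwards [weakGrad_coveringMap N b, ae_disc_mem] with x hx hx0
  have hf := frob_cof_coveringGrad hN hx0.2 (D x)
  simp only [hx, bilin, radPart_coveringGrad N hx0.2, tanPart_coveringGrad N hx0.2,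
    Fin.sum_univ_two] at hf ⊢
  rw [mul_add, show √(N : ℝ) * (((N : ℝ) ^ 2 - a) / N * (Real.log ‖x‖ *
    frob (cof (coveringGrad N x)) (D x))) = ((N : ℝ) ^ 2 - a) / N * Real.log ‖x‖ *
    (√(N : ℝ) * frob (cof (coveringGrad N x)) (D x)) by ring, hf]
  generalize (N : ℝ) * angle x = φ
  generalize √(N : ℝ) = s at *
  rw [← hs] at hN' ⊢
  field_simp
  ring

/-! The energy estimate -/

/-- A smooth approximation of the logarithm. -/
def logApprox (ε r : ℝ) : ℝ := 1 / 2 * (Real.log (r ^ 2 + ε) - Real.log (1 + ε))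

theorem hasDerivAt_logApprox {ε : ℝ} (hε : 0 < ε) (r : ℝ) :
    HasDerivAt (logApprox ε) (r / (r ^ 2 + ε)) r := by
  have hne : r ^ 2 + ε ≠ 0 := by positivity
  have h := ((((hasDerivAt_pow 2 r).add_const ε).log hne).sub_const
    (Real.log (1 + ε))).const_mul (1 / 2)
  refine h.congr_deriv ?_
  simp
  field_simp

/-- From `r² (1 + ε) ≤ r² + ε ≤ 1 + ε` the approximation lies between `log r` and `0`. This gives
the dominating function for `ε → 0`. -/
theorem abs_logApprox_le {ε r : ℝ} (hε : 0 < ε) (hr : 0 < r) (hr1 : r < 1) :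
    |logApprox ε r| ≤ |Real.log r| := by
  have h1 : Real.log (r ^ 2 + ε) ≤ Real.log (1 + ε) :=
    Real.log_le_log (by positivity) (by nlinarith)
  have h2 : Real.log (r ^ 2) + Real.log (1 + ε) ≤ Real.log (r ^ 2 + ε) := by
    rw [← Real.log_mul (by positivity) (by positivity)]
    refine Real.log_le_log (by positivity) ?_
    have : r ^ 2 ≤ 1 := pow_le_one₀ hr.le hr1.le
    nlinarith
  rw [Real.log_pow] at h2
  push_cast at h2
  rw [abs_of_nonpos (Real.log_nonpos hr.le hr1.le), logApprox, abs_of_nonpos (by linarith)]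
  linarith

theorem tendsto_logApprox {r : ℝ} (hr : 0 < r) :
    Tendsto (fun n : ℕ => logApprox (1 / ((n : ℝ) + 1)) r) atTop (𝓝 (Real.log r)) := by
  have h0 : Tendsto (fun n : ℕ => 1 / ((n : ℝ) + 1)) atTop (𝓝 0) :=
    tendsto_one_div_add_atTop_nhds_zero_nat
  have h1 : Tendsto (fun n : ℕ => Real.log (r ^ 2 + 1 / ((n : ℝ) + 1))) atTop
      (𝓝 (Real.log (r ^ 2))) := by
    refine Tendsto.log ?_ (by positivity)
    simpa using h0.const_add (r ^ 2)
  have h2 : Tendsto (fun n : ℕ => Real.log (1 + 1 / ((n : ℝ) + 1))) atTop (𝓝 (Real.log 1)) := by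
    refine Tendsto.log ?_ one_ne_zero
    simpa using h0.const_add 1
  have h := (h1.sub h2).const_mul (1 / 2)
  rw [Real.log_one, sub_zero, Real.log_pow] at h
  simpa [logApprox] using h

/-- The regularized weight is smooth and bounded, vanishes at `1`, and has derivative `r / (r² +
ε)`, so `r L' ≤ 1`. The Jacobian inequality applies to smooth maps and passes to the `L²` limit for
fixed `ε`. -/
theorem abs_integral_logApprox_det_le {ε : ℝ} (hε : 0 < ε) {ψ : ℕ → Plane → Plane}
    {D : Plane → Mat} (h : GradTendsto ψ D) :
    |2 * ∫ x, logApprox ε ‖x‖ * (D x).det ∂discMeasure| ≤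
      ∫ x, ∑ i, tanPart (D x) (angle x) i ^ 2 ∂discMeasure := by
  have hR := memLp_radPart h.memLp
  have hT := memLp_tanPart h.memLp
  have hs := fun n i => contDiff_component (h.contDiff n) i
  have hr := fun n i => memLp_radDeriv (hs n i) 2
  have ht := fun n i => memLp_angDeriv (hs n i) 2
  have hLc : Continuous (logApprox ε) :=
    continuous_iff_continuousAt.2 fun r => (hasDerivAt_logApprox hε r).continuousAt
  obtain ⟨C, hC⟩ := (isCompact_Icc (a := (0 : ℝ)) (b := 1)).exists_bound_of_continuousOn
    hLc.continuousOn
  have hLm : AEStronglyMeasurable (fun x : Plane => logApprox ε ‖x‖) discMeasure :=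
    (hLc.comp continuous_norm).aestronglyMeasurable
  have hbd : ∀ᵐ x ∂discMeasure, |logApprox ε ‖x‖| ≤ C := by
    filter_upwards [ae_disc_mem] with x hx
    obtain ⟨h0, h1⟩ := norm_mem_of_disc hx
    exact hC _ ⟨h0.le, h1.le⟩
  have hw : ∀ {f : Plane → ℝ}, MemLp f 2 discMeasure →
      MemLp (fun x => logApprox ε ‖x‖ * f x) 2 discMeasure := by
    intro f hf
    refine (hf.norm.const_mul C).mono' (hLm.mul hf.1) ?_
    filter_upwards [hbd] with x hx
    rw [norm_mul]
    exact mul_le_mul_of_nonneg_right hx (norm_nonneg _)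
  have l1 := tendsto_integral_mul_of_L2 (fun n => hw (hr n 0)) (fun n => ht n 1) (hw (hR 0)) (hT 1)
    (tendsto_eLpNorm_mul_bdd hbd (h.radPart 0)) (h.tanPart 1)
  have l2 := tendsto_integral_mul_of_L2 (fun n => hw (ht n 0)) (fun n => hr n 1) (hw (hT 0)) (hR 1)
    (tendsto_eLpNorm_mul_bdd hbd (h.tanPart 0)) (h.radPart 1)
  have l3 := tendsto_integral_mul_of_L2 (fun n => ht n 0) (fun n => ht n 0) (hT 0) (hT 0)
    (h.tanPart 0) (h.tanPart 0)
  have l4 := tendsto_integral_mul_of_L2 (fun n => ht n 1) (fun n => ht n 1) (hT 1) (hT 1)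
    (h.tanPart 1) (h.tanPart 1)
  have e1 : ∫ x, logApprox ε ‖x‖ * (D x).det ∂discMeasure =
      ∫ x, logApprox ε ‖x‖ * radPart (D x) (angle x) 0 * tanPart (D x) (angle x) 1 ∂discMeasure -
      ∫ x, logApprox ε ‖x‖ * tanPart (D x) (angle x) 0 * radPart (D x) (angle x) 1
        ∂discMeasure := by
    rw [← integral_sub (integrable_mul_of_L2 (hw (hR 0)) (hT 1)) (integrable_mul_of_L2 (hw (hT 0)) (hR 1))]
    congr 1 with x
    rw [det_eq_parts _ (angle x)]
    ring
  have e2 : ∫ x, ∑ i, tanPart (D x) (angle x) i ^ 2 ∂discMeasure =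
      ∫ x, tanPart (D x) (angle x) 0 * tanPart (D x) (angle x) 0 ∂discMeasure +
      ∫ x, tanPart (D x) (angle x) 1 * tanPart (D x) (angle x) 1 ∂discMeasure := by
    rw [← integral_add (integrable_mul_of_L2 (hT 0) (hT 0)) (integrable_mul_of_L2 (hT 1) (hT 1))]
    congr 1 with x
    rw [Fin.sum_univ_two]
    ring
  rw [e1, e2]
  refine le_of_tendsto_of_tendsto' ((l1.sub l2).const_mul 2).abs (l3.add l4) fun n => ?_
  have key := abs_integral_jacobian_le (hasDerivAt_logApprox hε)
    (Continuous.div continuous_id (by fun_prop) fun r => by positivity)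
    (by simp [logApprox]) (fun r hr => ⟨by have := hr.1; positivity, by
      rw [← mul_div_assoc, div_le_one (by positivity)]
      nlinarith⟩) (hs n 0) (hs n 1)
  rw [← integral_sub (integrable_mul_of_L2 (hw (hr n 0)) (ht n 1))
    (integrable_mul_of_L2 (hw (ht n 0)) (hr n 1)),
    ← integral_add (integrable_mul_of_L2 (ht n 0) (ht n 0)) (integrable_mul_of_L2 (ht n 1) (ht n 1))]
  simpa only [mul_sub, sq, ← mul_assoc] using key

/-- Dominated convergence as `ε → 0`: square integrability of the determinant makes its product with
the logarithm integrable. -/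
theorem abs_integral_log_det_le {ψ : ℕ → Plane → Plane} {D : Plane → Mat} (h : GradTendsto ψ D)
    (hdet : MemLp (fun x => (D x).det) 2 discMeasure) :
    |2 * ∫ x, Real.log ‖x‖ * (D x).det ∂discMeasure| ≤
      ∫ x, ∑ i, tanPart (D x) (angle x) i ^ 2 ∂discMeasure := by
  have hε : ∀ n : ℕ, 0 < 1 / ((n : ℝ) + 1) := fun n => by positivity
  have hlim : Tendsto (fun n : ℕ => ∫ x, logApprox (1 / ((n : ℝ) + 1)) ‖x‖ * (D x).det
      ∂discMeasure) atTop (𝓝 (∫ x, Real.log ‖x‖ * (D x).det ∂discMeasure)) := by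
    refine tendsto_integral_of_dominated_convergence (fun x => ‖Real.log ‖x‖ * (D x).det‖)
      (fun n => ?_) (integrable_log_mul hdet).norm (fun n => ?_) ?_
    · have hLc : Continuous (logApprox (1 / ((n : ℝ) + 1))) :=
        continuous_iff_continuousAt.2 fun r => (hasDerivAt_logApprox (hε n) r).continuousAt
      exact (hLc.comp continuous_norm).aestronglyMeasurable.mul hdet.1
    · filter_upwards [ae_disc_mem] with x hx
      obtain ⟨h0, h1⟩ := norm_mem_of_disc hx
      rw [norm_mul, norm_mul]
      exact mul_le_mul_of_nonneg_right (abs_logApprox_le (hε n) h0 h1) (norm_nonneg _)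
    · filter_upwards [ae_disc_mem] with x hx
      exact (tendsto_logApprox (norm_mem_of_disc hx).1).mul_const _
  exact le_of_tendsto' (hlim.const_mul 2).abs fun n => abs_integral_logApprox_det_le (hε n) h

/-! Stationarity and the pressure -/

theorem integrand_eq_bilin (ν a : ℝ) (x : Plane) (ξ : Mat) :
    integrand ν a x ξ = ν * bilin a x ξ ξ := by
  rw [integrand_eq, bilin]
  congr 1
  exact Finset.sum_congr rfl fun i _ => by ring

theorem frob_smul_coeff_act (ν a : ℝ) (x : Plane) (ξ ζ : Mat) :
    frob (Tensor.act (ν • coeff a x) ξ) ζ = ν * bilin a x ξ ζ := by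
  rw [bilin, ← frob_coeff_act]
  simp only [frob, Tensor.act, Fin.sum_univ_two, Matrix.of_apply, Pi.smul_apply, smul_eq_mul]
  ring

theorem bilin_add_smul (a : ℝ) (x : Plane) (ξ ζ : Mat) (t : ℝ) :
    bilin a x (ξ + t • ζ) (ξ + t • ζ) =
      bilin a x ξ ξ + t * (2 * bilin a x ξ ζ) + t ^ 2 * bilin a x ζ ζ := by
  simp only [bilin, Fin.sum_univ_two, radPart, tanPart, Matrix.add_apply, Matrix.smul_apply,
    smul_eq_mul]
  ring

theorem integral_bilin_add_smul (a : ℝ) {U H : Plane → Mat}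
    (hU : ∀ i j, MemLp (fun x => U x i j) 2 discMeasure)
    (hH : ∀ i j, MemLp (fun x => H x i j) 2 discMeasure) (t : ℝ) :
    ∫ x, bilin a x (U x + t • H x) (U x + t • H x) ∂discMeasure =
      ∫ x, bilin a x (U x) (U x) ∂discMeasure +
        t * (2 * ∫ x, bilin a x (U x) (H x) ∂discMeasure) +
        t ^ 2 * ∫ x, bilin a x (H x) (H x) ∂discMeasure := by
  simp only [bilin_add_smul]
  have i1 := integrable_bilin a hU hU
  have i2 := ((integrable_bilin a hU hH).const_mul 2).const_mul t
  have i3 := (integrable_bilin a hH hH).const_mul (t ^ 2)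
  rw [integral_add (i1.fun_add i2) i3, integral_add i1 i2, integral_const_mul, integral_const_mul,
    integral_const_mul]

theorem energy_eq (ν a : ℝ) (u : Plane → Plane) :
    energy (integrand ν a) u = ν * ∫ x, bilin a x (weakGrad u x) (weakGrad u x) ∂discMeasure := by
  rw [energy, ← integral_const_mul]
  simp only [integrand_eq_bilin]

theorem IsTest.eR_eq_zero {φ : Plane → Plane} (hφ : IsTest φ) (θ : ℝ) : φ (eR θ) = 0 :=
  image_eq_zero_of_notMem_tsupport fun h => by
    have := hφ.2.2 h
    rw [disc, mem_ball_zero_iff, norm_eR] at this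
    exact lt_irrefl _ this

/-- The energy along the line is a quadratic polynomial in `t`. Its linear coefficient is a weighted
integral of `cof ∇u·∇η`, which vanishes by the linearized constraint. -/
theorem isStationaryPoint_coveringMap (ν a : ℝ) {N : ℕ} (hN : N ≠ 0) (b : Plane) :
    IsStationaryPoint (integrand ν a) (coveringMap N b) := by
  rintro η ⟨hη, φ, hφ, -, hφη⟩ hcof
  have hU := (mapMemW12_coveringMap N b)
  have hG : GradTendsto φ (weakGrad η) := ⟨fun n => (hφ n).1, hη.memLp_weakGrad, hφη⟩
  have hEL := integral_bilin_coveringMap a hN b hG fun i => by simp [(hφ _).eR_eq_zero]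
  have h0 : ∫ x, Real.log ‖x‖ * frob (cof (weakGrad (coveringMap N b) x)) (weakGrad η x)
      ∂discMeasure = 0 := by
    refine integral_eq_zero_of_ae ?_
    filter_upwards [hcof] with x hx
    simp [hx]
  rw [h0, mul_zero, neg_zero] at hEL
  have he : ∀ t : ℝ, energy (integrand ν a) (fun x => coveringMap N b x + t • η x) =
      ν * (∫ x, bilin a x (weakGrad (coveringMap N b) x) (weakGrad (coveringMap N b) x)
        ∂discMeasure + t ^ 2 * ∫ x, bilin a x (weakGrad η x) (weakGrad η x) ∂discMeasure) := by
    intro t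
    have h := integral_bilin_add_smul a hU.memLp_weakGrad hη.memLp_weakGrad t
    rw [hEL, mul_zero, mul_zero, add_zero] at h
    rw [energy_eq, ← h]
    congr 1
    apply integral_congr_ae
    filter_upwards [(hU.hasWeakGrad.add_smul hη.hasWeakGrad t).weakGrad_ae_eq] with x hx
    rw [hx]
  simp only [he]
  have h := ((hasDerivAt_pow 2 (0 : ℝ)).mul_const
    (∫ x, bilin a x (weakGrad η x) (weakGrad η x) ∂discMeasure)).const_add
    (∫ x, bilin a x (weakGrad (coveringMap N b) x) (weakGrad (coveringMap N b) x) ∂discMeasure)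
    |>.const_mul ν
  simpa using h

theorem gradTendsto_jac {φ : Plane → Plane} (hφ : ContDiff ℝ ∞ φ) :
    GradTendsto (fun _ => φ) (jac φ) :=
  ⟨fun _ => hφ, fun i j => memLp_jac hφ i j 2, fun i j => by simp⟩

theorem isPressure_log (ν a : ℝ) {N : ℕ} (hN : N ≠ 0) (b : Plane) :
    IsPressure (fun x => ν • coeff a x) (coveringMap N b)
      (fun x => ν * (((N : ℝ) ^ 2 - a) / N) * Real.log ‖x‖) := by
  intro η hη
  have h := integral_bilin_coveringMap a hN b (gradTendsto_jac hη.1)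
    fun i => by simp [hη.eR_eq_zero]
  simp only [frob_smul_coeff_act, mul_assoc]
  rw [integral_const_mul, h, integral_const_mul, integral_const_mul]
  ring

theorem contDiffOn_log_norm : ContDiffOn ℝ ∞ (fun x : Plane => Real.log ‖x‖) {0}ᶜ := fun _ hx =>
  ((contDiffAt_norm ℝ hx).log (norm_ne_zero_iff.2 hx)).contDiffWithinAt

theorem abs_partialDeriv_log_norm_le (j : Fin 2) {x : Plane} (hx : x ≠ 0) :
    |partialDeriv j (fun x : Plane => Real.log ‖x‖) x| ≤ 1 * ‖x‖ ^ (-1 : ℝ) := by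
  have hpos := norm_pos_iff.2 hx
  have h := abs_partialDeriv_le (fun x : Plane => Real.log ‖x‖) x (angle x) j
  have hd : DifferentiableAt ℝ (fun x : Plane => Real.log ‖x‖) (‖x‖ • eR (angle x)) := by
    rw [norm_smul_eR_angle]
    exact differentiableAt_of_contDiffOn contDiffOn_log_norm hx
  have h1 := (hasDerivAt_radial hd).unique ((Real.hasDerivAt_log hpos.ne').congr_of_eventuallyEq
    (by filter_upwards [lt_mem_nhds hpos] with s hs; rw [norm_smul_eR hs.le]))
  have h2 := (hasDerivAt_angular hd).unique (by
    simp only [norm_smul_eR hpos.le]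
    exact hasDerivAt_const _ _)
  rw [norm_smul_eR_angle] at h1 h2
  rw [smul_eq_mul, mul_eq_zero, or_iff_right hpos.ne'] at h2
  rw [h1, h2, abs_zero, add_zero, abs_of_pos (inv_pos.2 hpos)] at h
  rwa [Real.rpow_neg_one, one_mul]

theorem memLp_partialDeriv_log_norm (j : Fin 2) {q : ℝ≥0∞} (hq1 : 1 ≤ q) (hq : q < 2) :
    MemLp (partialDeriv j fun x : Plane => Real.log ‖x‖) q discMeasure :=
  memLp_of_le_inv_norm (aestronglyMeasurable_of_contDiffOn
    (continuousOn_partialDeriv contDiffOn_log_norm j))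
    (fun _ hx => abs_partialDeriv_log_norm_le j hx) hq1 hq

theorem hasWeakPartial_log_norm (j : Fin 2) :
    HasWeakPartial j (fun x : Plane => Real.log ‖x‖)
      (partialDeriv j fun x : Plane => Real.log ‖x‖) := by
  refine hasWeakPartial_of_contDiffOn contDiffOn_log_norm ?_
    (memLp_partialDeriv_log_norm j le_rfl (by norm_num))
  have hm : Measurable fun x : Plane => Real.log ‖x‖ / ‖x‖ := by fun_prop
  -- The bound `|log r| ≤ 2 r^(-1/2)` gives `|log r| / r ≤ 2 r^(-3/2)`, and `3/2 < 2`.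
  refine ((memLp_norm_rpow_neg (s := 3 / 2) one_ne_zero ENNReal.one_ne_top
    (by norm_num)).const_mul 2).mono' hm.aestronglyMeasurable ?_
  filter_upwards [ae_disc_mem] with x hx
  obtain ⟨h0, h1⟩ := norm_mem_of_disc hx
  have h := abs_log_le_rpow h0 h1.le (s := 1 / 2) (by norm_num)
  rw [norm_div, norm_norm, Real.norm_eq_abs, div_le_iff₀ h0, mul_assoc,
    show (-(3 / 2) : ℝ) = -(1 / 2) - 1 by norm_num, Real.rpow_sub_one h0.ne',
    div_mul_cancel₀ _ h0.ne']
  simpa using h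

theorem memW1_const_mul_log_norm (c : ℝ) {q : ℝ≥0∞} (hq1 : 1 ≤ q) (hq : q < 2) :
    MemW1 q fun x : Plane => c * Real.log ‖x‖ := by
  have hq0 : q ≠ 0 := (zero_lt_one.trans_le hq1).ne'
  refine ⟨(memLp_log_norm hq0 hq.ne_top).const_mul c, fun j => ⟨fun x => 0 + c *
    partialDeriv j (fun x : Plane => Real.log ‖x‖) x, ?_, ?_⟩⟩
  · have h0 := hasWeakPartial_of_contDiff (contDiff_const (c := (0 : ℝ)) (𝕜 := ℝ) (E := Plane)
      (n := ∞)) j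
    have h := h0.add_const_mul (hasWeakPartial_log_norm j) c
    simpa [partialDeriv] using h
  · simpa using (memLp_partialDeriv_log_norm j hq1 hq).const_mul c

/-! Minimality -/

/-- Traces are measured on `(0, 2π]`, polar coordinates use `(-π, π)`; periodicity reconciles them.
-/
theorem integral_circle_eq {F : ℝ → ℝ} (hF : Function.Periodic F (2 * Real.pi)) :
    ∫ θ in -Real.pi..Real.pi, F θ = ∫ θ in Ioc 0 (2 * Real.pi), F θ := by
  have h := hF.intervalIntegral_add_eq (-Real.pi) 0
  rw [show -Real.pi + 2 * Real.pi = Real.pi by ring, zero_add] at h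
  rw [h, intervalIntegral.integral_of_le (by linarith [pi_pos])]

theorem eR_add_two_pi (θ : ℝ) : eR (θ + 2 * Real.pi) = eR θ := by
  rw [eR_congr_iff]
  simp

theorem tendsto_integral_circle {ψ : ℕ → Plane → Plane} (hψ : ∀ n, ContDiff ℝ ∞ (ψ n))
    (h : Tendsto (fun n => eLpNorm (fun θ => ψ n (eR θ)) 2
      (volume.restrict (Ioc 0 (2 * Real.pi)))) atTop (𝓝 0)) (i : Fin 2) :
    (∀ N : ℕ, Tendsto (fun n => ∫ θ in -Real.pi..Real.pi, eR (N * θ) i * ψ n (eR θ) i)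
      atTop (𝓝 0)) ∧
    Tendsto (fun n => ∫ θ in -Real.pi..Real.pi, ψ n (eR θ) i ^ 2) atTop (𝓝 0) := by
  have hc : ∀ n, Continuous fun θ => ψ n (eR θ) i := fun n =>
    (contDiff_component (hψ n) i).continuous.comp continuous_eR
  have hL : ∀ {F : ℝ → ℝ}, Continuous F → MemLp F 2 (volume.restrict (Ioc 0 (2 * Real.pi))) := by
    intro F hF
    obtain ⟨C, hC⟩ := (isCompact_Icc (a := 0) (b := 2 * Real.pi)).exists_bound_of_continuousOn
      hF.continuousOn
    refine MemLp.of_bound hF.aestronglyMeasurable C ?_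
    filter_upwards [ae_restrict_mem measurableSet_Ioc] with x hx
    exact hC x (Ioc_subset_Icc_self hx)
  have h0 : Tendsto (fun n => eLpNorm (fun θ => ψ n (eR θ) i - 0) 2
      (volume.restrict (Ioc 0 (2 * Real.pi)))) atTop (𝓝 0) := by
    simpa using tendsto_eLpNorm_component h i
  have hz : MemLp (fun _ : ℝ => (0 : ℝ)) 2 (volume.restrict (Ioc 0 (2 * Real.pi))) := by simp
  constructor
  · intro N
    have hw : MemLp (fun θ => eR (N * θ) i) 2 (volume.restrict (Ioc 0 (2 * Real.pi))) :=
      hL (by fun_prop)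
    have l := tendsto_integral_mul_of_L2 (fun _ => hw) (fun n => hL (hc n)) hw hz (by simp) h0
    simp only [mul_zero, integral_zero] at l
    refine l.congr fun n => (integral_circle_eq fun θ => ?_).symm
    rw [eR_nat_mul_congr N (eR_add_two_pi θ), eR_add_two_pi]
  · have l := tendsto_integral_mul_of_L2 (fun n => hL (hc n)) (fun n => hL (hc n)) hz hz h0 h0
    simp only [mul_zero, integral_zero] at l
    simp only [← sq] at l
    refine l.congr fun n => (integral_circle_eq fun θ => ?_).symm
    rw [eR_add_two_pi]

/-- Differences of maps with the same trace are limits of smooth maps with vanishing trace. -/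
theorem exists_tendsto_sub {u v : Plane → Plane} {h : ℝ → Plane} (hu : MapMemW12 u)
    (hv : MapMemW12 v) (hut : HasTrace u h) (hvt : HasTrace v h)
    (hh : Continuous h) :
    ∃ ψ : ℕ → Plane → Plane, GradTendsto ψ (fun x => weakGrad v x - weakGrad u x) ∧
      (∀ i, Tendsto (fun n => eLpNorm (fun x => ψ n x i - (v x i - u x i)) 2 discMeasure)
        atTop (𝓝 0)) ∧
      Tendsto (fun n => eLpNorm (fun θ => ψ n (eR θ)) 2 (volume.restrict (Ioc 0 (2 * Real.pi))))
        atTop (𝓝 0) := by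
  obtain ⟨α, hα, ⟨hαu, hαG⟩, hαt⟩ := hut
  obtain ⟨β, hβ, ⟨hβv, hβG⟩, hβt⟩ := hvt
  have hsub : ∀ n, ContDiff ℝ ∞ (fun x => β n x - α n x) := fun n => (hβ n).sub (hα n)
  have hcomp : ∀ {φ : Plane → Plane}, ContDiff ℝ ∞ φ → ∀ i,
      AEStronglyMeasurable (fun x => φ x i) discMeasure := fun hφ i =>
    (contDiff_component hφ i).continuous.aestronglyMeasurable
  refine ⟨fun n x => β n x - α n x, ⟨hsub, fun i j => (hv.memLp_weakGrad i j).sub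
    (hu.memLp_weakGrad i j), fun i j => ?_⟩, fun i => ?_, ?_⟩
  · refine (tendsto_eLpNorm_sub one_le_two
      (fun n => (memLp_jac (hβ n) i j 2).1.sub (hv.memLp_weakGrad i j).1)
      (fun n => (memLp_jac (hα n) i j 2).1.sub (hu.memLp_weakGrad i j).1)
      (hβG i j) (hαG i j)).congr fun n => ?_
    congr 1 with x
    have e : jac (fun x => β n x - α n x) x i j = jac (β n) x i j - jac (α n) x i j := by
      simp only [jac, Matrix.of_apply]
      rw [fderiv_fun_sub ((hβ n).differentiable (by simp) x) ((hα n).differentiable (by simp) x)]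
      rfl
    rw [e, Matrix.sub_apply]
    simp only [Pi.sub_apply]
    ring
  · refine (tendsto_eLpNorm_sub one_le_two
      (fun n => (hcomp (hβ n) i).sub (hv i).1.1) (fun n => (hcomp (hα n) i).sub (hu i).1.1)
      (tendsto_eLpNorm_component hβv i) (tendsto_eLpNorm_component hαu i)).congr fun n => ?_
    congr 1 with x
    simp only [PiLp.sub_apply, Pi.sub_apply]
    ring
  · have hm : ∀ {φ : Plane → Plane}, ContDiff ℝ ∞ φ → AEStronglyMeasurable
        (fun θ => φ (eR θ) - h θ) (volume.restrict (Ioc 0 (2 * Real.pi))) := fun hφ =>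
      ((hφ.continuous.comp continuous_eR).sub hh).aestronglyMeasurable
    have l := hβt.add hαt
    rw [add_zero] at l
    refine tendsto_of_tendsto_of_tendsto_of_le_of_le tendsto_const_nhds l (fun _ => zero_le)
      fun n => ?_
    have e : (fun θ => β n (eR θ) - α n (eR θ)) =
        (fun θ => β n (eR θ) - h θ) - fun θ => α n (eR θ) - h θ := by
      funext θ
      simp
    rw [e]
    exact eLpNorm_sub_le (hm (hβ n)) (hm (hα n)) one_le_two

theorem continuous_boundaryData (N : ℕ) (b : Plane) : Continuous (boundaryData N b) := by
  unfold boundaryData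
  fun_prop

/-- Both determinants equal `1`, so the two non-constant terms of the expansion of `det (∇u + D)`
cancel. -/
theorem frob_cof_eq_neg_det {N : ℕ} {b : Plane} {v : Plane → Plane} (hN : N ≠ 0)
    (hv : v ∈ Admissible (boundaryData N b)) :
    ∀ᵐ x ∂discMeasure, frob (cof (weakGrad (coveringMap N b) x))
      (weakGrad v x - weakGrad (coveringMap N b) x) =
        -(weakGrad v x - weakGrad (coveringMap N b) x).det := by
  filter_upwards [hv.2.1, (coveringMap_mem_admissible hN b).2.1] with x h1 h2
  have h := det_add_eq (weakGrad (coveringMap N b) x)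
    (weakGrad v x - weakGrad (coveringMap N b) x)
  rw [add_sub_cancel, h1, h2] at h
  linarith

theorem integral_bilin_self (a : ℝ) {D : Plane → Mat}
    (hD : ∀ i j, MemLp (fun x => D x i j) 2 discMeasure) :
    ∫ x, bilin a x (D x) (D x) ∂discMeasure =
      a * ∫ x, ∑ i, radPart (D x) (angle x) i ^ 2 ∂discMeasure +
        ∫ x, ∑ i, tanPart (D x) (angle x) i ^ 2 ∂discMeasure := by
  have hR : Integrable (fun x => ∑ i, radPart (D x) (angle x) i ^ 2) discMeasure :=
    integrable_finsetSum _ fun i _ => (memLp_radPart hD i).integrable_sq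
  have hT : Integrable (fun x => ∑ i, tanPart (D x) (angle x) i ^ 2) discMeasure :=
    integrable_finsetSum _ fun i _ => (memLp_tanPart hD i).integrable_sq
  rw [← integral_const_mul, ← integral_add (hR.const_mul a) hT]
  congr 1 with x
  simp only [bilin, Fin.sum_univ_two]
  ring

/-- The excess energy controls the radial derivative of the difference to the covering map. -/
theorem energy_excess {ν a : ℝ} (hν : 0 < ν) {N : ℕ} (hN : N ≠ 0)
    (ha : |(N : ℝ) ^ 2 - a| ≤ N) {b : Plane} {v : Plane → Plane}
    (hv : v ∈ Admissible (boundaryData N b)) :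
    energy (integrand ν a) (coveringMap N b) + ν * (a * ∫ x, ∑ i, radPart
      (weakGrad v x - weakGrad (coveringMap N b) x) (angle x) i ^ 2 ∂discMeasure) ≤
      energy (integrand ν a) v := by
  have hU := mapMemW12_coveringMap N b
  have hNpos : (0 : ℝ) < N := by positivity
  obtain ⟨ψ, hψ, -, hψt⟩ := exists_tendsto_sub hU hv.1 (hasTrace_coveringMap N b) hv.2.2
    (continuous_boundaryData N b)
  set D : Plane → Mat := fun x => weakGrad v x - weakGrad (coveringMap N b) x with hDdef
  have hEL := integral_bilin_coveringMap a hN b hψ fun i =>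
    (tendsto_integral_circle hψ.contDiff hψt i).1 N
  have hcof := frob_cof_eq_neg_det hN hv
  -- A product of two `L²` functions is a priori only in `L¹`; the constraint rewrites it as a
  -- bounded coefficient times `D`.
  have hdet : MemLp (fun x => (D x).det) 2 discMeasure := by
    refine (memLp_frob_cof N b hψ.memLp).neg.ae_eq ?_
    filter_upwards [hcof] with x hx
    rw [Pi.neg_apply, hx, neg_neg]
  have hlog := abs_integral_log_det_le hψ hdet
  have e1 : ∫ x, Real.log ‖x‖ * frob (cof (weakGrad (coveringMap N b) x)) (D x) ∂discMeasure =
      -∫ x, Real.log ‖x‖ * (D x).det ∂discMeasure := by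
    rw [← integral_neg]
    apply integral_congr_ae
    filter_upwards [hcof] with x hx
    rw [hx]
    ring
  -- At `t = 1` the line through `∇u` in direction `D` reaches `∇v`.
  have hE := integral_bilin_add_smul a hU.memLp_weakGrad hψ.memLp 1
  have e2 : ∀ x, weakGrad (coveringMap N b) x + (1 : ℝ) • D x = weakGrad v x := fun x => by
    rw [one_smul, hDdef, add_sub_cancel]
  simp only [e2] at hE
  rw [energy_eq, energy_eq, hE, hEL, e1, integral_bilin_self a hψ.memLp, ← mul_add]
  refine mul_le_mul_of_nonneg_left ?_ hν.le
  set τ := ∫ x, ∑ i, tanPart (D x) (angle x) i ^ 2 ∂discMeasure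
  set I := ∫ x, Real.log ‖x‖ * (D x).det ∂discMeasure
  have hτ : 0 ≤ τ := (abs_nonneg _).trans hlog
  -- This is where the range of `a` enters: the pressure coefficient is small enough for the linear
  -- term to be absorbed by `τ`.
  have hk : |((N : ℝ) ^ 2 - a) / N| ≤ 1 := by
    rw [abs_div, abs_of_pos hNpos, div_le_one hNpos]
    exact ha
  have h1 : |((N : ℝ) ^ 2 - a) / N * (2 * I)| ≤ τ := by
    rw [abs_mul]
    calc _ ≤ 1 * τ := mul_le_mul hk hlog (abs_nonneg _) zero_le_one
      _ = τ := one_mul τ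
  have h2 := neg_le_of_abs_le h1
  nlinarith

/-- A difference with zero trace and zero radial derivative vanishes along rays; the Poincaré
inequality makes this precise for Sobolev maps. -/
theorem ae_eq_of_integral_radPart_eq_zero {N : ℕ} {b : Plane} {v : Plane → Plane}
    (hv : v ∈ Admissible (boundaryData N b))
    (h0 : ∫ x, ∑ i, radPart (weakGrad v x - weakGrad (coveringMap N b) x) (angle x) i ^ 2
      ∂discMeasure = 0) : v =ᵐ[discMeasure] coveringMap N b := by
  have hU := mapMemW12_coveringMap N b
  obtain ⟨ψ, hψ, hψv, hψt⟩ := exists_tendsto_sub hU hv.1 (hasTrace_coveringMap N b) hv.2.2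
    (continuous_boundaryData N b)
  have hR := memLp_radPart hψ.memLp
  have hi : ∀ i, (fun x => v x i) =ᵐ[discMeasure] fun x => coveringMap N b x i := by
    intro i
    have hs := fun n => contDiff_component (hψ.contDiff n) i
    have hw : MemLp (fun x => v x i - coveringMap N b x i) 2 discMeasure :=
      (hv.1 i).1.sub (hU i).1
    have hz : ∫ x, radPart (weakGrad v x - weakGrad (coveringMap N b) x) (angle x) i ^ 2
        ∂discMeasure = 0 := by
      refine le_antisymm (le_trans ?_ h0.le) (integral_nonneg fun x => sq_nonneg _)
      refine integral_mono (hR i).integrable_sq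
        (integrable_finsetSum _ fun i _ => (hR i).integrable_sq) fun x => ?_
      exact Finset.single_le_sum (f := fun i => radPart (weakGrad v x -
        weakGrad (coveringMap N b) x) (angle x) i ^ 2) (fun i _ => sq_nonneg _) (Finset.mem_univ i)
    have l1 := tendsto_integral_mul_of_L2 (fun n => memLp_disc_of_continuous (hs n).continuous 2)
      (fun n => memLp_disc_of_continuous (hs n).continuous 2) hw hw (hψv i) (hψv i)
    have l2 := tendsto_integral_mul_of_L2 (fun n => memLp_radDeriv (hs n) 2)
      (fun n => memLp_radDeriv (hs n) 2) (hR i) (hR i) (hψ.radPart i) (hψ.radPart i)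
    have l3 := (tendsto_integral_circle hψ.contDiff hψt i).2
    simp only [← sq] at l1 l2
    have l4 := l3.add l2
    rw [hz, add_zero] at l4
    -- Both the boundary integrals and the radial energies of the approximants tend to zero, so the
    -- limiting `L²` norm is zero.
    have hle := le_of_tendsto_of_tendsto' l1 l4 fun n => integral_sq_le (hs n)
    have he := le_antisymm hle (integral_nonneg fun x => sq_nonneg _)
    rw [integral_eq_zero_iff_of_nonneg (fun x => sq_nonneg _) hw.integrable_sq] at he
    filter_upwards [he] with x hx
    exact sub_eq_zero.1 (pow_eq_zero_iff two_ne_zero |>.1 hx)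
  filter_upwards [hi 0, hi 1] with x h1 h2
  ext i
  fin_cases i
  exacts [h1, h2]

end IncompressibleDisc

end

open IncompressibleDisc

theorem mainTheorem10 (ν : ℝ) (hν : 0 < ν) (b : Plane) (N : ℕ) (hN : 2 ≤ N) (a : ℝ)
    (ha : a ∈ Ioo ((N : ℝ) ^ 2 - N) ((N : ℝ) ^ 2 + N)) :
    -- (i) the integrand is given by a bounded, uniformly positive coefficient tensor
    ((∀ i j k l, MemLp (fun x => coeff a x i j k l) ⊤ discMeasure) ∧
      (∀ x ∈ disc \ {0}, ∀ ξ : Mat,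
        integrand ν a x ξ = ν * frob ((coeff a x).act ξ) ξ ∧
        ν * frob ξ ξ ≤ ν * frob ((coeff a x).act ξ) ξ)) ∧
    -- (ii) the coefficients and the integrand are discontinuous at the origin
    ((¬ ∃ L : Tensor, Tendsto (coeff a) (𝓝[≠] 0) (𝓝 L)) ∧
      (∀ ξ : Mat, ¬ IsConformalMat ξ →
        ¬ ∃ l : ℝ, Tendsto (fun x => integrand ν a x ξ) (𝓝[≠] 0) (𝓝 l))) ∧
    -- (iii) the Sobolev regularity of the coefficients and of the integrand
    (((∀ q : ℝ≥0∞, 1 ≤ q → q < 2 → TensorMemW1 q (coeff a)) ∧ ¬ TensorMemW1 2 (coeff a)) ∧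
      (∀ ξ : Mat, ¬ IsConformalMat ξ →
        (∀ q : ℝ≥0∞, 1 ≤ q → q < 2 → MemW1 q fun x => integrand ν a x ξ) ∧
        ¬ MemW1 2 fun x => integrand ν a x ξ)) ∧
    -- (iv) the covering map is Lipschitz, not continuously differentiable, and stationary
    ((∃ K, LipschitzOnWith K (coveringMap N b) disc) ∧
      ¬ ContDiffOn ℝ 1 (coveringMap N b) disc ∧
      IsStationaryPoint (integrand ν a) (coveringMap N b) ∧
      ∃ p : Plane → ℝ, (∀ q : ℝ≥0∞, 1 ≤ q → q < 2 → MemW1 q p) ∧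
        IsPressure (fun x => ν • coeff a x) (coveringMap N b) p) ∧
    -- (v) the covering map is the unique global minimizer
    (coveringMap N b ∈ Admissible (boundaryData N b) ∧
      (∀ v ∈ Admissible (boundaryData N b),
        energy (integrand ν a) (coveringMap N b) ≤ energy (integrand ν a) v) ∧
      (∀ v ∈ Admissible (boundaryData N b),
        energy (integrand ν a) v = energy (integrand ν a) (coveringMap N b) →
          v =ᵐ[discMeasure] coveringMap N b)) ∧
    -- (vi) the minimal energy
    IsLeast (energy (integrand ν a) '' Admissible (boundaryData N b))
      (ν * Real.pi * (a / N + N)) := by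
  have hN2 : (2 : ℝ) ≤ N := by exact_mod_cast hN
  have hN0 : N ≠ 0 := by omega
  -- Indeed `a > N(N - 1) ≥ 2`. This gives coercivity with constant `1` and the nonconstancy `a ≠ 1`
  -- behind (ii) and (iii).
  have ha1 : 1 < a := by nlinarith [ha.1]
  have haN : |(N : ℝ) ^ 2 - a| ≤ N := by
    rw [abs_le]
    constructor <;> linarith [ha.1, ha.2]
  have hmin : ∀ v ∈ Admissible (boundaryData N b),
      energy (integrand ν a) (coveringMap N b) ≤ energy (integrand ν a) v := by
    intro v hv
    refine le_trans (le_add_of_nonneg_right ?_) (energy_excess hν hN0 haN hv)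
    have : 0 ≤ ∫ x, ∑ i, radPart (weakGrad v x - weakGrad (coveringMap N b) x) (angle x) i ^ 2
      ∂discMeasure := integral_nonneg fun x => Finset.sum_nonneg fun i _ => sq_nonneg _
    positivity
  refine ⟨⟨coeff_memLp_top a, fun x _ ξ => ⟨integrand_eq_coeff ν a x ξ,
      mul_le_mul_of_nonneg_left (coeff_coercive ha1.le x ξ) hν.le⟩⟩,
    ⟨coeff_not_tendsto ha1.ne', fun ξ hξ => integrand_not_tendsto hν.ne' ha1.ne' hξ⟩,
    ⟨⟨fun q h1 h2 => coeff_memW1 a h1 h2, coeff_not_memW1 ha1.ne'⟩, fun ξ hξ =>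
      ⟨fun q h1 h2 => integrand_memW1 ν a ξ h1 h2, integrand_not_memW1 hν.ne' ha1.ne' hξ⟩⟩,
    ⟨⟨_, (lipschitzWith_coveringMap N b).lipschitzOnWith⟩, not_contDiffOn_coveringMap hN b,
      isStationaryPoint_coveringMap ν a hN0 b, _,
      fun q h1 h2 => memW1_const_mul_log_norm _ h1 h2, isPressure_log ν a hN0 b⟩,
    ⟨coveringMap_mem_admissible hN0 b, hmin, fun v hv hE => ?_⟩,
    ⟨coveringMap N b, coveringMap_mem_admissible hN0 b, energy_coveringMap ν a hN0 b⟩, ?_⟩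
  · refine ae_eq_of_integral_radPart_eq_zero hv (le_antisymm ?_ (integral_nonneg fun x =>
      Finset.sum_nonneg fun i _ => sq_nonneg _))
    have h := energy_excess hν hN0 haN hv
    -- Equal energies leave no room for the excess term, so the radial integral is nonpositive.
    rw [hE, add_le_iff_nonpos_right, ← mul_assoc] at h
    have hpos : 0 < ν * a := by positivity
    exact nonpos_of_mul_nonpos_right h hpos
  · rintro _ ⟨v, hv, rfl⟩
    rw [← energy_coveringMap ν a hN0 b]
    exact hmin v hv
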